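/- A facility-client graph $G=(F,C,E,\mathrm{cost})$ consists of a finite set $F$ of facilities, a finite set $C$ of potential clients, a set $E\subseteq F\times C$ of available connections, and arbitrary non-negative rational costs of the facilities and of the connections. A feasible solution for a set $A\subseteq C$ of active clients is a set $F'\subseteq F$ of opened facilities together with a set $E'\subseteq E$ of purchased connections such that every $c\in A$ has a connection $(f,c)\in E'$ with $f\in F'$; its cost is $\sum_{f\in F'}\mathrm{cost}(f)+\sum_{e\in E'}\mathrm{cost}(e)$. Let $\mathrm{OPT}(G,A)$ be the minimum cost of a feasible solution. In the online problem, $G$ is known in advance and the (distinct) clients of an unknown set $A$ arrive one by one; on each arrival an online algorithm may purchase further facilities and connections, irrevocably, and its purchases so far must be a feasible solution for the clients that have arrived so far (each of which is incident to at least one edge of $E$). Let $\mathrm{ALG}(G,A)$ denote the total cost of its purchases. **Theorem.** There are a deterministic online algorithm for this problem and a universal constant $K$ such that the algorithm runs in polynomial time (its purchases on each arrival are computed in time polynomial in the bit length of the description of $G$, with costs written in binary, and of the clients that have arrived so far), it always maintains a feasible solution, and for every $G$ with $|F|\ge 2$ and $|C|\ge 2$ and every sequence of arriving clients with set $A$,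 $$\mathrm{ALG}(G,A)\le K\cdot\log_2|F|\cdot\bigl(\log_2|C|+\log_2\log_2|F|\bigr)\cdot\mathrm{OPT}(G,A).$$ -/

import Mathlib

/-! ## A deterministic machine model with logarithmic (bit) cost

Programs are structured programs of a random access machine.  The memory consists of arrays of
natural numbers of unbounded size; a program mentions only finitely many arrays.  Every operation
is charged the bit lengths of the numbers and of the addresses that it handles, so that polynomial
time here is polynomial time in the usual (Turing machine) sense. -/

/-- `σ a i` is the content of cell `i` of array `a`. -/
abbrev Memory : Type := ℕ → ℕ → ℕ

/-- The arithmetic operations of the machine. -/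
inductive BinOp : Type
  | add | sub | mul | div | mod | lt | eq

/-- Subtraction is truncated, division is integer division (with value `0` for divisor `0`),
comparisons return `1` (true) or `0` (false). -/
def BinOp.eval : BinOp → ℕ → ℕ → ℕ
  | .add, x, y => x + y
  | .sub, x, y => x - y
  | .mul, x, y => x * y
  | .div, x, y => x / y
  | .mod, x, y => x % y
  | .lt, x, y => if x < y then 1 else 0
  | .eq, x, y => if x = y then 1 else 0

/-- Expressions: numerals, array accesses `a[i]`, and operations. -/
inductive Expr : Type
  | lit (n : ℕ)
  | get (a : ℕ) (i : Expr)
  | bin (o : BinOp) (x y : Expr)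

/-- The value of an expression. -/
def Expr.eval (σ : Memory) : Expr → ℕ
  | .lit n => n
  | .get a i => σ a (i.eval σ)
  | .bin o x y => o.eval (x.eval σ) (y.eval σ)

/-- The time for evaluating an expression; `Nat.size x` is the bit length of `x`. -/
def Expr.time (σ : Memory) : Expr → ℕ
  | .lit n => 1 + n.size
  | .get a i => i.time σ + (1 + (i.eval σ).size + (σ a (i.eval σ)).size)
  | .bin o x y => x.time σ + y.time σ +
      (1 + (x.eval σ).size + (y.eval σ).size + (o.eval (x.eval σ) (y.eval σ)).size)

/-- Structured programs: `set a i e` is the assignment `a[i] := e`, `loop b p` is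
"while `b ≠ 0` do `p`". -/
inductive Prog : Type
  | skip
  | set (a : ℕ) (i e : Expr)
  | seq (p q : Prog)
  | ite (b : Expr) (p q : Prog)
  | loop (b : Expr) (p : Prog)

/-- `Exec p σ σ' t`: started in memory `σ`, the program `p` halts in memory `σ'` after time `t`. -/
inductive Exec : Prog → Memory → Memory → ℕ → Prop
  | skip (σ : Memory) : Exec .skip σ σ 1
  | set (σ : Memory) (a : ℕ) (i e : Expr) :
      Exec (.set a i e) σ
        (Function.update σ a (Function.update (σ a) (i.eval σ) (e.eval σ)))
        (i.time σ + e.time σ + (1 + (i.eval σ).size + (e.eval σ).size))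
  | seq {p q : Prog} {σ σ' σ'' : Memory} {t t' : ℕ} :
      Exec p σ σ' t → Exec q σ' σ'' t' → Exec (.seq p q) σ σ'' (t + t')
  | ite_true {b : Expr} {p q : Prog} {σ σ' : Memory} {t : ℕ} :
      b.eval σ ≠ 0 → Exec p σ σ' t → Exec (.ite b p q) σ σ' (b.time σ + 1 + t)
  | ite_false {b : Expr} {p q : Prog} {σ σ' : Memory} {t : ℕ} :
      b.eval σ = 0 → Exec q σ σ' t → Exec (.ite b p q) σ σ' (b.time σ + 1 + t)
  | loop_done {b : Expr} {p : Prog} {σ : Memory} :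
      b.eval σ = 0 → Exec (.loop b p) σ σ (b.time σ + 1)
  | loop_step {b : Expr} {p : Prog} {σ σ' σ'' : Memory} {t t' : ℕ} :
      b.eval σ ≠ 0 → Exec p σ σ' t → Exec (.loop b p) σ' σ'' t' →
        Exec (.loop b p) σ σ'' (b.time σ + 1 + t + t')

/-- The initial memory on input `w`: cell `0` of array `0` holds the length of `w`, the following
cells of array `0` hold the entries of `w`, and everything else is `0`. -/
def loadInput (w : List ℕ) : Memory :=
  fun a i => if a = 0 then (w.length :: w).getD i 0 else 0

/-- The output is the word `w`: array `1` holds the length of `w` followed by its entries. -/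
def OutputIs (σ : Memory) (w : List ℕ) : Prop :=
  ∀ i < w.length + 1, σ 1 i = (w.length :: w).getD i 0

/-- The size of a word of natural numbers: the total number of bits of its entries, plus one
delimiter per entry. -/
def wordSize (w : List ℕ) : ℕ := (w.map fun x => x.size + 1).sum

/-- `out : α → List ℕ` is computable in time polynomial in the size of the encoding `enc` of its
argument, by a single program. -/
def PolyTimeComputable {α : Type} (enc out : α → List ℕ) : Prop :=
  ∃ (p : Prog) (P : Polynomial ℕ), ∀ x : α, ∃ (σ : Memory) (t : ℕ),
    Exec p (loadInput (enc x)) σ t ∧ OutputIs σ (out x) ∧ t ≤ P.eval (wordSize (enc x))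

/-! ## Non-metric facility location -/

/-- A facility-client graph `(F, C, E, cost)`, with `F = Fin nF` and `C = Fin nC`, and with
arbitrary non-negative (rational) opening and connection costs.  The values of `edgeCost` outside
`edges` play no role. -/
structure FCGraph : Type where
  nF : ℕ
  nC : ℕ
  edges : Finset (Fin nF × Fin nC)
  facilityCost : Fin nF → ℚ≥0
  edgeCost : Fin nF × Fin nC → ℚ≥0

/-- A set of purchased facilities and a set of purchased edges. -/
structure Purchase (G : FCGraph) : Type where
  facilities : Finset (Fin G.nF)
  edges : Finset (Fin G.nF × Fin G.nC)

/-- The sum of opening and connection costs. -/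
def Purchase.cost {G : FCGraph} (S : Purchase G) : ℚ≥0 :=
  ∑ f ∈ S.facilities, G.facilityCost f + ∑ e ∈ S.edges, G.edgeCost e

/-- `S` is a feasible solution to the instance `(G, A)`: only edges of `G` are purchased, and every
active client is connected by a purchased edge to an open facility. -/
def Purchase.Feasible {G : FCGraph} (S : Purchase G) (A : Finset (Fin G.nC)) : Prop :=
  S.edges ⊆ G.edges ∧ ∀ c ∈ A, ∃ f ∈ S.facilities, (f, c) ∈ S.edges

/-- A deterministic online algorithm: `alg G [c₁, …, cₖ]` is what is purchased upon the arrival of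
`cₖ`, when the graph `G` is known and the clients `c₁, …, cₖ` have arrived in this order. -/
abbrev OnlineAlgorithm : Type := (G : FCGraph) → List (Fin G.nC) → Purchase G

namespace OnlineAlgorithm

/-- Everything that has been purchased after the clients of the list `A` have arrived one by one. -/
def total (alg : OnlineAlgorithm) (G : FCGraph) (A : List (Fin G.nC)) : Purchase G where
  facilities := (Finset.range A.length).biUnion fun i => (alg G (A.take (i + 1))).facilities
  edges := (Finset.range A.length).biUnion fun i => (alg G (A.take (i + 1))).edges

/-- The algorithm solves the online problem: at any time, the purchases made so far are a feasible
solution to the clients presented so far, whenever these clients can be served at all. -/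
def IsFeasible (alg : OnlineAlgorithm) : Prop :=
  ∀ (G : FCGraph) (A : List (Fin G.nC)), A.Nodup →
    (∃ S : Purchase G, S.Feasible A.toFinset) → (alg.total G A).Feasible A.toFinset

/-- The algorithm is `r`-competitive on the graph `G`: for any sequence of distinct clients, its
cost is at most `r` times the cost of any (in particular, of an optimal) offline solution. -/
def IsCompetitiveOn (alg : OnlineAlgorithm) (G : FCGraph) (r : ℝ) : Prop :=
  ∀ A : List (Fin G.nC), A.Nodup → ∀ S : Purchase G, S.Feasible A.toFinset →
    ((alg.total G A).cost : ℝ) ≤ r * (S.cost : ℝ)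

end OnlineAlgorithm

/-- Numerator and denominator (written in binary by the size measure). -/
def encodeCost (q : ℚ≥0) : List ℕ := [q.num, q.den]

/-- The input word that describes a facility-client graph: the numbers of facilities and of
clients, the opening costs, and for every pair `(f, c)` a flag that tells whether it is an edge,
together with its cost if it is one. -/
def encodeGraph (G : FCGraph) : List ℕ :=
  [G.nF, G.nC] ++
    ((List.finRange G.nF).flatMap fun f => encodeCost (G.facilityCost f)) ++
    ((List.finRange G.nF).flatMap fun f => (List.finRange G.nC).flatMap fun c =>
      if (f, c) ∈ G.edges then 1 :: encodeCost (G.edgeCost (f, c)) else [0, 0, 0])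

/-- The graph, followed by the number of clients that have arrived and by their indices. -/
def encodeInput (x : (G : FCGraph) × List (Fin G.nC)) : List ℕ :=
  encodeGraph x.1 ++ x.2.length :: x.2.map Fin.val

/-- The indicator vectors of the purchased facilities and edges. -/
def encodePurchase {G : FCGraph} (S : Purchase G) : List ℕ :=
  ((List.finRange G.nF).map fun f => if f ∈ S.facilities then 1 else 0) ++
    ((List.finRange G.nF).flatMap fun f => (List.finRange G.nC).map fun c =>
      if (f, c) ∈ S.edges then 1 else 0)

/-- The algorithm runs in polynomial time: some program computes its decision for the last client
from the graph and the clients that have arrived so far, in time polynomial in the bit length of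
this input.  (Summed over all arrivals, this is again polynomial in the whole input.) -/
def OnlineAlgorithm.IsPolyTime (alg : OnlineAlgorithm) : Prop :=
  PolyTimeComputable encodeInput
    (fun x : (G : FCGraph) × List (Fin G.nC) => encodePurchase (alg x.1 x.2))

/-! Clearing denominators makes all costs natural numbers. Let `m` and `n` be the numbers of
facilities and clients, `mu` and `L` their bit lengths, and `NN = 2 ^ L`. The algorithm keeps a
guess `B` of the optimum, which starts at 0, becomes 1 and is then doubled; a phase is a period of
constant guess. A client tries the radii `B * 2 ^ k / NN`, beginning with `k = 0`, and connects as
soon as an open facility lies within its radius. Until then it causes rounds: in a round every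
facility of cost at most `B` within the radius advances its counter, and about `f * m * NN / B`
advances double its weight `u`, which starts at 1. After `mu * m * 2 ^ k` rounds the radius is
doubled, but never beyond `B`; after `Q` rounds the phase ends.

The number `u / m` acts as a fractional opening, which is rounded deterministically, as in online
set cover. The potential `pot` is the cost of the open facilities, plus `B / 2 ^ lam` times the sum
of `rho ^ expo` over the uncovered pairs of a client and a radius, minus `lam / m` times `frac`. A
facility is opened exactly when the potential that disappears with it pays for it, hence a touch
never increases the potential (`pot_touch_le`). Since `2 ^ lam` is at least the number of pairs, the
potential after a reset exceeds the cost spent before by `O(B)` only (`pot_reset_le`). A pair whose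
weight reaches `m` contributes at least `B`, which would have caused an opening (`openInv_touch`).
So the weight near an uncovered client is less than `m`, a round adds at most `2 * B / (m * NN)` to
the fractional cost (`fracNat_touchAll_le`), and a whole phase adds `O(mu * B)`. Rounding loses the
factor `lam`.

The rounds are charged to an offline solution. If the facility that serves the client offline is
within the radius, its counter advances, which happens `O(mu * m * NN * f / B)` times. Otherwise the
radius is smaller than the offline connection cost `d`, and because the numbers of rounds grow
geometrically with the radius, there are only `O(mu * m * NN * d / B)` such rounds. Therefore a
phase with `B` at least the optimum never ends (`lt_opt_of_Q_le`), and `B` stays below twice the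
optimum. The connections of a phase cost `O(B)`: those at the smallest radius add up to at most `n *
B / NN`, and a larger radius is preceded by proportionally many rounds of the same client
(`clientInv_connect`). The phases add up geometrically, and `run_cost_le` bounds the total by `64 *
lam * mu` times the optimum. This is `O(log m * log n)`, so that the double logarithm in the theorem
is pure slack.

For the running time, the whole history is simulated anew at each arrival. Programs of type `Cmd`
truncate all stored numbers at `2 ^ W ^ 10` and all iteration counts at `W ^ 10`, where `W` is
linear in the input size. Their running time is thereby polynomial for syntactic reasons
(`Cmd.exists_exec`), and what remains is to show that truncation never takes effect when the clients
can be served (`rel_servedMem`). -/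

/-! ## Expressions and memories -/

/-- The memory `σ` with cell `i` of array `a` overwritten by `v`. -/
def store (σ : Memory) (a i v : ℕ) : Memory :=
  Function.update σ a (Function.update (σ a) i v)

theorem store_of_ne {σ : Memory} {a b i v : ℕ} (h : b ≠ a) : store σ a i v b = σ b := by
  simp [store, h]

@[simp] theorem store_same (σ : Memory) (a i v : ℕ) :
    store σ a i v a = Function.update (σ a) i v := by
  simp [store]

theorem store_cell (σ : Memory) (a i v : ℕ) : store σ a i v a i = v := by
  simp

instance : Add Expr := ⟨.bin .add⟩
instance : Sub Expr := ⟨.bin .sub⟩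
instance : Mul Expr := ⟨.bin .mul⟩
instance : Div Expr := ⟨.bin .div⟩

/-- The expression `x < y`. -/
def Expr.lt (x y : Expr) : Expr := .bin .lt x y

/-- The expression `x ≤ y`. -/
def Expr.le (x y : Expr) : Expr := .bin .lt x (y + .lit 1)

/-- The expression `x = y`. -/
def Expr.eq (x y : Expr) : Expr := .bin .eq x y

/-- The minimum, expressed by truncated subtraction. -/
def Expr.min (x y : Expr) : Expr := x - (x - y)

/-- The scalar variable that lives in cell `0` of array `a`. -/
def Expr.var (a : ℕ) : Expr := .get a (.lit 0)

namespace Expr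

variable (σ : Memory) (x y : Expr)

@[simp] theorem eval_lit (n : ℕ) : (Expr.lit n).eval σ = n := rfl
@[simp] theorem eval_get (a : ℕ) : (Expr.get a x).eval σ = σ a (x.eval σ) := rfl
@[simp] theorem eval_var (a : ℕ) : (Expr.var a).eval σ = σ a 0 := rfl
@[simp] theorem eval_add : (x + y).eval σ = x.eval σ + y.eval σ := rfl
@[simp] theorem eval_sub : (x - y).eval σ = x.eval σ - y.eval σ := rfl
@[simp] theorem eval_mul : (x * y).eval σ = x.eval σ * y.eval σ := rfl
@[simp] theorem eval_div : (x / y).eval σ = x.eval σ / y.eval σ := rfl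
@[simp] theorem eval_lt : (x.lt y).eval σ = if x.eval σ < y.eval σ then 1 else 0 := rfl
@[simp] theorem eval_eq : (x.eq y).eval σ = if x.eval σ = y.eval σ then 1 else 0 := rfl

@[simp] theorem eval_le : (x.le y).eval σ = if x.eval σ ≤ y.eval σ then 1 else 0 := by
  have : (x.le y).eval σ = if x.eval σ < y.eval σ + 1 then 1 else 0 := rfl
  simp only [this, Nat.lt_succ_iff]

@[simp] theorem eval_min : (x.min y).eval σ = Min.min (x.eval σ) (y.eval σ) := by
  have : (x.min y).eval σ = x.eval σ - (x.eval σ - y.eval σ) := rfl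
  omega

end Expr

/-! ### Bit lengths of values and evaluation times -/

theorem Nat.size_add_le (x y : ℕ) : (x + y).size ≤ x.size + y.size + 1 := by
  rw [Nat.size_le]
  have hx := Nat.lt_size_self x
  have hy := Nat.lt_size_self y
  have h1 : 2 ^ x.size ≤ 2 ^ (x.size + y.size) := Nat.pow_le_pow_right (by norm_num) (by omega)
  have h2 : 2 ^ y.size ≤ 2 ^ (x.size + y.size) := Nat.pow_le_pow_right (by norm_num) (by omega)
  rw [pow_succ]
  omega

theorem Nat.size_mul_le (x y : ℕ) : (x * y).size ≤ x.size + y.size := by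
  rw [Nat.size_le, pow_add]
  exact Nat.mul_lt_mul'' (Nat.lt_size_self x) (Nat.lt_size_self y)

theorem Nat.size_le_self (x : ℕ) : x.size ≤ x := by
  rw [Nat.size_le]
  exact Nat.lt_two_pow_self

theorem BinOp.size_eval_le (o : BinOp) (x y : ℕ) :
    (o.eval x y).size ≤ x.size + y.size + 1 := by
  cases o <;> simp only [BinOp.eval]
  · exact Nat.size_add_le x y
  · have := Nat.size_le_size (Nat.sub_le x y); omega
  · have := Nat.size_mul_le x y; omega
  · have := Nat.size_le_size (Nat.div_le_self x y); omega
  · have := Nat.size_le_size (Nat.mod_le x y); omega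
  · split_ifs <;> simp
  · split_ifs <;> simp

/-- Values of an expression have bit length linear in the bit length of the memory contents. -/
theorem Expr.exists_size_eval_le (e : Expr) :
    ∃ K, ∀ (σ : Memory) (s : ℕ), (∀ a i, (σ a i).size ≤ s) → (e.eval σ).size ≤ K * (s + 1) := by
  induction e with
  | lit n => exact ⟨n.size, fun σ s _ => Nat.le_mul_of_pos_right _ (by omega)⟩
  | get a i _ =>
    refine ⟨1, fun σ s h => ?_⟩
    have := h a (i.eval σ)
    simp only [Expr.eval]; omega
  | bin o x y hx hy =>
    obtain ⟨K, hK⟩ := hx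
    obtain ⟨K', hK'⟩ := hy
    refine ⟨K + K' + 1, fun σ s h => ?_⟩
    have h1 := hK σ s h
    have h2 := hK' σ s h
    have h3 := o.size_eval_le (x.eval σ) (y.eval σ)
    simp only [Expr.eval]
    nlinarith

/-- Evaluating an expression takes time linear in the bit length of the memory contents. -/
theorem Expr.exists_time_le (e : Expr) :
    ∃ K, ∀ (σ : Memory) (s : ℕ), (∀ a i, (σ a i).size ≤ s) → e.time σ ≤ K * (s + 1) := by
  induction e with
  | lit n => exact ⟨1 + n.size, fun σ s _ => Nat.le_mul_of_pos_right _ (by omega)⟩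
  | get a i hi =>
    obtain ⟨K, hK⟩ := hi
    obtain ⟨K', hK'⟩ := i.exists_size_eval_le
    refine ⟨K + K' + 1, fun σ s h => ?_⟩
    have h1 := hK σ s h
    have h2 := hK' σ s h
    have h3 := h a (i.eval σ)
    simp only [Expr.time]
    nlinarith
  | bin o x y hx hy =>
    obtain ⟨K, hK⟩ := hx
    obtain ⟨K', hK'⟩ := hy
    obtain ⟨J, hJ⟩ := x.exists_size_eval_le
    obtain ⟨J', hJ'⟩ := y.exists_size_eval_le
    refine ⟨K + K' + 2 * J + 2 * J' + 2, fun σ s h => ?_⟩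
    have h1 := hK σ s h
    have h2 := hK' σ s h
    have h3 := hJ σ s h
    have h4 := hJ' σ s h
    have h5 := o.size_eval_le (x.eval σ) (y.eval σ)
    simp only [Expr.time]
    nlinarith

/-- A loop whose successive memories are `s 0, …, s n`. -/
theorem exec_loop {b : Expr} {p : Prog} (s : ℕ → Memory) (n τ : ℕ)
    (hb : ∀ i < n, b.eval (s i) ≠ 0) (hn : b.eval (s n) = 0)
    (hτ : ∀ i ≤ n, b.time (s i) ≤ τ) (hp : ∀ i < n, ∃ t ≤ τ, Exec p (s i) (s (i + 1)) t) :
    ∃ t ≤ (n + 1) * (2 * τ + 1), Exec (.loop b p) (s 0) (s n) t := by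
  induction n generalizing s with
  | zero => exact ⟨_, by have := hτ 0 le_rfl; omega, Exec.loop_done hn⟩
  | succ n ih =>
    obtain ⟨t, ht, he⟩ := ih (fun i => s (i + 1)) (fun i hi => hb _ (by omega)) hn
      (fun i hi => hτ _ (by omega)) (fun i hi => hp _ (by omega))
    obtain ⟨t', ht', he'⟩ := hp 0 (by omega)
    refine ⟨_, ?_, Exec.loop_step (hb 0 (by omega)) he' he⟩
    have := hτ 0 (by omega)
    nlinarith

/-! ## Programs with bounded loops and bounded memory contents

Cell `0` of array `2` holds a bound for all numbers that are stored, and cell `0` of array `3` a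
bound for the number of iterations of every loop. -/

/-- Programs whose only loops are `rep c l e p`: repeat `p` as many times as the value of `e`
says, where the variable `c` counts the iterations and the variable `l` holds their number. -/
inductive Cmd : Type
  | skip
  | set (a : ℕ) (i e : Expr)
  | seq (p q : Cmd)
  | ite (b : Expr) (p q : Cmd)
  | rep (c l : ℕ) (e : Expr) (p : Cmd)

namespace Cmd

/-- Assignments are truncated at the bound in array `2`, and iteration counts also at the bound
in array `3`. -/
def run : Cmd → Memory → Memory
  | skip => fun σ => σ
  | set a i e => fun σ => store σ a (i.eval σ) (min (e.eval σ) (σ 2 0))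
  | seq p q => fun σ => q.run (p.run σ)
  | ite b p q => fun σ => if b.eval σ ≠ 0 then p.run σ else q.run σ
  | rep c l e p => fun σ =>
      (fun τ => store (p.run τ) c 0 (p.run τ c 0 + 1))^[min (min (e.eval σ) (σ 3 0)) (σ 2 0)]
        (store (store σ l 0 (min (min (e.eval σ) (σ 3 0)) (σ 2 0))) c 0 0)

/-- The machine program. -/
def compile : Cmd → Prog
  | skip => .skip
  | set a i e => .set a i (e.min (.var 2))
  | seq p q => .seq p.compile q.compile
  | ite b p q => .ite b p.compile q.compile
  | rep c l e p => .seq (.set l (.lit 0) ((e.min (.var 3)).min (.var 2)))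
      (.seq (.set c (.lit 0) (.lit 0))
        (.loop ((Expr.var c).lt (.var l))
          (.seq p.compile (.set c (.lit 0) (.var c + .lit 1)))))

/-- The arrays that a program may modify. -/
def writes : Cmd → ℕ → Bool
  | skip, _ => false
  | set a _ _, b => b == a
  | seq p q, b => p.writes b || q.writes b
  | ite _ p q, b => p.writes b || q.writes b
  | rep c l _ p, b => b == c || b == l || p.writes b

/-- The bounds are not modified, and loop variables are modified by their own loop only. -/
def wf : Cmd → Bool
  | skip => true
  | set a _ _ => a != 2 && a != 3
  | seq p q => p.wf && q.wf
  | ite _ p q => p.wf && q.wf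
  | rep c l _ p => c != l && c != 2 && c != 3 && l != 2 && l != 3 &&
      !p.writes c && !p.writes l && p.wf

/-- The frame rule. Since `writes` is computable, the preservation of parameters and state by a
concrete program reduces to `rfl` or `decide`. -/
theorem run_eq_of_not_writes {p : Cmd} {a : ℕ} (h : p.writes a = false) (σ : Memory) :
    p.run σ a = σ a := by
  induction p generalizing σ with
  | skip => rfl
  | set b i e =>
    simp only [writes, beq_eq_false_iff_ne] at h
    simp [run, store_of_ne h]
  | seq p q hp hq =>
    simp only [writes, Bool.or_eq_false_iff] at h
    simp only [run]
    rw [hq h.2, hp h.1]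
  | ite b p q hp hq =>
    simp only [writes, Bool.or_eq_false_iff] at h
    simp only [run]
    split_ifs
    · exact hp h.1 σ
    · exact hq h.2 σ
  | rep c l e p hp =>
    simp only [writes, Bool.or_eq_false_iff, beq_eq_false_iff_ne] at h
    simp only [run]
    generalize min (min (e.eval σ) (σ 3 0)) (σ 2 0) = n
    have : ∀ (k : ℕ) (τ : Memory), τ a = σ a →
        (fun τ => store (p.run τ) c 0 (p.run τ c 0 + 1))^[k] τ a = σ a := by
      intro k
      induction k with
      | zero => intro τ hτ; exact hτ
      | succ k ih =>
        intro τ hτ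
        rw [Function.iterate_succ_apply]
        apply ih
        rw [store_of_ne h.1.1, hp h.2, hτ]
    apply this
    rw [store_of_ne h.1.1, store_of_ne h.1.2]

/-- The two bounds thus keep their initial values, so that the time of every subprogram is measured
by the same quantities. -/
theorem writes_eq_false_of_wf {p : Cmd} (h : p.wf) :
    p.writes 2 = false ∧ p.writes 3 = false := by
  induction p with
  | skip => exact ⟨rfl, rfl⟩
  | set a i e =>
    simp only [wf, Bool.and_eq_true, bne_iff_ne] at h
    simp only [writes, beq_eq_false_iff_ne]
    omega
  | seq p q hp hq =>
    simp only [wf, Bool.and_eq_true] at h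
    simp [writes, hp h.1, hq h.2]
  | ite b p q hp hq =>
    simp only [wf, Bool.and_eq_true] at h
    simp [writes, hp h.1, hq h.2]
  | rep c l e p hp =>
    simp only [wf, Bool.and_eq_true, bne_iff_ne] at h
    simp only [writes, hp h.2, Bool.or_false, Bool.or_eq_false_iff, beq_eq_false_iff_ne]
    omega

/-- The rule for loops: `P i` holds after `i` iterations.  Arrays that the body does not modify
keep their contents. -/
theorem run_rep {c l : ℕ} {e : Expr} {p : Cmd} {σ : Memory} (n : ℕ) (P : ℕ → Memory → Prop)
    (hc : p.writes c = false) (hn : min (min (e.eval σ) (σ 3 0)) (σ 2 0) = n)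
    (h0 : P 0 (store (store σ l 0 n) c 0 0))
    (hs : ∀ i < n, ∀ τ : Memory, τ c 0 = i →
      (∀ a, (rep c l e p).writes a = false → τ a = σ a) → P i τ →
        P (i + 1) (store (p.run τ) c 0 (i + 1))) :
    P n ((rep c l e p).run σ) := by
  simp only [run, hn]
  set g : Memory → Memory := fun τ => store (p.run τ) c 0 (p.run τ c 0 + 1) with hg
  set τ0 := store (store σ l 0 n) c 0 0 with hτ0
  have key : ∀ i ≤ n, P i (g^[i] τ0) ∧ (g^[i] τ0) c 0 = i ∧
      ∀ a, (rep c l e p).writes a = false → (g^[i] τ0) a = σ a := by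
    intro i
    induction i with
    | zero =>
      intro _
      refine ⟨h0, by simp [hτ0], fun a ha => ?_⟩
      simp only [writes, Bool.or_eq_false_iff, beq_eq_false_iff_ne] at ha
      simp only [Function.iterate_zero, id, hτ0]
      rw [store_of_ne ha.1.1, store_of_ne ha.1.2]
    | succ i ih =>
      intro hi
      obtain ⟨h1, h2, h3⟩ := ih (by omega)
      rw [Function.iterate_succ_apply']
      have h4 := hs i (by omega) _ h2 h3 h1
      have h5 : g (g^[i] τ0) = store (p.run (g^[i] τ0)) c 0 (i + 1) := by
        simp only [hg]
        rw [run_eq_of_not_writes hc (g^[i] τ0)]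
        congr 1
        exact congrArg (· + 1) h2
      rw [h5]
      refine ⟨h4, by simp, fun a ha => ?_⟩
      have ha' := ha
      simp only [writes, Bool.or_eq_false_iff, beq_eq_false_iff_ne] at ha
      rw [store_of_ne ha.1.1, run_eq_of_not_writes ha.2, h3 a ha']
  exact (key n le_rfl).1

/-- All memory contents are at most the bound in array `2`. -/
def Bounded (σ : Memory) : Prop := ∀ a i, σ a i ≤ σ 2 0

theorem Bounded.store {σ : Memory} (h : Bounded σ) {a i v : ℕ} (ha : a ≠ 2) (hv : v ≤ σ 2 0) :
    Bounded (store σ a i v) := by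
  intro b k
  rw [store_of_ne (Ne.symm ha)]
  by_cases hb : b = a
  · subst hb
    rw [store_same]
    by_cases hk : k = i
    · subst hk; simpa using hv
    · simpa [hk] using h b k
  · rw [store_of_ne hb]; exact h b k

/-- Brings time bounds of different degrees to a common form so that they can be added. -/
theorem le_of_mul_pow {t K K' r d d' s : ℕ} (h : t ≤ K * (r + 1) ^ d * (s + 1)) (hK : K ≤ K')
    (hd : d ≤ d') : t ≤ K' * (r + 1) ^ d' * (s + 1) := by
  refine h.trans ?_
  gcongr
  omega

/-- Executing a command takes time polynomial in the iteration bound and in the bit length of the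
bound for the memory contents. -/
theorem exists_exec (p : Cmd) (hp : p.wf) : ∃ K d, ∀ σ, Bounded σ → Bounded (p.run σ) ∧
    ∃ t, Exec p.compile σ (p.run σ) t ∧ t ≤ K * (σ 3 0 + 1) ^ d * ((σ 2 0).size + 1) := by
  have hsz : ∀ σ, Bounded σ → ∀ a i, (σ a i).size ≤ (σ 2 0).size :=
    fun σ h a i => Nat.size_le_size (h a i)
  induction p with
  | skip =>
    refine ⟨1, 0, fun σ h => ⟨h, 1, Exec.skip σ, ?_⟩⟩
    rw [pow_zero]
    omega
  | set a i e =>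
    simp only [wf, Bool.and_eq_true, bne_iff_ne] at hp
    obtain ⟨K1, h1⟩ := i.exists_time_le
    obtain ⟨K2, h2⟩ := (e.min (.var 2)).exists_time_le
    obtain ⟨K3, h3⟩ := i.exists_size_eval_le
    obtain ⟨K4, h4⟩ := (e.min (.var 2)).exists_size_eval_le
    refine ⟨K1 + K2 + K3 + K4 + 1, 0, fun σ h => ⟨h.store hp.1 (min_le_right _ _), ?_⟩⟩
    have hx := Exec.set σ a i (e.min (.var 2))
    rw [Expr.eval_min, Expr.eval_var] at hx
    refine ⟨_, hx, ?_⟩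
    · have h1 := h1 σ _ (hsz σ h)
      have h2 := h2 σ _ (hsz σ h)
      have h3 := h3 σ _ (hsz σ h)
      have h4 := h4 σ _ (hsz σ h)
      rw [Expr.eval_min, Expr.eval_var] at h4
      rw [pow_zero]
      nlinarith
  | seq p q hp' hq' =>
    simp only [wf, Bool.and_eq_true] at hp
    obtain ⟨K1, d1, h1⟩ := hp' hp.1
    obtain ⟨K2, d2, h2⟩ := hq' hp.2
    refine ⟨K1 + K2, max d1 d2, fun σ h => ?_⟩
    obtain ⟨b1, t1, e1, l1⟩ := h1 σ h
    obtain ⟨b2, t2, e2, l2⟩ := h2 _ b1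
    refine ⟨b2, _, Exec.seq e1 e2, ?_⟩
    rw [run_eq_of_not_writes (writes_eq_false_of_wf hp.1).1,
      run_eq_of_not_writes (writes_eq_false_of_wf hp.1).2] at l2
    have l1 := le_of_mul_pow l1 le_rfl (le_max_left d1 d2)
    have l2 := le_of_mul_pow l2 le_rfl (le_max_right d1 d2)
    rw [add_mul, add_mul]
    omega
  | ite b p q hp' hq' =>
    simp only [wf, Bool.and_eq_true] at hp
    obtain ⟨K1, d1, h1⟩ := hp' hp.1
    obtain ⟨K2, d2, h2⟩ := hq' hp.2
    obtain ⟨K3, h3⟩ := b.exists_time_le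
    refine ⟨K1 + K2 + K3 + 1, max d1 d2, fun σ h => ?_⟩
    obtain ⟨b1, t1, e1, l1⟩ := h1 σ h
    obtain ⟨b2, t2, e2, l2⟩ := h2 σ h
    have l1 := le_of_mul_pow l1 le_rfl (le_max_left d1 d2)
    have l2 := le_of_mul_pow l2 le_rfl (le_max_right d1 d2)
    have h3 : b.time σ ≤ K3 * (σ 3 0 + 1) ^ 0 * ((σ 2 0).size + 1) := by
      simpa using h3 σ _ (hsz σ h)
    have h3 := le_of_mul_pow h3 le_rfl (Nat.zero_le (max d1 d2))
    have h5 : 1 ≤ 1 * (σ 3 0 + 1) ^ (max d1 d2) * ((σ 2 0).size + 1) :=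
      Nat.succ_le_of_lt (by positivity)
    simp only [run]
    split_ifs with hb
    · refine ⟨b1, _, Exec.ite_true hb e1, ?_⟩
      rw [add_mul, add_mul, add_mul, add_mul, add_mul, add_mul]
      omega
    · refine ⟨b2, _, Exec.ite_false (by simpa using hb) e2, ?_⟩
      rw [add_mul, add_mul, add_mul, add_mul, add_mul, add_mul]
      omega
  | rep c l e p hp' =>
    have hwf := hp
    simp only [wf, Bool.and_eq_true, bne_iff_ne, Bool.not_eq_eq_eq_not, Bool.not_true] at hp
    obtain ⟨⟨⟨⟨⟨⟨⟨hcl, hc2⟩, hc3⟩, hl2⟩, hl3⟩, hpc⟩, hpl⟩, hpwf⟩ := hp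
    obtain ⟨K1, d1, h1⟩ := hp' hpwf
    set e' := (e.min (.var 3)).min (.var 2) with he'
    obtain ⟨K2, h2⟩ := e'.exists_time_le
    obtain ⟨K3, h3⟩ := ((Expr.var c).lt (.var l)).exists_time_le
    obtain ⟨K4, h4⟩ := (Expr.var c + .lit 1).exists_time_le
    set T := K1 + K2 + K3 + K4 + 10 with hT
    -- There are at most `σ 3 0` iterations, which costs one more power of `σ 3 0 + 1`.
    refine ⟨4 * T + 2, d1 + 1, fun σ h => ?_⟩
    set n := min (min (e.eval σ) (σ 3 0)) (σ 2 0) with hn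
    have hnR : n ≤ σ 3 0 := (min_le_left _ _).trans (min_le_right _ _)
    have hnC : n ≤ σ 2 0 := min_le_right _ _
    set g : Memory → Memory := fun τ => store (p.run τ) c 0 (p.run τ c 0 + 1) with hg
    set τ0 := store (store σ l 0 n) c 0 0 with hτ0
    have b0 : Bounded (store σ l 0 n) := h.store hl2 hnC
    have b0' : Bounded τ0 := b0.store hc2 (Nat.zero_le _)
    have hw := writes_eq_false_of_wf hpwf
    have key : ∀ i ≤ n, Bounded (g^[i] τ0) ∧ (g^[i] τ0) c 0 = i ∧ (g^[i] τ0) l 0 = n ∧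
        (g^[i] τ0) 2 = σ 2 ∧ (g^[i] τ0) 3 = σ 3 := by
      intro i
      induction i with
      | zero =>
        intro _
        refine ⟨b0', by simp [hτ0], ?_, ?_, ?_⟩ <;> simp only [Function.iterate_zero, id, hτ0]
        · rw [store_of_ne (Ne.symm hcl)]; simp
        · rw [store_of_ne (Ne.symm hc2), store_of_ne (Ne.symm hl2)]
        · rw [store_of_ne (Ne.symm hc3), store_of_ne (Ne.symm hl3)]
      | succ i ih =>
        intro hi
        obtain ⟨a1, a2, a3, a4, a5⟩ := ih (by omega)
        rw [Function.iterate_succ_apply']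
        simp only [hg]
        have hc := run_eq_of_not_writes hpc (g^[i] τ0)
        have hl := run_eq_of_not_writes hpl (g^[i] τ0)
        have h2' := run_eq_of_not_writes hw.1 (g^[i] τ0)
        have h3' := run_eq_of_not_writes hw.2 (g^[i] τ0)
        refine ⟨?_, ?_, ?_, ?_, ?_⟩
        -- The increment of the counter is compiled without truncation; it respects the bound
        -- because the counter never exceeds `n ≤ σ 2 0`.
        · refine (h1 _ a1).1.store hc2 ?_
          have e1 : p.run (g^[i] τ0) c 0 = i := by rw [hc, a2]
          have e2 : p.run (g^[i] τ0) 2 0 = σ 2 0 := by rw [h2', a4]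
          have := e1; have := e2
          change p.run (g^[i] τ0) c 0 + 1 ≤ p.run (g^[i] τ0) 2 0
          omega
        · rw [store_cell]
          change p.run (g^[i] τ0) c 0 + 1 = i + 1
          rw [hc, a2]
        · rw [store_of_ne (Ne.symm hcl)]
          change p.run (g^[i] τ0) l 0 = n
          rw [hl, a3]
        · rw [store_of_ne (Ne.symm hc2)]
          change p.run (g^[i] τ0) 2 = _
          rw [h2', a4]
        · rw [store_of_ne (Ne.symm hc3)]
          change p.run (g^[i] τ0) 3 = _
          rw [h3', a5]
    have hrun : (rep c l e p).run σ = g^[n] τ0 := rfl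
    rw [hrun]
    refine ⟨(key n le_rfl).1, ?_⟩
    set s := (σ 2 0).size with hs
    set Y := (σ 3 0 + 1) ^ d1 * (s + 1) with hY
    have hY1 : s + 1 ≤ Y := Nat.le_mul_of_pos_left _ (by positivity)
    have hKY : ∀ {K t : ℕ}, t ≤ K * (s + 1) → t ≤ K * Y :=
      fun ht => ht.trans (Nat.mul_le_mul_left _ hY1)
    have hszi : ∀ i ≤ n, ∀ a k, ((g^[i] τ0) a k).size ≤ s := by
      intro i hi a k
      have := hsz _ (key i hi).1 a k
      rwa [(key i hi).2.2.2.1] at this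
    obtain ⟨t, ht, he⟩ := exec_loop (b := (Expr.var c).lt (.var l))
      (p := .seq p.compile (.set c (.lit 0) (.var c + .lit 1))) (fun i => g^[i] τ0) n (T * Y)
      (by
        intro i hi
        obtain ⟨_, a2, a3, _⟩ := key i hi.le
        simp only [Expr.eval_lt, Expr.eval_var, a2, a3, if_pos hi]
        omega)
      (by
        obtain ⟨_, a2, a3, _⟩ := key n le_rfl
        simp only [Expr.eval_lt, Expr.eval_var, a2, a3, lt_irrefl, if_false])
      (by
        intro i hi
        refine (hKY (h3 _ s (hszi i hi))).trans (Nat.mul_le_mul_right _ (by omega)))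
      (by
        intro i hi
        obtain ⟨a1, a2, a3, a4, a5⟩ := key i hi.le
        obtain ⟨b1, t1, e1, l1⟩ := h1 _ a1
        rw [Function.iterate_succ_apply']
        refine ⟨_, ?_, Exec.seq e1 (Exec.set (p.run (g^[i] τ0)) c (.lit 0) (.var c + .lit 1))⟩
        · rw [a4, a5, mul_assoc] at l1
          have hc := run_eq_of_not_writes hpc (g^[i] τ0)
          have h2' := run_eq_of_not_writes hw.1 (g^[i] τ0)
          have e2 : p.run (g^[i] τ0) 2 0 = σ 2 0 := by rw [h2', a4]
          have l4 := hKY (h4 (p.run (g^[i] τ0)) s (by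
            intro a k
            have := hsz _ b1 a k
            rwa [e2] at this))
          have e3 : (Expr.var c + .lit 1).eval (p.run (g^[i] τ0)) = i + 1 := by
            simp only [Expr.eval_add, Expr.eval_var, Expr.eval_lit, hc, a2]
          have l5 : (i + 1).size ≤ s := Nat.size_le_size (by omega)
          rw [e3]
          have tz : ∀ τ : Memory, (Expr.lit 0).time τ = 1 := fun τ => by
            simp [Expr.time]
          change t1 ≤ K1 * Y at l1
          simp only [Expr.eval_lit, tz, Nat.size_zero, hT, add_mul]
          omega)
    have hset1 := Exec.set σ l (.lit 0) e'
    have hset2 := Exec.set (store σ l 0 n) c (.lit 0) (.lit 0)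
    have hev : e'.eval σ = n := by simp [he', hn]
    rw [hev] at hset1
    refine ⟨_, Exec.seq hset1 (Exec.seq hset2 he), ?_⟩
    have l2 := hKY (h2 σ s (hsz σ h))
    have l5 : n.size ≤ s := Nat.size_le_size hnC
    have hgoal : (4 * T + 2) * (σ 3 0 + 1) ^ (d1 + 1) * (s + 1) =
        (σ 3 0 + 1) * ((4 * T + 2) * Y) := by
      rw [hY]; ring
    rw [hgoal]
    have hR : (n + 1) * (2 * (T * Y) + 1) ≤ (σ 3 0 + 1) * ((2 * T + 1) * Y) := by
      refine Nat.mul_le_mul (by omega) ?_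
      rw [add_mul (2 * T), mul_assoc, one_mul]
      omega
    have hR2 : (2 * T + 1) * Y ≤ (σ 3 0 + 1) * ((2 * T + 1) * Y) :=
      Nat.le_mul_of_pos_left _ (by omega)
    have hR3 : (σ 3 0 + 1) * ((4 * T + 2) * Y) =
        (σ 3 0 + 1) * ((2 * T + 1) * Y) + (σ 3 0 + 1) * ((2 * T + 1) * Y) := by ring
    rw [hR3]
    refine le_trans ?_ (Nat.add_le_add hR2 hR)
    simp only [Expr.time, Expr.eval_lit, Nat.size_zero]
    have h8 : (2 * T + 1) * Y = 2 * (K1 * Y) + 2 * (K2 * Y) + 2 * (K3 * Y) + 2 * (K4 * Y) + 21 * Y := by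
      rw [hT]; ring
    omega

end Cmd

/-! ## Computing the bounds -/

/-- The bit length of a number that dominates the product of the entries of `w`. -/
def inputBits (w : List ℕ) : ℕ := (w.map fun x => 2 * x + 2).prod.size

/-- An entry `x` contributes at most `x.size + 2` bits to the product and `x.size + 1` to
`wordSize`. Bounds polynomial in `inputBits` are therefore polynomial in the input size. -/
theorem inputBits_le (w : List ℕ) : inputBits w ≤ 2 * wordSize w + 1 := by
  unfold inputBits wordSize
  induction w with
  | nil => simp
  | cons x w ih =>
    simp only [List.map_cons, List.prod_cons, List.sum_cons]
    have h1 := Nat.size_mul_le (2 * x + 2) ((w.map fun x => 2 * x + 2).prod)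
    have h2 : (2 * x + 2).size ≤ x.size + 2 := by
      rw [Nat.size_le, pow_add]
      have := Nat.lt_size_self x
      omega
    omega

theorem length_le_wordSize (w : List ℕ) : w.length ≤ wordSize w := by
  unfold wordSize
  induction w with
  | nil => simp
  | cons x w ih =>
    simp only [List.map_cons, List.sum_cons, List.length_cons]
    omega

theorem size_le_wordSize {w : List ℕ} {x : ℕ} (h : x ∈ w) : x.size ≤ wordSize w := by
  unfold wordSize
  have := List.single_le_sum (l := w.map fun x => x.size + 1) (fun _ _ => Nat.zero_le _) (x.size + 1)
    (List.mem_map.2 ⟨x, h, rfl⟩)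
  omega

theorem size_getD_cons_length_le (w : List ℕ) (i : ℕ) :
    ((w.length :: w).getD i 0).size ≤ wordSize w := by
  cases i with
  | zero =>
    simp only [List.getD_cons_zero]
    exact (Nat.size_le_self _).trans (length_le_wordSize w)
  | succ i =>
    simp only [List.getD_cons_succ]
    by_cases h : i < w.length
    · rw [List.getD_eq_getElem _ _ h]
      exact size_le_wordSize (List.getElem_mem h)
    · rw [List.getD_eq_default _ _ (by omega)]
      simp

/-- The memories that occur while the bounds are computed. -/
def boundsMem (w : List ℕ) (x2 x3 x4 x5 x6 : ℕ) : Memory := fun a i =>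
  if a = 0 then (w.length :: w).getD i 0 else
    if i = 0 then
      if a = 2 then x2 else if a = 3 then x3 else if a = 4 then x4 else
        if a = 5 then x5 else if a = 6 then x6 else 0
    else 0

theorem size_boundsMem_le {w : List ℕ} {x2 x3 x4 x5 x6 s : ℕ} (hw : wordSize w ≤ s)
    (h2 : x2.size ≤ s) (h3 : x3.size ≤ s) (h4 : x4.size ≤ s) (h5 : x5.size ≤ s)
    (h6 : x6.size ≤ s) (a i : ℕ) : (boundsMem w x2 x3 x4 x5 x6 a i).size ≤ s := by
  unfold boundsMem
  have := size_getD_cons_length_le w i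
  split_ifs <;> first | assumption | omega | simp

section

variable (w : List ℕ) (x2 x3 x4 x5 x6 v : ℕ)

theorem store_boundsMem_two :
    store (boundsMem w x2 x3 x4 x5 x6) 2 0 v = boundsMem w v x3 x4 x5 x6 := by
  funext a i
  by_cases ha : a = 2
  · subst ha; by_cases hi : i = 0 <;> simp [boundsMem, hi]
  · simp [store_of_ne ha, boundsMem, ha]

theorem store_boundsMem_three :
    store (boundsMem w x2 x3 x4 x5 x6) 3 0 v = boundsMem w x2 v x4 x5 x6 := by
  funext a i
  by_cases ha : a = 3
  · subst ha; by_cases hi : i = 0 <;> simp [boundsMem, hi]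
  · simp [store_of_ne ha, boundsMem, ha]

theorem store_boundsMem_four :
    store (boundsMem w x2 x3 x4 x5 x6) 4 0 v = boundsMem w x2 x3 v x5 x6 := by
  funext a i
  by_cases ha : a = 4
  · subst ha; by_cases hi : i = 0 <;> simp [boundsMem, hi]
  · simp [store_of_ne ha, boundsMem, ha]

theorem store_boundsMem_five :
    store (boundsMem w x2 x3 x4 x5 x6) 5 0 v = boundsMem w x2 x3 x4 v x6 := by
  funext a i
  by_cases ha : a = 5
  · subst ha; by_cases hi : i = 0 <;> simp [boundsMem, hi]
  · simp [store_of_ne ha, boundsMem, ha]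

theorem store_boundsMem_six :
    store (boundsMem w x2 x3 x4 x5 x6) 6 0 v = boundsMem w x2 x3 x4 x5 v := by
  funext a i
  by_cases ha : a = 6
  · subst ha; by_cases hi : i = 0 <;> simp [boundsMem, hi]
  · simp [store_of_ne ha, boundsMem, ha]

end

/-- The tenth power of an expression. -/
def Expr.pow10 (x : Expr) : Expr :=
  x * x * (x * x) * (x * x * (x * x)) * (x * x)

/-- The program that computes the bounds for the numbers that are stored and for the iteration
counts. -/
def boundsProg : Prog :=
  .seq (.set 5 (.lit 0) (.lit 1))
  (.seq (.loop ((Expr.var 4).lt (.var 0))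
    (.seq (.set 4 (.lit 0) (.var 4 + .lit 1))
      (.set 5 (.lit 0) (.var 5 * (.lit 2 * .get 0 (.var 4) + .lit 2)))))
  (.seq (.loop (.var 5)
    (.seq (.set 5 (.lit 0) (.var 5 / .lit 2)) (.set 6 (.lit 0) (.var 6 + .lit 1))))
  (.seq (.set 3 (.lit 0) (Expr.pow10 (.var 6)))
  (.seq (.set 6 (.lit 0) (.var 3))
  (.seq (.set 2 (.lit 0) (.lit 1))
  (.loop (.var 6)
    (.seq (.set 2 (.lit 0) (.var 2 * .lit 2)) (.set 6 (.lit 0) (.var 6 - .lit 1)))))))))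

theorem exists_exec_set (a : ℕ) (i e : Expr) : ∃ K, ∀ (σ : Memory) (s : ℕ),
    (∀ a i, (σ a i).size ≤ s) →
      ∃ t ≤ K * (s + 1), Exec (.set a i e) σ (store σ a (i.eval σ) (e.eval σ)) t := by
  obtain ⟨K1, h1⟩ := i.exists_time_le
  obtain ⟨K2, h2⟩ := e.exists_time_le
  obtain ⟨K3, h3⟩ := i.exists_size_eval_le
  obtain ⟨K4, h4⟩ := e.exists_size_eval_le
  refine ⟨K1 + K2 + K3 + K4 + 1, fun σ s h => ⟨_, ?_, Exec.set σ a i e⟩⟩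
  have h1 := h1 σ s h
  have h2 := h2 σ s h
  have h3 := h3 σ s h
  have h4 := h4 σ s h
  nlinarith

/-- Products over prefixes are the intermediate results of the first loop of `boundsProg`. -/
theorem size_prod_take_le (w : List ℕ) (i : ℕ) :
    ((w.take i).map fun x => 2 * x + 2).prod.size ≤ 2 * wordSize w + 1 := by
  refine (inputBits_le (w.take i)).trans ?_
  have : wordSize (w.take i) ≤ wordSize w := by
    unfold wordSize
    rw [List.map_take]
    exact List.Sublist.sum_le_sum (List.take_sublist _ _) (fun _ _ => Nat.zero_le _)
  omega

/-- A quantity that dominates all bit lengths and iteration counts of `boundsProg`. -/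
def boundsScale (N : ℕ) : ℕ := (2 * N + 1) ^ 10 + 20 * (2 * N + 1)

/-- This program cannot be a `Cmd`, since the bounds do not exist yet. With `W = inputBits w`, its
loops form the product of all `2 * x + 2`, count the bits of that product by halving, and produce `2
^ W ^ 10` by repeated doubling. Each has at most `boundsScale` iterations on numbers of at most
`boundsScale` bits, hence the square. -/
theorem exists_exec_boundsProg : ∃ K, ∀ w : List ℕ, ∃ t ≤ K * (boundsScale (wordSize w) + 1) ^ 2,
    Exec boundsProg (loadInput w)
      (boundsMem w (2 ^ inputBits w ^ 10) (inputBits w ^ 10) w.length 0 0) t := by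
  obtain ⟨K1, h1⟩ := exists_exec_set 5 (.lit 0) (.lit 1)
  obtain ⟨K2, h2⟩ := exists_exec_set 4 (.lit 0) (.var 4 + .lit 1)
  obtain ⟨K3, h3⟩ := exists_exec_set 5 (.lit 0) (.var 5 * (.lit 2 * .get 0 (.var 4) + .lit 2))
  obtain ⟨K4, h4⟩ := exists_exec_set 5 (.lit 0) (.var 5 / .lit 2)
  obtain ⟨K5, h5⟩ := exists_exec_set 6 (.lit 0) (.var 6 + .lit 1)
  obtain ⟨K6, h6⟩ := exists_exec_set 3 (.lit 0) (Expr.pow10 (.var 6))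
  obtain ⟨K7, h7⟩ := exists_exec_set 6 (.lit 0) (.var 3)
  obtain ⟨K8, h8⟩ := exists_exec_set 2 (.lit 0) (.lit 1)
  obtain ⟨K9, h9⟩ := exists_exec_set 2 (.lit 0) (.var 2 * .lit 2)
  obtain ⟨K10, h10⟩ := exists_exec_set 6 (.lit 0) (.var 6 - .lit 1)
  obtain ⟨B1, b1⟩ := ((Expr.var 4).lt (.var 0)).exists_time_le
  obtain ⟨B2, b2⟩ := (Expr.var 5).exists_time_le
  obtain ⟨B3, b3⟩ := (Expr.var 6).exists_time_le
  set K := K1 + K2 + K3 + K4 + K5 + K6 + K7 + K8 + K9 + K10 + B1 + B2 + B3 + 1 with hK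
  refine ⟨20 * K + 10, fun w => ?_⟩
  set s := boundsScale (wordSize w) with hs
  set W := inputBits w with hW
  set pr : ℕ → ℕ := fun i => ((w.take i).map fun x => 2 * x + 2).prod with hpr
  have hWle : W ≤ 2 * wordSize w + 1 := inputBits_le w
  have hR : W ^ 10 ≤ (2 * wordSize w + 1) ^ 10 := Nat.pow_le_pow_left hWle 10
  have hs1 : 20 * (2 * wordSize w + 1) ≤ s := Nat.le_add_left _ _
  have hs2 : W ^ 10 + 20 * (2 * wordSize w + 1) ≤ s := Nat.add_le_add_right hR _
  have hlen := length_le_wordSize w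
  have hprs : ∀ i, (pr i).size ≤ s := fun i =>
    (size_prod_take_le w i).trans (by omega)
  have hsz : ∀ x ≤ s, x.size ≤ s := fun x hx => (Nat.size_le_self x).trans hx
  have hK' : ∀ {k t : ℕ}, t ≤ k * (s + 1) → k ≤ K → t ≤ K * (s + 1) :=
    fun ht hk => ht.trans (Nat.mul_le_mul_right _ hk)
  have e0 : loadInput w = boundsMem w 0 0 0 0 0 := by
    funext a i
    simp [loadInput, boundsMem]
  -- first assignment
  obtain ⟨t1, l1, x1⟩ := h1 (boundsMem w 0 0 0 0 0) s
    (size_boundsMem_le (by omega) (by simp) (by simp) (by simp) (by simp) (by simp))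
  rw [Expr.eval_lit, Expr.eval_lit, store_boundsMem_five] at x1
  -- first loop
  obtain ⟨t2, l2, x2⟩ := exec_loop (b := (Expr.var 4).lt (.var 0))
    (p := (.seq (.set 4 (.lit 0) (.var 4 + .lit 1))
      (.set 5 (.lit 0) (.var 5 * (.lit 2 * .get 0 (.var 4) + .lit 2)))))
    (fun i => boundsMem w 0 0 i (pr i) 0) w.length (2 * (K * (s + 1)))
    (fun i hi => by simp [boundsMem, hi])
    (by simp [boundsMem])
    (fun i hi => by
      have := hK' (b1 (boundsMem w 0 0 i (pr i) 0) s (size_boundsMem_le (by omega) (by simp) (by simp)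
        (hsz i (by omega)) (hprs i) (by simp))) (by omega)
      omega)
    (fun i hi => by
      -- The index is advanced before it is used: entry `i` of `w` is in cell `i + 1`, because cell
      -- 0 holds the length.
      obtain ⟨t, l, x⟩ := h2 (boundsMem w 0 0 i (pr i) 0) s (size_boundsMem_le (by omega)
        (by simp) (by simp) (hsz i (by omega)) (hprs i) (by simp))
      have ev : (Expr.var 4 + .lit 1).eval (boundsMem w 0 0 i (pr i) 0) = i + 1 := by
        simp [boundsMem]
      rw [Expr.eval_lit, ev, store_boundsMem_four] at x
      obtain ⟨t', l', x'⟩ := h3 (boundsMem w 0 0 (i + 1) (pr i) 0) s (size_boundsMem_le (by omega)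
        (by simp) (by simp) (hsz (i + 1) (by omega)) (hprs i) (by simp))
      have ev' : (Expr.var 5 * (.lit 2 * .get 0 (.var 4) + .lit 2)).eval
          (boundsMem w 0 0 (i + 1) (pr i) 0) = pr (i + 1) := by
        simp only [Expr.eval_mul, Expr.eval_var, Expr.eval_add, Expr.eval_lit, Expr.eval_get]
        simp only [boundsMem]
        simp [hpr, hi, mul_comm]
      rw [Expr.eval_lit, ev', store_boundsMem_five] at x'
      refine ⟨_, ?_, Exec.seq x x'⟩
      have := hK' l (by omega)
      have := hK' l' (by omega)
      omega)
  have hp0 : pr 0 = 1 := by simp [hpr]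
  have hpl : (pr w.length).size = W := by simp only [hpr, List.take_length, hW, inputBits]
  -- second loop
  obtain ⟨t3, l3, x3⟩ := exec_loop (b := Expr.var 5)
    (p := (.seq (.set 5 (.lit 0) (.var 5 / .lit 2)) (.set 6 (.lit 0) (.var 6 + .lit 1))))
    (fun i => boundsMem w 0 0 w.length (pr w.length / 2 ^ i) i) W (2 * (K * (s + 1)))
    (fun i hi => by
      rw [← hpl, Nat.lt_size] at hi
      have := Nat.div_pos hi (by positivity)
      simp only [Expr.eval_var, boundsMem]
      simpa using hi)
    (by
      have := Nat.lt_size_self (pr w.length)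
      rw [hpl] at this
      simp [boundsMem, Nat.div_eq_of_lt this])
    (fun i hi => by
      have := hK' (b2 (boundsMem w 0 0 w.length (pr w.length / 2 ^ i) i) s (size_boundsMem_le (by omega) (by simp) (by simp)
        (hsz _ (by omega)) ((Nat.size_le_size (Nat.div_le_self _ (2 ^ i))).trans (hprs w.length))
        (hsz i (by omega)))) (by omega)
      omega)
    (fun i hi => by
      obtain ⟨t, l, x⟩ := h4 (boundsMem w 0 0 w.length (pr w.length / 2 ^ i) i) s
        (size_boundsMem_le (by omega) (by simp) (by simp) (hsz _ (by omega))
        ((Nat.size_le_size (Nat.div_le_self _ (2 ^ i))).trans (hprs w.length))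
        (hsz i (by omega)))
      have ev : (Expr.var 5 / .lit 2).eval (boundsMem w 0 0 w.length (pr w.length / 2 ^ i) i) =
          pr w.length / 2 ^ (i + 1) := by
        simp [boundsMem, Nat.div_div_eq_div_mul, pow_succ]
      rw [Expr.eval_lit, ev, store_boundsMem_five] at x
      obtain ⟨t', l', x'⟩ := h5 (boundsMem w 0 0 w.length (pr w.length / 2 ^ (i + 1)) i) s
        (size_boundsMem_le (by omega) (by simp) (by simp) (hsz _ (by omega))
        ((Nat.size_le_size (Nat.div_le_self _ (2 ^ (i + 1)))).trans (hprs w.length))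
        (hsz i (by omega)))
      have ev' : (Expr.var 6 + .lit 1).eval
          (boundsMem w 0 0 w.length (pr w.length / 2 ^ (i + 1)) i) = i + 1 := by
        simp [boundsMem]
      rw [Expr.eval_lit, ev', store_boundsMem_six] at x'
      refine ⟨_, ?_, Exec.seq x x'⟩
      have := hK' l (by omega)
      have := hK' l' (by omega)
      omega)
  have hz : pr w.length / 2 ^ W = 0 := by
    have := Nat.lt_size_self (pr w.length)
    rw [hpl] at this
    exact Nat.div_eq_of_lt this
  simp only [hz, pow_zero, Nat.div_one] at x3
  simp only [hp0] at x2
  -- the power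
  obtain ⟨t4, l4, x4⟩ := h6 (boundsMem w 0 0 w.length 0 W) s (size_boundsMem_le (by omega)
    (by simp) (by simp) (hsz _ (by omega)) (by simp) (hsz W (by omega)))
  have ev4 : (Expr.pow10 (.var 6)).eval (boundsMem w 0 0 w.length 0 W) = W ^ 10 := by
    simp only [Expr.pow10, Expr.eval_mul, Expr.eval_var, boundsMem]
    simp; ring
  rw [Expr.eval_lit, ev4, store_boundsMem_three] at x4
  obtain ⟨t5, l5, x5⟩ := h7 (boundsMem w 0 (W ^ 10) w.length 0 W) s (size_boundsMem_le (by omega)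
    (by simp) (hsz _ (by omega)) (hsz _ (by omega)) (by simp) (hsz W (by omega)))
  have ev5 : (Expr.var 3).eval (boundsMem w 0 (W ^ 10) w.length 0 W) = W ^ 10 := by
    simp [boundsMem]
  rw [Expr.eval_lit, ev5, store_boundsMem_six] at x5
  obtain ⟨t6, l6, x6⟩ := h8 (boundsMem w 0 (W ^ 10) w.length 0 (W ^ 10)) s
    (size_boundsMem_le (by omega) (by simp) (hsz _ (by omega)) (hsz _ (by omega)) (by simp)
      (hsz _ (by omega)))
  rw [Expr.eval_lit, Expr.eval_lit, store_boundsMem_two] at x6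
  -- third loop
  have h2s : ∀ i ≤ W ^ 10, (2 ^ i).size ≤ s := fun i hi => by
    rw [Nat.size_pow]; omega
  obtain ⟨t7, l7, x7⟩ := exec_loop (b := Expr.var 6)
    (p := (.seq (.set 2 (.lit 0) (.var 2 * .lit 2)) (.set 6 (.lit 0) (.var 6 - .lit 1))))
    (fun i => boundsMem w (2 ^ i) (W ^ 10) w.length 0 (W ^ 10 - i)) (W ^ 10) (2 * (K * (s + 1)))
    (fun i hi => by
      simp only [Expr.eval_var, boundsMem]
      simp; omega)
    (by simp [boundsMem])
    (fun i hi => by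
      have := hK' (b3 (boundsMem w (2 ^ i) (W ^ 10) w.length 0 (W ^ 10 - i)) s (size_boundsMem_le (by omega) (h2s i hi) (hsz _ (by omega))
        (hsz _ (by omega)) (by simp) (hsz (W ^ 10 - i) (by omega)))) (by omega)
      omega)
    (fun i hi => by
      obtain ⟨t, l, x⟩ := h9 (boundsMem w (2 ^ i) (W ^ 10) w.length 0 (W ^ 10 - i)) s
        (size_boundsMem_le (by omega) (h2s i hi.le) (hsz _ (by omega))
        (hsz _ (by omega)) (by simp) (hsz (W ^ 10 - i) (by omega)))
      have ev : (Expr.var 2 * .lit 2).eval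
          (boundsMem w (2 ^ i) (W ^ 10) w.length 0 (W ^ 10 - i)) = 2 ^ (i + 1) := by
        simp [boundsMem, pow_succ]
      rw [Expr.eval_lit, ev, store_boundsMem_two] at x
      obtain ⟨t', l', x'⟩ := h10 (boundsMem w (2 ^ (i + 1)) (W ^ 10) w.length 0 (W ^ 10 - i)) s
        (size_boundsMem_le (by omega) (h2s _ hi) (hsz _ (by omega))
        (hsz _ (by omega)) (by simp) (hsz (W ^ 10 - i) (by omega)))
      have ev' : (Expr.var 6 - .lit 1).eval
          (boundsMem w (2 ^ (i + 1)) (W ^ 10) w.length 0 (W ^ 10 - i)) = W ^ 10 - (i + 1) := by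
        simp [boundsMem]; omega
      rw [Expr.eval_lit, ev', store_boundsMem_six] at x'
      refine ⟨_, ?_, Exec.seq x x'⟩
      have := hK' l (by omega)
      have := hK' l' (by omega)
      omega)
  simp only [pow_zero, Nat.sub_zero, Nat.sub_self] at x7
  rw [e0]
  refine ⟨_, ?_, Exec.seq x1 (Exec.seq x2 (Exec.seq x3 (Exec.seq x4 (Exec.seq x5
    (Exec.seq x6 x7)))))⟩
  have l1 := hK' l1 (by omega)
  have l4 := hK' l4 (by omega)
  have l5 := hK' l5 (by omega)
  have l6 := hK' l6 (by omega)
  have hloop : ∀ {n t : ℕ}, t ≤ (n + 1) * (2 * (2 * (K * (s + 1))) + 1) → n ≤ s →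
      t ≤ (s + 1) * (4 * (K * (s + 1)) + 1) := by
    intro n t ht hn
    refine ht.trans (Nat.mul_le_mul (by omega) (by omega))
  have l2 := hloop l2 (by omega)
  have l3 := hloop l3 (by omega)
  have l7 := hloop l7 (by omega)
  have hone : K * (s + 1) ≤ (s + 1) * (K * (s + 1)) := Nat.le_mul_of_pos_left _ (by omega)
  have hexp : (20 * K + 10) * (s + 1) ^ 2 = 20 * ((s + 1) * (K * (s + 1))) +
    10 * ((s + 1) * (s + 1)) := by ring
  have hexp' : (s + 1) * (4 * (K * (s + 1)) + 1) =
    4 * ((s + 1) * (K * (s + 1))) + (s + 1) := by ring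
  have hsq : s + 1 ≤ (s + 1) * (s + 1) := Nat.le_mul_of_pos_left _ (by omega)
  rw [hexp]
  rw [hexp'] at l2 l3 l7
  omega

theorem inputBits_pow_le (w : List ℕ) : inputBits w ^ 10 ≤ boundsScale (wordSize w) :=
  (Nat.pow_le_pow_left (inputBits_le w) 10).trans (Nat.le_add_right _ _)

/-- This is the reason for the factors `2 * x + 2` in place of `x`: each is at least 2, so the
product controls the number of entries as well as their sizes. -/
theorem pow_length_le_prod (w : List ℕ) : 2 ^ w.length ≤ (w.map fun x => 2 * x + 2).prod := by
  induction w with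
  | nil => simp
  | cons x w ih =>
    simp only [List.length_cons, List.map_cons, List.prod_cons, pow_succ]
    rw [mul_comm]
    exact Nat.mul_le_mul (by omega) ih

theorem length_lt_inputBits (w : List ℕ) : w.length < inputBits w := by
  rw [inputBits, Nat.lt_size]
  exact pow_length_le_prod w

theorem prod_lt_two_pow_inputBits (w : List ℕ) :
    (w.map fun x => 2 * x + 2).prod < 2 ^ inputBits w :=
  Nat.lt_size_self _

theorem lt_two_pow_inputBits {w : List ℕ} {x : ℕ} (h : x ∈ w) : x < 2 ^ inputBits w := by
  refine lt_of_le_of_lt ?_ (prod_lt_two_pow_inputBits w)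
  have h1 : 2 * x + 2 ∣ (w.map fun x => 2 * x + 2).prod :=
    List.dvd_prod (List.mem_map.2 ⟨x, h, rfl⟩)
  have h2 : 0 < (w.map fun x => 2 * x + 2).prod := by
    have := pow_length_le_prod w
    exact lt_of_lt_of_le (by positivity) this
  have := Nat.le_of_dvd h2 h1
  omega

theorem bounded_boundsMem (w : List ℕ) :
    Cmd.Bounded (boundsMem w (2 ^ inputBits w ^ 10) (inputBits w ^ 10) w.length 0 0) := by
  have hW := length_lt_inputBits w
  have h1 : inputBits w ≤ inputBits w ^ 10 := Nat.le_self_pow (by norm_num) _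
  have h2 : inputBits w ^ 10 < 2 ^ inputBits w ^ 10 := Nat.lt_two_pow_self
  have h3 : 2 ^ inputBits w ≤ 2 ^ inputBits w ^ 10 := Nat.pow_le_pow_right (by norm_num) h1
  intro a i
  have : boundsMem w (2 ^ inputBits w ^ 10) (inputBits w ^ 10) w.length 0 0 2 0 =
    2 ^ inputBits w ^ 10 := by simp [boundsMem]
  rw [this]
  have hi : (w.length :: w).getD i 0 ≤ 2 ^ inputBits w ^ 10 := by
    cases i with
    | zero => simp only [List.getD_cons_zero]; omega
    | succ i =>
      simp only [List.getD_cons_succ]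
      by_cases h : i < w.length
      · rw [List.getD_eq_getElem _ _ h]
        exact (lt_two_pow_inputBits (List.getElem_mem h)).le.trans h3
      · rw [List.getD_eq_default _ _ (by omega)]
        omega
  unfold boundsMem
  split_ifs <;> omega

/-! ## The online algorithm on graphs with integral costs -/

/-- A facility-client graph with integral costs: numbers of facilities and of clients, opening
costs, connection costs, and the indicator of the edges. -/
structure IntGraph : Type where
  m : ℕ
  n : ℕ
  f : ℕ → ℕ
  d : ℕ → ℕ → ℕ
  e : ℕ → ℕ → ℕ

/-- The state of the algorithm: the current guess `B` of the optimum, the number `q` of rounds since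
the guess was last changed, the number `tau` of rounds that were spent for the current client on
its current radius, which is `B * pk / 2 ^ L`, whether the current client is served, the opened
facilities, for every facility a counter and its weight, and the purchased edges. -/
structure Config : Type where
  B : ℕ
  q : ℕ
  tau : ℕ
  pk : ℕ
  done : ℕ
  opn : ℕ → ℕ
  c : ℕ → ℕ
  u : ℕ → ℕ
  be : ℕ → ℕ

namespace IntGraph

variable (I : IntGraph)

/-- A weight that is at most `2 * m` has been doubled at most `mu` times. The radii are numbered by
`k ≤ L`, from `B / NN` up to `B`; as `NN` exceeds `n`, all connections at the smallest radius
together cost at most `B`. -/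
def mu : ℕ := I.m.size
def L : ℕ := I.n.size
def NN : ℕ := 2 ^ I.L
-- Chosen so that `2 ^ lam = NN ^ 2` is at least the number `n * (L + 1)` of pairs of a client and a
-- radius.
def lam : ℕ := 2 * I.L
-- The largest exponent of `1 + 1 / m` that occurs, since `expo` is at most `2 * m` even after a
-- doubling.
def X : ℕ := 2 * I.lam * I.m
-- An offline solution of cost at most `B` accounts for at most `3 * mu * m * NN` rounds with guess
-- `B`; one more round refutes the guess.
def Q : ℕ := 3 * I.mu * I.m * I.NN + 1

/-- Up to a constant factor, the power of `1 + 1 / m`. -/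
def pw (x : ℕ) : ℕ := if x ≤ I.X then (I.m + 1) ^ x * I.m ^ (I.X - x) else 0

/-- The facility `i` is within the radius given by `pk` of the client `j`. -/
def Near (B pk i j : ℕ) : Prop := I.e i j ≠ 0 ∧ I.d i j * I.NN ≤ B * pk

instance (B pk i j : ℕ) : Decidable (I.Near B pk i j) := inferInstanceAs (Decidable (_ ∧ _))

/-- The successor of the last open facility below `r` near the client `j`, or `0`. -/
def cover (s : Config) (j pk : ℕ) : ℕ → ℕ
  | 0 => 0
  | r + 1 => if I.Near s.B pk r j ∧ s.opn r ≠ 0 then r + 1 else cover s j pk r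

/-- The total weight (minus the initial weight) near the client `j`. -/
def expo (s : Config) (j pk : ℕ) : ℕ :=
  ∑ i ∈ Finset.range I.m, if I.Near s.B pk i j then s.u i - 1 else 0

/-- The scaled potential of the client `j` and the radius given by `pk`. -/
def term (s : Config) (j pk : ℕ) : ℕ :=
  if I.cover s j pk I.m = 0 then I.pw (I.lam * I.expo s j pk) else 0

/-- The scaled potential that vanishes when the facility `i` is opened. -/
def gain (s : Config) (i : ℕ) : ℕ :=
  ∑ j ∈ Finset.range I.n, ∑ k ∈ Finset.range (I.L + 1),
    if I.Near s.B (2 ^ k) i j then I.term s j (2 ^ k) else 0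

/-- Increase of the counter of the facility `i`; if the counter is complete then the weight is
doubled. -/
def count (s : Config) (i : ℕ) : Config :=
  { s with
    c := Function.update s.c i (if I.f i * (I.m * I.NN) ≤ (s.c i + 1) * s.B then 0 else s.c i + 1)
    u := Function.update s.u i
      (if I.f i * (I.m * I.NN) ≤ (s.c i + 1) * s.B then 2 * s.u i else s.u i) }

/-- Opening the facility `i`. -/
def openFac (s : Config) (i : ℕ) : Config := { s with opn := Function.update s.opn i 1 }

/-- The facility `i` is counted, and opened if this gains enough potential. -/
def touch (s : Config) (i : ℕ) : Config :=
  if I.f i * (2 ^ I.lam * I.m ^ I.X) ≤ (I.count s i).B * I.gain (I.count s i) i then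
    openFac (I.count s i) i else I.count s i

/-- All facilities below `r` near the client `j` are touched. -/
def touchAll (s : Config) (j : ℕ) : ℕ → Config
  | 0 => s
  | r + 1 => if I.Near s.B s.pk r j ∧ I.f r ≤ s.B then I.touch (touchAll s j r) r
      else touchAll s j r

/-- All weights are reset, and the very cheap facilities are opened. -/
def reset (s : Config) : Config :=
  { s with
    q := 0
    tau := 0
    pk := 1
    c := fun i => if i < I.m then 0 else s.c i
    u := fun i => if i < I.m then 1 else s.u i
    opn := fun i => if i < I.m ∧ I.f i * I.m ≤ s.B then 1 else s.opn i }

/-- One step for the client `j`. -/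
def step (j : ℕ) (s : Config) : Config :=
  if s.done ≠ 0 then s
  else if I.cover s j s.pk I.m ≠ 0 then
    { s with be := Function.update s.be ((I.cover s j s.pk I.m - 1) * I.n + j) 1, done := 1 }
  else if I.Q ≤ s.q then I.reset { s with B := 2 * s.B + if s.B = 0 then 1 else 0 }
  else if I.mu * I.m * s.pk ≤ s.tau ∧ s.pk < I.NN then { s with pk := 2 * s.pk, tau := 0 }
  else I.touchAll { s with q := s.q + 1, tau := s.tau + 1 } j I.m

/-- The start of the service of a client. -/
def begin (s : Config) : Config := { s with pk := 1, tau := 0, done := 0 }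

/-- At most `F` steps for the client `j`. -/
def serve (F : ℕ) (s : Config) (j : ℕ) : Config := (I.step j)^[F] (begin s)

/-- With guess 0 the reset opens exactly the free facilities, which settles instances of optimum 0.
Integrality makes 1 the next sensible guess. -/
def init : Config := I.reset ⟨0, 0, 0, 0, 0, fun _ => 0, fun _ => 0, fun _ => 0, fun _ => 0⟩

/-- The state after the clients of the list `l` have arrived. -/
def run (F : ℕ) (l : List ℕ) : Config := l.foldl (I.serve F) I.init

/-! ### Elementary facts -/

variable {I}

theorem cover_eq_zero {s : Config} {j pk r : ℕ} :
    I.cover s j pk r = 0 ↔ ∀ i < r, ¬(I.Near s.B pk i j ∧ s.opn i ≠ 0) := by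
  induction r with
  | zero => simp [cover]
  | succ r ih =>
    simp only [cover]
    split_ifs with h
    · exact ⟨fun h' => h'.elim, fun h' => (h' r (by omega) h).elim⟩
    · rw [ih]
      constructor
      · intro h' i hi
        rcases Nat.lt_succ_iff_lt_or_eq.1 hi with hi | rfl
        · exact h' i hi
        · exact h
      · exact fun h' i hi => h' i (by omega)

theorem cover_spec {s : Config} {j pk r : ℕ} (h : I.cover s j pk r ≠ 0) :
    I.cover s j pk r - 1 < r ∧ I.Near s.B pk (I.cover s j pk r - 1) j ∧
      s.opn (I.cover s j pk r - 1) ≠ 0 := by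
  induction r with
  | zero => simp [cover] at h
  | succ r ih =>
    simp only [cover] at h ⊢
    split_ifs with h'
    · simpa using h'
    · rw [if_neg h'] at h
      obtain ⟨h1, h2⟩ := ih h
      exact ⟨by omega, h2⟩

@[simp] theorem count_B (s : Config) (i : ℕ) : (I.count s i).B = s.B := rfl
@[simp] theorem count_opn (s : Config) (i : ℕ) : (I.count s i).opn = s.opn := rfl
@[simp] theorem openFac_B (s : Config) (i : ℕ) : (openFac s i).B = s.B := rfl

theorem touch_cases (s : Config) (i : ℕ) :
    I.touch s i = openFac (I.count s i) i ∨ I.touch s i = I.count s i := by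
  unfold touch
  split_ifs
  · exact Or.inl rfl
  · exact Or.inr rfl

theorem touch_fields (s : Config) (i : ℕ) :
    (I.touch s i).B = s.B ∧ (I.touch s i).q = s.q ∧ (I.touch s i).tau = s.tau ∧
    (I.touch s i).pk = s.pk ∧ (I.touch s i).done = s.done ∧ (I.touch s i).be = s.be ∧
    (I.touch s i).c = (I.count s i).c ∧ (I.touch s i).u = (I.count s i).u := by
  rcases I.touch_cases s i with h | h <;> rw [h] <;> simp [openFac, count]

theorem touch_opn (s : Config) (i i' : ℕ) (h : i' ≠ i) : (I.touch s i).opn i' = s.opn i' := by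
  rcases I.touch_cases s i with h' | h' <;> rw [h'] <;> simp [openFac, count, h]

theorem touch_opn_mono (s : Config) (i i' : ℕ) (h : s.opn i' ≠ 0) : (I.touch s i).opn i' ≠ 0 := by
  rcases I.touch_cases s i with h' | h' <;> rw [h']
  · by_cases hi : i' = i
    · subst hi; simp [openFac]
    · simpa [openFac, count, hi] using h
  · exact h

theorem touchAll_fields (s : Config) (j r : ℕ) :
    (I.touchAll s j r).B = s.B ∧ (I.touchAll s j r).q = s.q ∧ (I.touchAll s j r).tau = s.tau ∧
    (I.touchAll s j r).pk = s.pk ∧ (I.touchAll s j r).done = s.done ∧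
    (I.touchAll s j r).be = s.be := by
  induction r with
  | zero => simp [touchAll]
  | succ r ih =>
    simp only [touchAll]
    split_ifs
    · obtain ⟨h1, h2, h3, h4, h5, h6, -, -⟩ := I.touch_fields (I.touchAll s j r) r
      rw [h1, h2, h3, h4, h5, h6]
      exact ih
    · exact ih

/-- A touch changes the counter and the weight of its own facility only, and each facility is
touched at most once per round. Their new values are thus determined by the state before the round,
whatever is opened meanwhile. -/
theorem touchAll_cu (s : Config) (j r i : ℕ) :
    (I.touchAll s j r).c i = (if i < r ∧ I.Near s.B s.pk i j ∧ I.f i ≤ s.B then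
      (I.count s i).c i else s.c i) ∧
    (I.touchAll s j r).u i = (if i < r ∧ I.Near s.B s.pk i j ∧ I.f i ≤ s.B then
      (I.count s i).u i else s.u i) := by
  induction r with
  | zero => simp [touchAll]
  | succ r ih =>
    simp only [touchAll]
    by_cases h : I.Near s.B s.pk r j ∧ I.f r ≤ s.B
    · rw [if_pos h]
      obtain ⟨-, -, -, -, -, -, h7, h8⟩ := I.touch_fields (I.touchAll s j r) r
      rw [h7, h8]
      by_cases hi : i = r
      · subst hi
        have hB := (I.touchAll_fields s j i).1
        simp only [lt_irrefl, false_and, if_false] at ih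
        simp [count, h, ih.1, ih.2, hB]
      · have : i < r + 1 ↔ i < r := by omega
        simp only [count, Function.update_of_ne hi, this]
        simpa [count] using ih
    · rw [if_neg h]
      by_cases hi : i = r
      · subst hi
        simp only [lt_irrefl, false_and, if_false] at ih
        rw [if_neg (fun h' => h h'.2), if_neg (fun h' => h h'.2)]
        exact ih
      · have : i < r + 1 ↔ i < r := by omega
        simp only [this]
        exact ih

theorem touchAll_opn_of_le (s : Config) (j r i : ℕ) (h : r ≤ i) :
    (I.touchAll s j r).opn i = s.opn i := by
  induction r with
  | zero => simp [touchAll]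
  | succ r ih =>
    simp only [touchAll]
    split_ifs
    · rw [touch_opn _ _ _ (by omega), ih (by omega)]
    · exact ih (by omega)

theorem touchAll_opn_mono (s : Config) (j r i : ℕ) (h : s.opn i ≠ 0) :
    (I.touchAll s j r).opn i ≠ 0 := by
  induction r with
  | zero => exact h
  | succ r ih =>
    simp only [touchAll]
    split_ifs
    · exact touch_opn_mono _ _ _ ih
    · exact ih

/-! ### The potential -/

/-- The invariants of counters and weights. -/
structure WeightInv (I : IntGraph) (s : Config) : Prop where
  pow : ∀ i < I.m, ∃ k, s.u i = 2 ^ k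
  le : ∀ i < I.m, s.u i ≤ 2 * I.m
  counter : ∀ i < I.m, s.c i * s.B ≤ I.f i * (I.m * I.NN)

theorem WeightInv.pos {s : Config} (h : WeightInv I s) {i : ℕ} (hi : i < I.m) : 0 < s.u i := by
  obtain ⟨k, hk⟩ := h.pow i hi
  rw [hk]; positivity

/-- The invariants of the set of open facilities. -/
structure OpenInv (I : IntGraph) (s : Config) : Prop where
  le : ∀ i < I.m, s.opn i ≠ 0 → I.f i ≤ s.B
  free : ∀ i < I.m, I.f i * I.m ≤ s.B → s.opn i ≠ 0
  expo_lt : ∀ j < I.n, ∀ k ≤ I.L, I.cover s j (2 ^ k) I.m = 0 → I.expo s j (2 ^ k) < I.m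

/-- The total cost of the open facilities. -/
def fac (I : IntGraph) (s : Config) : ℕ :=
  ∑ i ∈ Finset.range I.m, if s.opn i ≠ 0 then I.f i else 0

/-- The base of the potential. -/
noncomputable def rho (I : IntGraph) : ℝ := (1 + 1 / (I.m : ℝ)) ^ I.lam

/-- The potential of a client and a radius. -/
noncomputable def wt (I : IntGraph) (s : Config) (j pk : ℕ) : ℝ :=
  if I.cover s j pk I.m = 0 then I.rho ^ I.expo s j pk else 0

/-- The set of pairs of a client and a radius. -/
def pairs (I : IntGraph) : Finset (ℕ × ℕ) := Finset.range I.n ×ˢ Finset.range (I.L + 1)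

/-- The fractional cost. -/
noncomputable def frac (I : IntGraph) (s : Config) : ℝ :=
  ∑ i ∈ Finset.range I.m, (I.f i : ℝ) * ((s.u i : ℝ) - 1)

/-- The total potential. -/
noncomputable def pot (I : IntGraph) (s : Config) : ℝ :=
  I.fac s + (s.B : ℝ) / 2 ^ I.lam * ∑ p ∈ I.pairs, I.wt s p.1 (2 ^ p.2) -
    I.lam / I.m * I.frac s

theorem rho_pos : 0 < I.rho := by unfold rho; positivity

theorem one_le_rho : 1 ≤ I.rho := by
  unfold rho
  exact one_le_pow₀ (by simp)

theorem wt_nonneg (s : Config) (j pk : ℕ) : 0 ≤ I.wt s j pk := by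
  unfold wt
  split_ifs
  · exact pow_nonneg rho_pos.le _
  · exact le_rfl

/-- Bernoulli's inequality gives `(1 + 1 / m) ^ m ≥ 2`. So a pair of weight `m` alone outweighs the
normalization of the potential. -/
theorem two_pow_lam_le (hm : 0 < I.m) : (2 : ℝ) ^ I.lam ≤ I.rho ^ I.m := by
  unfold rho
  rw [← pow_mul, mul_comm, pow_mul]
  refine pow_le_pow_left₀ (by norm_num) ?_ _
  have h := one_add_mul_le_pow (a := 1 / (I.m : ℝ)) (by
    have : (0 : ℝ) ≤ 1 / (I.m : ℝ) := by positivity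
    linarith) I.m
  have hm' : (I.m : ℝ) ≠ 0 := by positivity
  have : (1 : ℝ) + I.m * (1 / I.m) = 2 := by field_simp; norm_num
  linarith

/-- Bernoulli's inequality for the inverse base `1 - 1 / (m + 1)`. It compares the exponential loss
in the potential with the linear growth of the fractional cost. -/
theorem one_sub_le (hm : 0 < I.m) (x : ℕ) : 1 - (I.rho ^ x)⁻¹ ≤ I.lam / I.m * x := by
  have hm' : (0 : ℝ) < I.m := by exact_mod_cast hm
  have h := one_add_mul_le_pow (a := -(1 / ((I.m : ℝ) + 1))) (by
    have : 1 / ((I.m : ℝ) + 1) ≤ 1 := by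
      rw [div_le_one (by positivity)]; linarith
    linarith) (I.lam * x)
  have h2 : (I.rho ^ x)⁻¹ = (1 + -(1 / ((I.m : ℝ) + 1))) ^ (I.lam * x) := by
    unfold rho
    rw [← pow_mul, ← inv_pow]
    congr 1
    field_simp
    ring
  rw [h2]
  have h3 : (I.lam * x : ℝ) * (1 / ((I.m : ℝ) + 1)) ≤ I.lam / I.m * x := by
    rw [mul_one_div, div_mul_eq_mul_div]
    gcongr
    linarith
  push_cast at h
  linarith

theorem pw_eq (hm : 0 < I.m) {x : ℕ} (hx : x ≤ 2 * I.m) :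
    (I.pw (I.lam * x) : ℝ) = (I.m : ℝ) ^ I.X * I.rho ^ x := by
  have hm' : (I.m : ℝ) ≠ 0 := by positivity
  have hle : I.lam * x ≤ I.X := by
    unfold X
    calc I.lam * x ≤ I.lam * (2 * I.m) := Nat.mul_le_mul_left _ hx
      _ = 2 * I.lam * I.m := by ring
  unfold pw rho
  rw [if_pos hle, ← pow_mul]
  push_cast
  have : (1 + 1 / (I.m : ℝ)) = (I.m + 1) / I.m := by field_simp
  rw [this, div_pow]
  have hsplit : (I.m : ℝ) ^ I.X = (I.m : ℝ) ^ (I.lam * x) * (I.m : ℝ) ^ (I.X - I.lam * x) := by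
    rw [← pow_add]; congr 1; omega
  rw [hsplit]
  field_simp

theorem count_u_self (s : Config) (i : ℕ) :
    (I.count s i).u i = s.u i ∨ (I.count s i).u i = 2 * s.u i := by
  simp only [count, Function.update_self]
  split_ifs
  · exact Or.inr rfl
  · exact Or.inl rfl

theorem count_u_of_ne (s : Config) {i i' : ℕ} (h : i' ≠ i) : (I.count s i).u i' = s.u i' := by
  simp [count, h]

theorem expo_count {s : Config} {i : ℕ} (hi : i < I.m) (hu : 0 < s.u i) (j pk : ℕ) :
    I.expo (I.count s i) j pk = I.expo s j pk +
      if I.Near s.B pk i j then (I.count s i).u i - s.u i else 0 := by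
  unfold expo
  rw [← Finset.add_sum_erase _ _ (Finset.mem_range.2 hi),
    ← Finset.add_sum_erase _ (fun i' => if I.Near s.B pk i' j then s.u i' - 1 else 0)
      (Finset.mem_range.2 hi)]
  have h : ∑ x ∈ (Finset.range I.m).erase i,
      (if I.Near (I.count s i).B pk x j then (I.count s i).u x - 1 else 0) =
      ∑ x ∈ (Finset.range I.m).erase i, (if I.Near s.B pk x j then s.u x - 1 else 0) := by
    refine Finset.sum_congr rfl fun x hx => ?_
    rw [count_u_of_ne _ (Finset.ne_of_mem_erase hx), count_B]
  rw [h, count_B]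
  have := I.count_u_self s i
  split_ifs <;> omega

theorem cover_count (s : Config) (i j pk r : ℕ) :
    I.cover (I.count s i) j pk r = I.cover s j pk r := by
  induction r with
  | zero => rfl
  | succ r ih => simp only [cover, ih, count_B, count_opn]

theorem cover_openFac_eq_zero {s : Config} {i j pk : ℕ} (hi : i < I.m) :
    I.cover (openFac s i) j pk I.m = 0 ↔ I.cover s j pk I.m = 0 ∧ ¬ I.Near s.B pk i j := by
  rw [cover_eq_zero, cover_eq_zero]
  constructor
  · intro h
    refine ⟨fun i' hi' h' => h i' hi' ⟨h'.1, ?_⟩, fun h' => h i hi ⟨h', ?_⟩⟩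
    · by_cases hii : i' = i
      · subst hii; simp [openFac]
      · simpa [openFac, hii] using h'.2
    · simp [openFac]
  · rintro ⟨h1, h2⟩ i' hi' ⟨h3, h4⟩
    by_cases hii : i' = i
    · subst hii; exact h2 h3
    · exact h1 i' hi' ⟨h3, by simpa [openFac, hii] using h4⟩

theorem expo_openFac (s : Config) (i j pk : ℕ) : I.expo (openFac s i) j pk = I.expo s j pk := rfl

/-- The real version of `gain`. -/
noncomputable def gainR (I : IntGraph) (s : Config) (i : ℕ) : ℝ :=
  ∑ p ∈ I.pairs, if I.Near s.B (2 ^ p.2) i p.1 then I.wt s p.1 (2 ^ p.2) else 0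

theorem mem_pairs {p : ℕ × ℕ} : p ∈ I.pairs ↔ p.1 < I.n ∧ p.2 ≤ I.L := by
  simp [pairs]

theorem weight_le_of_near {s : Config} {i j pk : ℕ} (hi : i < I.m)
    (hn : I.Near s.B pk i j) : s.u i - 1 ≤ I.expo s j pk := by
  have := Finset.single_le_sum (f := fun i => if I.Near s.B pk i j then s.u i - 1 else 0)
    (fun _ _ => Nat.zero_le _) (Finset.mem_range.2 hi)
  simpa [hn, expo] using this

/-- An uncovered pair has weight less than `m`, so each weight near it is at most `m`, and doubling
one of them adds at most `m`. The exponent stays within the range in which `pw` is a true power. -/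
theorem expo_count_le {s : Config} (hw : WeightInv I s) (ho : OpenInv I s) {i j k : ℕ}
    (hi : i < I.m) (hj : j < I.n) (hk : k ≤ I.L) (hc : I.cover s j (2 ^ k) I.m = 0) :
    I.expo (I.count s i) j (2 ^ k) ≤ 2 * I.m := by
  rw [expo_count hi (hw.pos hi)]
  have h1 := ho.expo_lt j hj k hk hc
  split_ifs with hn
  · have h2 := weight_le_of_near hi hn
    have := hw.pos hi
    have := I.count_u_self s i
    omega
  · omega

/-- The program evaluates the potential exactly, in integers, after multiplication by the common
denominator `m ^ X`. -/
theorem gain_count {s : Config} (hm : 0 < I.m) (hw : WeightInv I s) (ho : OpenInv I s) {i : ℕ}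
    (hi : i < I.m) :
    (I.gain (I.count s i) i : ℝ) = (I.m : ℝ) ^ I.X * I.gainR (I.count s i) i := by
  unfold gain gainR pairs
  rw [← Finset.sum_product', Finset.mul_sum]
  push_cast
  refine Finset.sum_congr rfl fun p hp => ?_
  obtain ⟨h1, h2⟩ := (mem_pairs (I := I)).1 hp
  split_ifs with hn
  · unfold term wt
    split_ifs with hc
    · rw [pw_eq hm (expo_count_le hw ho hi h1 h2 (by rwa [cover_count] at hc))]
    · simp
  · simp

theorem wt_count {s : Config} {i : ℕ} (hi : i < I.m) (hu : 0 < s.u i) (j pk : ℕ) :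
    I.wt (I.count s i) j pk = if I.Near s.B pk i j then
      I.rho ^ ((I.count s i).u i - s.u i) * I.wt s j pk else I.wt s j pk := by
  unfold wt
  rw [cover_count, expo_count hi hu]
  split_ifs <;> simp [pow_add, mul_comm]

theorem gainR_count {s : Config} {i : ℕ} (hi : i < I.m) (hu : 0 < s.u i) :
    I.gainR (I.count s i) i = I.rho ^ ((I.count s i).u i - s.u i) * I.gainR s i := by
  unfold gainR
  rw [Finset.mul_sum]
  refine Finset.sum_congr rfl fun p _ => ?_
  rw [wt_count hi hu, count_B]
  split_ifs <;> simp

theorem sum_wt_count {s : Config} {i : ℕ} (hi : i < I.m) (hu : 0 < s.u i) :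
    ∑ p ∈ I.pairs, I.wt (I.count s i) p.1 (2 ^ p.2) =
      ∑ p ∈ I.pairs, I.wt s p.1 (2 ^ p.2) + (I.gainR (I.count s i) i - I.gainR s i) := by
  unfold gainR
  rw [← Finset.sum_sub_distrib, ← Finset.sum_add_distrib]
  refine Finset.sum_congr rfl fun p _ => ?_
  rw [wt_count hi hu, count_B]
  split_ifs <;> ring

/-- Opening `i` covers exactly the pairs near `i`, and their terms vanish. -/
theorem sum_wt_openFac (s : Config) {i : ℕ} (hi : i < I.m) :
    ∑ p ∈ I.pairs, I.wt (openFac s i) p.1 (2 ^ p.2) =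
      ∑ p ∈ I.pairs, I.wt s p.1 (2 ^ p.2) - I.gainR s i := by
  unfold gainR
  rw [← Finset.sum_sub_distrib]
  refine Finset.sum_congr rfl fun p _ => ?_
  unfold wt
  simp only [cover_openFac_eq_zero hi, expo_openFac]
  by_cases hn : I.Near s.B (2 ^ p.2) i p.1
  · simp [hn]
  · simp [hn]

theorem fac_openFac {s : Config} {i : ℕ} (hi : i < I.m) (h : s.opn i = 0) :
    I.fac (openFac s i) = I.fac s + I.f i := by
  unfold fac
  rw [← Finset.add_sum_erase _ _ (Finset.mem_range.2 hi),
    ← Finset.add_sum_erase _ (fun i' => if s.opn i' ≠ 0 then I.f i' else 0)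
      (Finset.mem_range.2 hi)]
  have h' : ∑ x ∈ (Finset.range I.m).erase i,
      (if (openFac s i).opn x ≠ 0 then I.f x else 0) =
      ∑ x ∈ (Finset.range I.m).erase i, (if s.opn x ≠ 0 then I.f x else 0) := by
    refine Finset.sum_congr rfl fun x hx => ?_
    simp [openFac, Finset.ne_of_mem_erase hx]
  rw [h']
  simp [openFac, h, add_comm]

theorem frac_count {s : Config} {i : ℕ} (hi : i < I.m) :
    I.frac (I.count s i) = I.frac s + I.f i * (((I.count s i).u i - s.u i : ℕ) : ℝ) := by
  unfold frac
  rw [← Finset.add_sum_erase _ _ (Finset.mem_range.2 hi),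
    ← Finset.add_sum_erase _ (fun i' => (I.f i' : ℝ) * ((s.u i' : ℝ) - 1))
      (Finset.mem_range.2 hi)]
  have h' : ∑ x ∈ (Finset.range I.m).erase i, (I.f x : ℝ) * (((I.count s i).u x : ℝ) - 1) =
      ∑ x ∈ (Finset.range I.m).erase i, (I.f x : ℝ) * ((s.u x : ℝ) - 1) := by
    refine Finset.sum_congr rfl fun x hx => ?_
    rw [count_u_of_ne _ (Finset.ne_of_mem_erase hx)]
  rw [h']
  rcases I.count_u_self s i with h | h
  · rw [h]; simp
  · rw [h]
    have : 2 * s.u i - s.u i = s.u i := by omega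
    rw [this]; push_cast; ring

theorem touch_cond_iff {s : Config} (hm : 0 < I.m) (hw : WeightInv I s) (ho : OpenInv I s) {i : ℕ}
    (hi : i < I.m) :
    I.f i * (2 ^ I.lam * I.m ^ I.X) ≤ (I.count s i).B * I.gain (I.count s i) i ↔
      (I.f i : ℝ) ≤ (s.B : ℝ) / 2 ^ I.lam * I.gainR (I.count s i) i := by
  rw [← Nat.cast_le (α := ℝ)]
  push_cast
  rw [gain_count hm hw ho hi, count_B]
  have h1 : (0 : ℝ) < (I.m : ℝ) ^ I.X := by positivity
  rw [div_mul_eq_mul_div, le_div_iff₀ (by positivity)]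
  constructor <;> intro h
  · refine le_of_mul_le_mul_right ?_ h1
    linarith
  · have := mul_le_mul_of_nonneg_right h h1.le
    linarith

/-- Touching a facility does not increase the potential. -/
theorem pot_touch_le {s : Config} (hm : 0 < I.m) (hw : WeightInv I s) (ho : OpenInv I s) {i : ℕ}
    (hi : i < I.m) (hopn : s.opn i = 0) : I.pot (I.touch s i) ≤ I.pot s := by
  have hu := hw.pos hi
  have hiff := touch_cond_iff hm hw ho hi
  set x := (I.count s i).u i - s.u i with hx
  have hb := one_sub_le hm x
  have hg := gainR_count hi hu
  rw [← hx] at hg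
  set a := I.gainR s i
  set a' := I.gainR (I.count s i) i
  set β : ℝ := (s.B : ℝ) / 2 ^ I.lam with hβ
  set r : ℝ := (I.rho ^ x)⁻¹ with hr
  have hrho : 0 < I.rho ^ x := pow_pos rho_pos x
  have hr0 : 0 < r := inv_pos.2 hrho
  have hr1 : r ≤ 1 := inv_le_one_of_one_le₀ (one_le_pow₀ one_le_rho)
  -- Counting multiplies each term near `i` by `rho ^ x`, where `x` is the increase of the weight.
  have ha : a = a' * r := by rw [hg, hr]; field_simp
  have hf : (0 : ℝ) ≤ I.f i := Nat.cast_nonneg _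
  have hsum := sum_wt_count hi hu
  have hfr := frac_count (s := s) hi
  rw [← hx] at hfr
  -- In both cases the rest of the potential grows by at most `f * (1 - r)`, which the subtracted
  -- fractional cost compensates.
  have hfb : (I.f i : ℝ) * (1 - r) ≤ I.lam / I.m * (I.f i * x) := by
    have := mul_le_mul_of_nonneg_left hb hf
    linarith
  unfold touch
  split_ifs with hc
  · rw [hiff] at hc
    have hfo := fac_openFac (s := I.count s i) hi hopn
    have hfc : I.fac (I.count s i) = I.fac s := rfl
    have hso := sum_wt_openFac (I.count s i) hi
    unfold pot
    rw [hso, hsum, hfo, hfc]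
    have e1 : I.frac (openFac (I.count s i) i) = I.frac (I.count s i) := rfl
    rw [e1, hfr]
    simp only [openFac_B, count_B, ← hβ]
    push_cast
    -- Opening adds `f` and removes the terms near `i`, a net change of `f - β * a`. The criterion
    -- `f ≤ β * a'` makes this at most `f * (1 - r)`.
    have h1 : (I.f i : ℝ) * r ≤ β * a := by
      rw [ha]; have := mul_le_mul_of_nonneg_right hc hr0.le; linarith
    nlinarith
  · rw [hiff, not_le] at hc
    have hfc : I.fac (I.count s i) = I.fac s := rfl
    unfold pot
    rw [hsum, hfc, hfr]
    simp only [count_B, ← hβ]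
    -- Without opening, the terms grow by `β * a' * (1 - r)`, and here `β * a'` is less than `f`.
    have h1 : β * (a' - a) ≤ I.f i * (1 - r) := by
      have : β * (a' - a) = (β * a') * (1 - r) := by rw [ha]; ring
      rw [this]
      exact mul_le_mul_of_nonneg_right hc.le (by linarith)
    nlinarith

/-- If a pair stays uncovered with weight at least `m` after the count and is near `i`, its term
alone is at least `2 ^ lam`. Then the scaled gain is at least `B ≥ f`, and `i` would have been
opened. Pairs that are not near `i` keep their weight. -/
theorem openInv_touch {s : Config} (hm : 0 < I.m) (hw : WeightInv I s) (ho : OpenInv I s) {i : ℕ}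
    (hi : i < I.m) (hf : I.f i ≤ s.B) : OpenInv I (I.touch s i) := by
  have hu := hw.pos hi
  have hiff := touch_cond_iff hm hw ho hi
  have hB := (I.touch_fields s i).1
  refine ⟨fun i' hi' h => ?_, fun i' hi' h => ?_, fun j hj k hk h => ?_⟩
  · rw [hB]
    by_cases hii : i' = i
    · rw [hii]; exact hf
    · rw [touch_opn _ _ _ hii] at h
      exact ho.le i' hi' h
  · rw [hB] at h
    exact touch_opn_mono _ _ _ (ho.free i' hi' h)
  · unfold touch at h ⊢
    split_ifs at h ⊢ with hc
    · rw [cover_openFac_eq_zero hi, cover_count] at h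
      have hn : ¬ I.Near s.B (2 ^ k) i j := h.2
      rw [expo_openFac, expo_count hi hu, if_neg hn]
      exact ho.expo_lt j hj k hk h.1
    · rw [cover_count] at h
      by_contra hlt
      rw [not_lt] at hlt
      by_cases hn : I.Near s.B (2 ^ k) i j
      · apply hc
        rw [hiff]
        have h1 : I.rho ^ I.m ≤ I.gainR (I.count s i) i := by
          have h2 := Finset.single_le_sum (s := I.pairs) (f := fun p =>
            if I.Near (I.count s i).B (2 ^ p.2) i p.1 then
              I.wt (I.count s i) p.1 (2 ^ p.2) else 0)
            (fun p _ => by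
              split_ifs
              · exact wt_nonneg _ _ _
              · exact le_rfl) (show (j, k) ∈ I.pairs from mem_pairs.2 ⟨hj, hk⟩)
          simp only [count_B, hn, if_true] at h2
          refine le_trans ?_ h2
          unfold wt
          rw [cover_count, if_pos h]
          exact pow_le_pow_right₀ one_le_rho hlt
        have h3 := (two_pow_lam_le hm).trans h1
        rw [div_mul_eq_mul_div, le_div_iff₀ (by positivity)]
        have hf' : (I.f i : ℝ) ≤ s.B := by exact_mod_cast hf
        exact mul_le_mul hf' h3 (by positivity) (Nat.cast_nonneg _)
      · rw [expo_count hi hu, if_neg hn] at hlt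
        have := ho.expo_lt j hj k hk h
        omega

end IntGraph

namespace IntGraph

variable {I : IntGraph}

theorem one_le_mu (hm : 0 < I.m) : 1 ≤ I.mu := by
  unfold mu
  exact Nat.size_pos.2 hm

theorem one_le_L (hn : 0 < I.n) : 1 ≤ I.L := by
  unfold L
  exact Nat.size_pos.2 hn

theorem NN_pos : 0 < I.NN := by unfold NN; positivity

theorem n_lt_NN : I.n < I.NN := by
  unfold NN L
  exact Nat.lt_size_self _

/-! ### Resetting the weights -/

theorem cover_congr {s t : Config} (hB : s.B = t.B) (ho : s.opn = t.opn) (j pk r : ℕ) :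
    I.cover s j pk r = I.cover t j pk r := by
  induction r with
  | zero => rfl
  | succ r ih => simp only [cover, ih, hB, ho]

theorem expo_reset (s : Config) (j pk : ℕ) : I.expo (I.reset s) j pk = 0 := by
  unfold expo
  refine Finset.sum_eq_zero fun i hi => ?_
  rw [Finset.mem_range] at hi
  simp [reset, hi]

theorem weightInv_reset (s : Config) : WeightInv I (I.reset s) := by
  refine ⟨fun i hi => ⟨0, by simp [reset, hi]⟩, fun i hi => ?_, fun i hi => ?_⟩
  · simp only [reset, hi, if_true]; omega
  · simp [reset, hi]

theorem openInv_reset (hm : 0 < I.m) {s : Config} (h : ∀ i < I.m, s.opn i ≠ 0 → I.f i ≤ s.B) :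
    OpenInv I (I.reset s) := by
  refine ⟨fun i hi h' => ?_, fun i hi h' => ?_, fun j _ k _ _ => ?_⟩
  · simp only [reset] at h' ⊢
    split_ifs at h' with h''
    · exact (Nat.le_mul_of_pos_right _ hm).trans h''.2
    · exact h i hi h'
  · have h'' : I.f i * I.m ≤ s.B := h'
    simp [reset, hi, h'']
  · rw [expo_reset]; exact hm

theorem frac_reset (s : Config) : I.frac (I.reset s) = 0 := by
  unfold frac
  refine Finset.sum_eq_zero fun i hi => ?_
  rw [Finset.mem_range] at hi
  simp [reset, hi]

/-- Each newly opened facility costs at most `B / m`, and there are at most `m` of them. -/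
theorem fac_reset_le (hm : 0 < I.m) (s : Config) : I.fac (I.reset s) ≤ I.fac s + s.B := by
  have h1 : I.fac (I.reset s) ≤ ∑ i ∈ Finset.range I.m,
      ((if s.opn i ≠ 0 then I.f i else 0) + s.B / I.m) := by
    unfold fac
    refine Finset.sum_le_sum fun i hi => ?_
    rw [Finset.mem_range] at hi
    simp only [reset]
    by_cases hf : I.f i * I.m ≤ s.B
    · have : I.f i ≤ s.B / I.m := (Nat.le_div_iff_mul_le hm).2 hf
      simp only [hi, hf, and_self, if_true]
      split_ifs <;> omega
    · simp [hf]
  refine h1.trans ?_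
  rw [Finset.sum_add_distrib]
  have : ∑ _i ∈ Finset.range I.m, s.B / I.m ≤ s.B := by
    rw [Finset.sum_const, Finset.card_range, smul_eq_mul]
    exact Nat.mul_div_le _ _
  unfold fac
  omega

/-- All exponents are 0 after a reset, so the sum of the terms is at most the number of pairs, hence
at most `2 ^ lam`. One `B` pays for this and one for the very cheap facilities. -/
theorem pot_reset_le (hm : 0 < I.m) (s : Config) :
    I.pot (I.reset s) ≤ I.fac s + 2 * s.B := by
  unfold pot
  rw [frac_reset]
  have h1 : (I.fac (I.reset s) : ℝ) ≤ I.fac s + s.B := by exact_mod_cast fac_reset_le hm s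
  have h2 : ∑ p ∈ I.pairs, I.wt (I.reset s) p.1 (2 ^ p.2) ≤ 2 ^ I.lam := by
    calc ∑ p ∈ I.pairs, I.wt (I.reset s) p.1 (2 ^ p.2) ≤ ∑ _p ∈ I.pairs, (1 : ℝ) := by
          refine Finset.sum_le_sum fun p _ => ?_
          unfold wt
          rw [expo_reset]
          split_ifs <;> simp
      _ = ((I.n * (I.L + 1) : ℕ) : ℝ) := by simp [pairs]
      _ ≤ ((2 ^ I.L * 2 ^ I.L : ℕ) : ℝ) := by
          refine Nat.cast_le.2 (Nat.mul_le_mul ?_ ?_)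
          · exact (n_lt_NN (I := I)).le
          · exact Nat.lt_two_pow_self
      _ = 2 ^ I.lam := by
          rw [← pow_add, ← two_mul]
          push_cast
          rfl
  have h3 : (s.B : ℝ) / 2 ^ I.lam * ∑ p ∈ I.pairs, I.wt (I.reset s) p.1 (2 ^ p.2) ≤ s.B := by
    rw [div_mul_eq_mul_div, div_le_iff₀ (by positivity)]
    exact mul_le_mul_of_nonneg_left h2 (Nat.cast_nonneg _)
  have h4 : (I.reset s).B = s.B := rfl
  rw [h4]
  linarith

/-! ### The invariants -/

/-- The total cost of the purchased edges. -/
def conn (I : IntGraph) (s : Config) : ℕ :=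
  ∑ x ∈ Finset.range (I.m * I.n), if s.be x ≠ 0 then I.d (x / I.n) (x % I.n) else 0

/-- An offline solution opens the facilities of `O` and connects the client `j` to `a j`. -/
structure Solution (I : IntGraph) (O : Finset ℕ) (a : ℕ → ℕ) (l : List ℕ) : Prop where
  subset : O ⊆ Finset.range I.m
  lt : ∀ j ∈ l, j < I.n
  mem : ∀ j ∈ l, a j ∈ O
  edge : ∀ j ∈ l, I.e (a j) j ≠ 0

/-- The connection cost of an offline solution. -/
def connOpt (I : IntGraph) (a : ℕ → ℕ) (l : List ℕ) : ℕ := (l.map fun j => I.d (a j) j).sum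

/-- The cost of an offline solution. -/
def costOpt (I : IntGraph) (O : Finset ℕ) (a : ℕ → ℕ) (l : List ℕ) : ℕ :=
  ∑ i ∈ O, I.f i + I.connOpt a l

/-- The progress of the counters of the facilities in `O`. -/
def progress (I : IntGraph) (O : Finset ℕ) (s : Config) : ℕ :=
  ∑ i ∈ O, (2 * Nat.log 2 (s.u i) * (I.f i * (I.m * I.NN)) + s.c i * s.B)

/-- The fractional cost, including the counters. -/
def fracNat (I : IntGraph) (s : Config) : ℕ :=
  ∑ i ∈ Finset.range I.m, (I.f i * (s.u i - 1) * (I.m * I.NN) + s.c i * s.u i * s.B)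

/-- The invariants that do not refer to costs. -/
structure BaseInv (I : IntGraph) (opt : ℕ) (l : List ℕ) (s : Config) : Prop where
  weight : WeightInv I s
  opn : OpenInv I s
  q_le : s.q ≤ I.Q
  B_le : s.B ≤ 2 * opt
  c_le : ∀ i < I.m, s.c i ≤ s.q
  frac_le : I.fracNat s ≤ 2 * I.m * s.q * s.B
  served : ∀ j ∈ l, ∃ i < I.m, s.opn i ≠ 0 ∧ s.be (i * I.n + j) ≠ 0
  edge : ∀ i < I.m, ∀ j < I.n, s.be (i * I.n + j) ≠ 0 → I.e i j ≠ 0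

/-- The bounds for the cost of the algorithm; the connections so far are paid by the rounds before
round `q0`. -/
def CostInv (I : IntGraph) (l : List ℕ) (s : Config) (q0 : ℕ) : Prop :=
  ∃ P P' : ℝ, I.pot s ≤ P ∧
    (I.conn s : ℝ) * (I.NN * (I.mu * I.m)) ≤ P' * (I.NN * (I.mu * I.m)) +
      s.B * (I.mu * I.m) * l.length + 2 * s.B * q0 ∧
    P + P' ≤ (16 * I.lam * I.mu + 2) * s.B

/-- As long as the guess is not too small, the rounds can be charged to the offline solution; `z`
rounds (times `B`) are charged to the connection of the current client. -/
def LowerInv (I : IntGraph) (O : Finset ℕ) (a : ℕ → ℕ) (opt : ℕ) (l : List ℕ) (s : Config)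
    (zok : ℕ → Prop) : Prop :=
  opt ≤ s.B → (s.B = 0 → s.q = 0) ∧ ∃ sd z, s.q * s.B ≤
    I.progress O s + 2 * (I.mu * I.m * I.NN) * sd + z ∧ sd ≤ I.connOpt a l ∧ zok z

/-- The invariants between the service of two clients. -/
structure ClientInv (I : IntGraph) (O : Finset ℕ) (a : ℕ → ℕ) (opt : ℕ) (l : List ℕ)
    (s : Config) : Prop where
  base : BaseInv I opt l s
  cost : CostInv I l s s.q
  lower : LowerInv I O a opt l s (fun z => z = 0)

/-- The invariants during the service of the client `j`. -/
structure StepInv (I : IntGraph) (O : Finset ℕ) (a : ℕ → ℕ) (opt : ℕ) (l : List ℕ) (j k : ℕ)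
    (s : Config) : Prop where
  base : BaseInv I opt l s
  done : s.done = 0
  k_le : k ≤ I.L
  pk : s.pk = 2 ^ k
  tau_le : s.pk < I.NN → s.tau ≤ I.mu * I.m * s.pk
  cost : ∃ q0, CostInv I l s q0 ∧ q0 + s.tau ≤ s.q ∧
    (s.pk = 1 ∨ 2 * q0 + s.pk * (I.mu * I.m) ≤ 2 * s.q)
  lower : LowerInv I O a opt l s (fun z => z ≤ 2 * (I.mu * I.m * I.NN) * I.d (a j) j ∧
    (s.B * s.pk < I.d (a j) j * I.NN → z ≤ s.B * (I.mu * I.m * (s.pk - 1) + s.tau)))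

variable {O : Finset ℕ} {a : ℕ → ℕ} {opt : ℕ} {l : List ℕ} {j k : ℕ} {s : Config}

/-! ### The total cost in terms of the guess -/

theorem fac_le_pot_add (s : Config) : (I.fac s : ℝ) ≤ I.pot s + I.lam / I.m * I.frac s := by
  unfold pot
  have : 0 ≤ (s.B : ℝ) / 2 ^ I.lam * ∑ p ∈ I.pairs, I.wt s p.1 (2 ^ p.2) :=
    mul_nonneg (by positivity) (Finset.sum_nonneg fun p _ => wt_nonneg _ _ _)
  linarith

theorem frac_mul_le (hw : WeightInv I s) : I.frac s * (I.m * I.NN) ≤ I.fracNat s := by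
  unfold frac fracNat
  rw [Finset.sum_mul]
  push_cast
  refine Finset.sum_le_sum fun i hi => ?_
  have := hw.pos (Finset.mem_range.1 hi)
  rw [Nat.cast_sub this, Nat.cast_one]
  have : (0 : ℝ) ≤ s.c i * s.u i * s.B := by positivity
  linarith

/-- With at most `4 * mu * m * NN` rounds in the phase, the fractional cost contributes at most `8 *
lam * mu * B` and the connections at most `B + 8 * B`; `P + P'` covers the past. The bound for guess
`B` is half of what `costInv_reset` admits per unit of the doubled guess, which makes the phases add
up geometrically. -/
theorem cost_le (hm : 0 < I.m) (hn : 0 < I.n) (hl : l.length ≤ I.n) (hb : BaseInv I opt l s)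
    {q0 : ℕ} (hq : q0 ≤ s.q) (hc : CostInv I l s q0) :
    (I.fac s : ℝ) + I.conn s ≤ 2 * (16 * I.lam * I.mu) * s.B := by
  obtain ⟨P, P', h1, h2, h3⟩ := hc
  have hm' : (0 : ℝ) < I.m := by exact_mod_cast hm
  have hN : (0 : ℝ) < I.NN := by exact_mod_cast NN_pos
  have hmu : (1 : ℝ) ≤ I.mu := by exact_mod_cast one_le_mu hm
  have hlam : (2 : ℝ) ≤ I.lam := by
    have := one_le_L hn
    have : 2 ≤ I.lam := by unfold lam; omega
    exact_mod_cast this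
  have hB : (0 : ℝ) ≤ s.B := Nat.cast_nonneg _
  have hQ : (I.Q : ℝ) ≤ 4 * (I.mu * I.m * I.NN) := by
    have : I.Q ≤ 4 * (I.mu * I.m * I.NN) := by
      have : 0 < I.mu * I.m * I.NN := Nat.mul_pos (Nat.mul_pos (one_le_mu hm) hm) NN_pos
      have h : I.Q = 3 * (I.mu * I.m * I.NN) + 1 := by unfold Q; ring
      omega
    exact_mod_cast this
  have hq1 : (s.q : ℝ) ≤ I.Q := by exact_mod_cast hb.q_le
  have hq0 : (q0 : ℝ) ≤ I.Q := (Nat.cast_le.2 hq).trans hq1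
  have hfr : I.lam / I.m * I.frac s ≤ 8 * I.lam * I.mu * s.B := by
    have e1 := frac_mul_le hb.weight
    have e2 : (I.fracNat s : ℝ) ≤ 2 * I.m * s.q * s.B := by exact_mod_cast hb.frac_le
    have e3 : I.frac s * (I.m * I.NN) ≤ (8 * I.mu * I.m * s.B) * (I.m * I.NN) := by
      calc I.frac s * (I.m * I.NN) ≤ 2 * I.m * s.q * s.B := e1.trans e2
        _ ≤ 2 * I.m * (4 * (I.mu * I.m * I.NN)) * s.B := by
            gcongr
            exact hq1.trans hQ
        _ = _ := by ring
    have e4 := le_of_mul_le_mul_right e3 (by positivity)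
    calc I.lam / I.m * I.frac s ≤ I.lam / I.m * (8 * I.mu * I.m * s.B) := by gcongr
      _ = 8 * I.lam * I.mu * s.B := by field_simp
  have hconn : (I.conn s : ℝ) ≤ P' + 9 * s.B := by
    have e0 : (0 : ℝ) < I.NN * (I.mu * I.m) := by positivity
    refine le_of_mul_le_mul_right ?_ e0
    refine h2.trans ?_
    have e1 : (l.length : ℝ) ≤ I.NN := by
      exact_mod_cast hl.trans n_lt_NN.le
    have e2 : (s.B : ℝ) * (I.mu * I.m) * l.length ≤ s.B * (I.mu * I.m) * I.NN := by gcongr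
    have e3 : 2 * (s.B : ℝ) * q0 ≤ 2 * s.B * (4 * (I.mu * I.m * I.NN)) := by
      gcongr
      exact hq0.trans hQ
    linarith
  have hfac := fac_le_pot_add (I := I) s
  -- The remainder `(2 + 9) * B` is absorbed by a third share of `8 * lam * mu * B`, after the
  -- shares 16 and 8.
  have hlm : 16 ≤ 8 * ((I.lam : ℝ) * I.mu) := by nlinarith
  have : 16 * (s.B : ℝ) ≤ 8 * ((I.lam : ℝ) * I.mu) * s.B := mul_le_mul_of_nonneg_right hlm hB
  nlinarith

/-! ### The guess is increased only if it is smaller than the optimum -/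

theorem log_weight_le (hw : WeightInv I s) {i : ℕ} (hi : i < I.m) :
    Nat.log 2 (s.u i) ≤ I.mu := by
  have h1 := hw.le i hi
  have h2 := Nat.lt_size_self I.m
  have h3 : Nat.log 2 (s.u i) < I.mu + 1 := by
    refine Nat.log_lt_of_lt_pow (hw.pos hi).ne' ?_
    rw [pow_succ]
    unfold mu
    omega
  omega

/-- A facility has at most `mu` doublings, each counted twice, and one incomplete counter, which
makes `2 * mu + 1 ≤ 3 * mu` units of `f * m * NN`. -/
theorem progress_le (hO : O ⊆ Finset.range I.m) (hm : 0 < I.m) (hw : WeightInv I s) :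
    I.progress O s ≤ 3 * (I.mu * I.m * I.NN) * ∑ i ∈ O, I.f i := by
  unfold progress
  rw [Finset.mul_sum]
  refine Finset.sum_le_sum fun i hi => ?_
  have hi' := Finset.mem_range.1 (hO hi)
  have h1 := log_weight_le hw hi'
  have h2 := hw.counter i hi'
  have h3 : 2 * Nat.log 2 (s.u i) * (I.f i * (I.m * I.NN)) ≤
      2 * I.mu * (I.f i * (I.m * I.NN)) := by gcongr
  have h4 : 1 * (I.f i * (I.m * I.NN)) ≤ I.mu * (I.f i * (I.m * I.NN)) :=
    Nat.mul_le_mul_right _ (one_le_mu hm)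
  calc _ ≤ 2 * I.mu * (I.f i * (I.m * I.NN)) + I.mu * (I.f i * (I.m * I.NN)) := by omega
    _ = _ := by ring

/-- If the guess were at least `opt`, then `LowerInv` would charge all rounds to the offline
solution and give `q * B ≤ 3 * mu * m * NN * opt ≤ (Q - 1) * B`, with `B` positive. The current
client contributes through `z`. -/
theorem lt_opt_of_Q_le (hm : 0 < I.m) (hO : O ⊆ Finset.range I.m)
    (hopt : I.costOpt O a (l ++ [j]) ≤ opt) (h : StepInv I O a opt l j k s) (hq : I.Q ≤ s.q) :
    s.B < opt := by
  by_contra hlt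
  rw [not_lt] at hlt
  obtain ⟨h0, sd, z, h1, h2, h3, -⟩ := h.lower hlt
  have hQ : I.Q = 3 * (I.mu * I.m * I.NN) + 1 := by unfold Q; ring
  have hB : 0 < s.B := by
    rcases Nat.eq_zero_or_pos s.B with hB | hB
    · have := h0 hB; omega
    · exact hB
  have hp := progress_le hO hm h.base.weight
  have hc : I.costOpt O a (l ++ [j]) = ∑ i ∈ O, I.f i + (I.connOpt a l + I.d (a j) j) := by
    simp [costOpt, connOpt]
  rw [hc] at hopt
  set Y := I.mu * I.m * I.NN
  have e1 : I.Q * s.B ≤ 3 * Y * opt := by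
    calc I.Q * s.B ≤ s.q * s.B := Nat.mul_le_mul_right _ hq
      _ ≤ 3 * Y * (∑ i ∈ O, I.f i) + 2 * Y * sd + 2 * Y * I.d (a j) j := by omega
      _ ≤ 3 * Y * (∑ i ∈ O, I.f i) + 2 * Y * I.connOpt a l + 2 * Y * I.d (a j) j := by gcongr
      _ ≤ 3 * Y * (∑ i ∈ O, I.f i) + 3 * Y * I.connOpt a l + 3 * Y * I.d (a j) j := by
          gcongr <;> omega
      _ = 3 * Y * (∑ i ∈ O, I.f i + (I.connOpt a l + I.d (a j) j)) := by ring
      _ ≤ 3 * Y * opt := by gcongr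
  have e2 : 3 * Y * opt ≤ 3 * Y * s.B := Nat.mul_le_mul_left _ hlt
  rw [hQ, add_mul] at e1
  omega

/-! ### A round -/

theorem not_open_of_near (hc : I.cover s j s.pk I.m = 0) {i : ℕ}
    (hi : i < I.m) (hn : I.Near s.B s.pk i j) : s.opn i = 0 := by
  rw [cover_eq_zero] at hc
  by_contra h'
  exact hc i hi ⟨hn, h'⟩

theorem expo_lt_of_uncovered (h : StepInv I O a opt l j k s) (hj : j < I.n)
    (hc : I.cover s j s.pk I.m = 0) : I.expo s j s.pk < I.m := by
  rw [h.pk] at hc ⊢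
  exact h.base.opn.expo_lt j hj k h.k_le hc

/-- Only weights near an uncovered client are doubled, so this keeps all weights at most `2 * m`. -/
theorem weight_le_m (h : StepInv I O a opt l j k s) (hj : j < I.n)
    (hc : I.cover s j s.pk I.m = 0) {i : ℕ} (hi : i < I.m) (hn : I.Near s.B s.pk i j) :
    s.u i ≤ I.m := by
  have h1 := expo_lt_of_uncovered h hj hc
  have h2 := weight_le_of_near hi hn
  omega

theorem weightInv_touchAll (hw : WeightInv I s) (hu : ∀ i < I.m, I.Near s.B s.pk i j →
    s.u i ≤ I.m) (r : ℕ) : WeightInv I (I.touchAll s j r) := by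
  have hB := (I.touchAll_fields s j r).1
  refine ⟨fun i hi => ?_, fun i hi => ?_, fun i hi => ?_⟩
  · rw [(I.touchAll_cu s j r i).2]
    obtain ⟨k, hk⟩ := hw.pow i hi
    split_ifs
    · rcases I.count_u_self s i with h | h <;> rw [h]
      · exact ⟨k, hk⟩
      · exact ⟨k + 1, by rw [hk, pow_succ, mul_comm]⟩
    · exact ⟨k, hk⟩
  · rw [(I.touchAll_cu s j r i).2]
    split_ifs with hn
    · have := hu i hi hn.2.1
      have := I.count_u_self s i
      omega
    · exact hw.le i hi
  · rw [(I.touchAll_cu s j r i).1, hB]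
    split_ifs with hn
    · simp only [count, Function.update_self]
      split_ifs with h'
      · simp
      · omega
    · exact hw.counter i hi

/-- A near facility is closed before the round and can be opened only by its own touch, so it is
still closed when it is touched, as `pot_touch_le` requires. -/
theorem openInv_touchAll (hm : 0 < I.m) (hw : WeightInv I s) (ho : OpenInv I s)
    (hu : ∀ i < I.m, I.Near s.B s.pk i j → s.u i ≤ I.m)
    (hopn : ∀ i < I.m, I.Near s.B s.pk i j → s.opn i = 0) (r : ℕ) (hr : r ≤ I.m) :
    OpenInv I (I.touchAll s j r) ∧ I.pot (I.touchAll s j r) ≤ I.pot s := by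
  induction r with
  | zero => exact ⟨ho, le_rfl⟩
  | succ r ih =>
    obtain ⟨h1, h2⟩ := ih (by omega)
    simp only [touchAll]
    split_ifs with h
    · have hw' := weightInv_touchAll hw hu r
      have hB := (I.touchAll_fields s j r).1
      have ho' : (I.touchAll s j r).opn r = 0 := by
        rw [touchAll_opn_of_le _ _ _ _ le_rfl]
        exact hopn r (by omega) h.1
      exact ⟨openInv_touch hm hw' h1 (by omega) (by rw [hB]; exact h.2),
        (pot_touch_le hm hw' h1 (by omega) ho').trans h2⟩
    · exact ⟨h1, h2⟩

/-- Touching a facility raises its summand by at most `u * B`: an advance adds this to the counter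
term, and a completed counter has already paid for the doubled weight. The touched weights add up to
at most `expo + m`, which is less than `2 * m`. -/
theorem fracNat_touchAll_le (hw : WeightInv I s) (he : I.expo s j s.pk < I.m) :
    I.fracNat (I.touchAll s j I.m) ≤ I.fracNat s + 2 * I.m * s.B := by
  have hB := (I.touchAll_fields s j I.m).1
  have h1 : I.fracNat (I.touchAll s j I.m) ≤ I.fracNat s +
      ∑ i ∈ Finset.range I.m, s.B * ((if I.Near s.B s.pk i j then s.u i - 1 else 0) + 1) := by
    unfold fracNat
    rw [← Finset.sum_add_distrib]
    refine Finset.sum_le_sum fun i hi => ?_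
    have hi := Finset.mem_range.1 hi
    rw [(I.touchAll_cu s j I.m i).1, (I.touchAll_cu s j I.m i).2, hB]
    by_cases hn : i < I.m ∧ I.Near s.B s.pk i j ∧ I.f i ≤ s.B
    · rw [if_pos hn, if_pos hn, if_pos hn.2.1]
      have hpos := hw.pos hi
      obtain ⟨v, hv⟩ : ∃ v, s.u i = v + 1 := ⟨s.u i - 1, by omega⟩
      simp only [count, Function.update_self]
      split_ifs with hc
      · rw [hv]
        have e1 : 2 * (v + 1) - 1 = v + (v + 1) := by omega
        have e2 : v + 1 - 1 = v := by omega
        rw [e1, e2]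
        nlinarith [Nat.mul_le_mul_left (v + 1) hc]
      · rw [hv]
        have e2 : v + 1 - 1 = v := by omega
        rw [e2]
        nlinarith
    · rw [if_neg hn, if_neg hn]
      omega
  refine h1.trans ?_
  rw [← Finset.mul_sum, Finset.sum_add_distrib]
  have h2 : ∑ i ∈ Finset.range I.m, (if I.Near s.B s.pk i j then s.u i - 1 else 0) =
    I.expo s j s.pk := rfl
  rw [h2]
  simp only [Finset.sum_const, Finset.card_range, smul_eq_mul, mul_one]
  have : s.B * (I.expo s j s.pk + I.m) ≤ s.B * (2 * I.m) := Nat.mul_le_mul_left _ (by omega)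
  have e : s.B * (2 * I.m) = 2 * I.m * s.B := mul_comm _ _
  omega

/-- A completed counter gives up at most `f * m * NN`. The factor 2 of the logarithm returns twice
that amount, so at least `f * m * NN ≥ B` is gained. -/
theorem progress_summand_le (hw : WeightInv I s) {i : ℕ} (hi : i < I.m)
    (hf : s.B ≤ I.f i * (I.m * I.NN)) :
    2 * Nat.log 2 (s.u i) * (I.f i * (I.m * I.NN)) + s.c i * s.B + s.B ≤
      2 * Nat.log 2 ((I.count s i).u i) * (I.f i * (I.m * I.NN)) + (I.count s i).c i * s.B := by
  simp only [count, Function.update_self]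
  have h1 := hw.counter i hi
  have h2 := hw.pos hi
  split_ifs with hc
  · rw [mul_comm 2 (s.u i), Nat.log_mul_base (by norm_num) h2.ne']
    nlinarith
  · nlinarith

theorem progress_touchAll (hO : O ⊆ Finset.range I.m) (hw : WeightInv I s)
    (hnf : ∀ i < I.m, I.Near s.B s.pk i j → s.B ≤ I.f i * (I.m * I.NN)) :
    I.progress O s ≤ I.progress O (I.touchAll s j I.m) ∧ ∀ i ∈ O, I.Near s.B s.pk i j →
      I.f i ≤ s.B → I.progress O s + s.B ≤ I.progress O (I.touchAll s j I.m) := by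
  have hB := (I.touchAll_fields s j I.m).1
  have h1 : ∀ i ∈ O, 2 * Nat.log 2 (s.u i) * (I.f i * (I.m * I.NN)) + s.c i * s.B +
      (if I.Near s.B s.pk i j ∧ I.f i ≤ s.B then s.B else 0) ≤
      2 * Nat.log 2 ((I.touchAll s j I.m).u i) * (I.f i * (I.m * I.NN)) +
        (I.touchAll s j I.m).c i * (I.touchAll s j I.m).B := by
    intro i hi
    have hi := Finset.mem_range.1 (hO hi)
    rw [(I.touchAll_cu s j I.m i).1, (I.touchAll_cu s j I.m i).2, hB]
    by_cases hn : I.Near s.B s.pk i j ∧ I.f i ≤ s.B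
    · rw [if_pos hn, if_pos ⟨hi, hn⟩, if_pos ⟨hi, hn⟩]
      exact progress_summand_le hw hi (hnf i hi hn.1)
    · rw [if_neg hn, if_neg (fun h => hn h.2), if_neg (fun h => hn h.2)]
      omega
  have h2 := Finset.sum_le_sum h1
  rw [Finset.sum_add_distrib] at h2
  have h3 : I.progress O s + ∑ i ∈ O, (if I.Near s.B s.pk i j ∧ I.f i ≤ s.B then s.B else 0) ≤
    I.progress O (I.touchAll s j I.m) := h2
  refine ⟨by omega, fun i hi hn hf => ?_⟩
  have h4 := Finset.single_le_sum (f := fun i =>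
    if I.Near s.B s.pk i j ∧ I.f i ≤ s.B then s.B else 0) (fun _ _ => Nat.zero_le _) hi
  simp only [hn, hf, and_self, if_true] at h4
  omega

end IntGraph

namespace IntGraph

variable {I : IntGraph} {O : Finset ℕ} {a : ℕ → ℕ} {opt : ℕ} {l : List ℕ} {j k : ℕ} {s : Config}

theorem connOpt_append_singleton : I.connOpt a (l ++ [j]) = I.connOpt a l + I.d (a j) j := by
  simp [connOpt]

/-! ### Preservation of the invariants -/

theorem pot_congr {s t : Config} (hB : s.B = t.B) (ho : s.opn = t.opn) (hu : s.u = t.u) :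
    I.pot s = I.pot t := by
  have h1 : ∀ j pk, I.expo s j pk = I.expo t j pk := fun j pk => by unfold expo; rw [hB, hu]
  have h2 : I.fac s = I.fac t := by unfold fac; rw [ho]
  have h3 : I.frac s = I.frac t := by unfold frac; rw [hu]
  unfold pot wt
  simp only [h1, h2, h3, hB, cover_congr hB ho]

theorem costInv_of_pot_le {s t : Config} {q0 : ℕ} (h : CostInv I l s q0) (hp : I.pot t ≤ I.pot s)
    (hb : t.be = s.be) (hB : t.B = s.B) : CostInv I l t q0 := by
  obtain ⟨P, P', h1, h2, h3⟩ := h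
  refine ⟨P, P', hp.trans h1, ?_, by rw [hB]; exact h3⟩
  have : I.conn t = I.conn s := by simp [conn, hb]
  rw [this, hB]
  exact h2

theorem flat_index_lt {i m j n : ℕ} (hi : i < m) (hj : j < n) : i * n + j < m * n := by
  calc i * n + j < i * n + n := by omega
    _ = (i + 1) * n := by ring
    _ ≤ m * n := Nat.mul_le_mul_right _ hi

theorem flat_index_div {i j n : ℕ} (hj : j < n) : (i * n + j) / n = i := by
  rw [mul_comm, Nat.mul_add_div (by omega), Nat.div_eq_of_lt hj, add_zero]

theorem flat_index_mod {i j n : ℕ} (hj : j < n) : (i * n + j) % n = j := by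
  rw [mul_comm, Nat.mul_add_mod, Nat.mod_eq_of_lt hj]

theorem conn_update_le {i : ℕ} (hi : i < I.m) (hj : j < I.n) {t : Config}
    (ht : t.be = Function.update s.be (i * I.n + j) 1) : I.conn t ≤ I.conn s + I.d i j := by
  unfold conn
  have hx := Finset.mem_range.2 (flat_index_lt hi hj)
  rw [← Finset.add_sum_erase _ _ hx, ← Finset.add_sum_erase _ (fun x =>
    if s.be x ≠ 0 then I.d (x / I.n) (x % I.n) else 0) hx]
  have h' : ∑ x ∈ (Finset.range (I.m * I.n)).erase (i * I.n + j),
      (if t.be x ≠ 0 then I.d (x / I.n) (x % I.n) else 0) =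
      ∑ x ∈ (Finset.range (I.m * I.n)).erase (i * I.n + j),
      (if s.be x ≠ 0 then I.d (x / I.n) (x % I.n) else 0) := by
    refine Finset.sum_congr rfl fun x hx => ?_
    rw [ht, Function.update_of_ne (Finset.ne_of_mem_erase hx)]
  rw [h', flat_index_div hj, flat_index_mod hj]
  have : (if t.be (i * I.n + j) ≠ 0 then I.d i j else 0) ≤ I.d i j := by split_ifs <;> omega
  omega

/-- The rounds from `q0` on belong to the current client and have not yet paid for any connection,
so they can pay for this one. The rounds in `z` are booked on the offline connection cost of the
client, which joins `sd`. -/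
theorem clientInv_connect (hj : j < I.n) (h : StepInv I O a opt l j k s)
    (hc : I.cover s j s.pk I.m ≠ 0) :
    ClientInv I O a opt (l ++ [j]) { s with
      be := Function.update s.be ((I.cover s j s.pk I.m - 1) * I.n + j) 1, done := 1 } := by
  obtain ⟨hi, hn, ho⟩ := cover_spec hc
  set i := I.cover s j s.pk I.m - 1
  have hb := h.base
  have hcov : ∀ j' pk r, I.cover { s with be := Function.update s.be (i * I.n + j) 1, done := 1 }
      j' pk r = I.cover s j' pk r := fun j pk r => cover_congr (by rfl) (by rfl) j pk r
  refine ⟨⟨⟨hb.weight.pow, hb.weight.le, hb.weight.counter⟩, ⟨hb.opn.le, hb.opn.free, ?_⟩,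
    hb.q_le, hb.B_le, hb.c_le, hb.frac_le, ?_, ?_⟩, ?_, ?_⟩
  · intro j' hj' k' hk' hc'
    rw [hcov] at hc'
    exact hb.opn.expo_lt j' hj' k' hk' hc'
  · intro j' hj'
    rcases List.mem_append.1 hj' with hj' | hj'
    · obtain ⟨i', h1, h2, h3⟩ := hb.served j' hj'
      refine ⟨i', h1, h2, ?_⟩
      by_cases hx : i' * I.n + j' = i * I.n + j
      · simp [hx]
      · simpa [hx] using h3
    · rw [List.mem_singleton] at hj'
      subst hj'
      exact ⟨i, hi, ho, by simp⟩
  · intro i' hi' j' hj' h'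
    by_cases hx : i' * I.n + j' = i * I.n + j
    · have e1 : i' = i := by
        rw [← flat_index_div (i := i') hj', hx, flat_index_div hj]
      have e2 : j' = j := by
        rw [← flat_index_mod (i := i') hj', hx, flat_index_mod hj]
      rw [e1, e2]
      exact hn.1
    · replace h' : Function.update s.be (i * I.n + j) 1 (i' * I.n + j') ≠ 0 := h'
      rw [Function.update_of_ne hx] at h'
      exact hb.edge i' hi' j' hj' h'
  · obtain ⟨q0, ⟨P, P', h1, h2, h3⟩, h4, h5⟩ := h.cost
    refine ⟨P, P', ?_, ?_, h3⟩
    · refine le_trans (le_of_eq ?_) h1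
      exact pot_congr rfl rfl rfl
    · have h6 := conn_update_le (s := s) hi hj (t := { s with
        be := Function.update s.be (i * I.n + j) 1, done := 1 }) rfl
      have h7 : I.conn _ * (I.NN * (I.mu * I.m)) ≤
        (I.conn s + I.d i j) * (I.NN * (I.mu * I.m)) := Nat.mul_le_mul_right _ h6
      have h8 : I.d i j * (I.NN * (I.mu * I.m)) ≤ s.B * s.pk * (I.mu * I.m) := by
        rw [← mul_assoc]
        exact Nat.mul_le_mul_right _ hn.2
      -- A connection at the smallest radius is paid by the term for the number of clients, a longer
      -- one by the rounds between `q0` and `q`.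
      have h9 : s.B * s.pk * (I.mu * I.m) + 2 * s.B * q0 ≤
          s.B * (I.mu * I.m) + 2 * s.B * s.q := by
        rcases h5 with h5 | h5
        · rw [h5, mul_one]
          have : 2 * s.B * q0 ≤ 2 * s.B * s.q := Nat.mul_le_mul_left _ (by omega)
          omega
        · have := Nat.mul_le_mul_left s.B h5
          have e : s.B * (2 * q0 + s.pk * (I.mu * I.m)) =
            s.B * s.pk * (I.mu * I.m) + 2 * s.B * q0 := by ring
          have e' : s.B * (2 * s.q) = 2 * s.B * s.q := by ring
          omega
      rify at h7 h8 h9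
      simp only [List.length_append, List.length_singleton, Nat.cast_add, Nat.cast_one]
      rw [add_mul] at h7
      linarith
  · intro hopt
    obtain ⟨h0, sd, z, h1, h2, h3, -⟩ := h.lower hopt
    refine ⟨h0, sd + I.d (a j) j, 0, ?_, ?_, rfl⟩
    · have e : I.progress O { s with
          be := Function.update s.be (i * I.n + j) 1, done := 1 } = I.progress O s := rfl
      rw [e]
      change s.q * s.B ≤ _
      rw [mul_add]
      omega
    · rw [connOpt_append_singleton]
      omega

/-! ### Transitions between rounds, radii and guesses -/

theorem reset_opn_mono {i : ℕ} (h : s.opn i ≠ 0) : (I.reset s).opn i ≠ 0 := by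
  simp only [reset]
  split_ifs
  · exact one_ne_zero
  · exact h

theorem baseInv_reset (hm : 0 < I.m) (hB : s.B ≤ 2 * opt)
    (hopn : ∀ i < I.m, s.opn i ≠ 0 → I.f i ≤ s.B)
    (hs : ∀ j ∈ l, ∃ i < I.m, s.opn i ≠ 0 ∧ s.be (i * I.n + j) ≠ 0)
    (he : ∀ i < I.m, ∀ j < I.n, s.be (i * I.n + j) ≠ 0 → I.e i j ≠ 0) :
    BaseInv I opt l (I.reset s) := by
  refine ⟨weightInv_reset s, openInv_reset hm hopn, Nat.zero_le _, hB, fun i hi => ?_, ?_, ?_, he⟩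
  · simp [reset, hi]
  · have : I.fracNat (I.reset s) = 0 := by
      unfold fracNat
      refine Finset.sum_eq_zero fun i hi => ?_
      rw [Finset.mem_range] at hi
      simp [reset, hi]
    rw [this]
    exact Nat.zero_le _
  · intro j hj
    obtain ⟨i, h1, h2, h3⟩ := hs j hj
    exact ⟨i, h1, reset_opn_mono h2, h3⟩

theorem lowerInv_reset {zok : ℕ → Prop} (hz : zok 0) : LowerInv I O a opt l (I.reset s) zok := by
  intro _
  refine ⟨fun _ => rfl, 0, 0, ?_, Nat.zero_le _, hz⟩
  have : (I.reset s).q = 0 := rfl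
  rw [this]
  omega

/-- All earlier expenses are moved into `P` and `P'`, and the accounting by rounds starts again at
0. -/
theorem costInv_reset (hm : 0 < I.m) {l' : List ℕ}
    (h : (I.fac s : ℝ) + I.conn s ≤ (16 * I.lam * I.mu) * s.B) : CostInv I l' (I.reset s) 0 := by
  refine ⟨I.fac s + 2 * s.B, I.conn s, pot_reset_le hm s, ?_, ?_⟩
  · have : I.conn (I.reset s) = I.conn s := rfl
    rw [this]
    have : (0 : ℝ) ≤ ((I.reset s).B : ℝ) * (I.mu * I.m) * l'.length := by positivity
    simp only [Nat.cast_zero, mul_zero, add_zero]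
    linarith
  · have : (I.reset s).B = s.B := rfl
    rw [this]
    linarith

/-- The phase ends only if `B < opt`, so the new guess is at most `2 * opt`, also when 0 is replaced
by 1. The current client starts again at the smallest radius; all purchases are kept, and open
facilities remain affordable for the larger guess. -/
theorem stepInv_newPhase (hm : 0 < I.m) (hn : 0 < I.n) (hl : l.length ≤ I.n)
    (hO : O ⊆ Finset.range I.m) (hopt : I.costOpt O a (l ++ [j]) ≤ opt)
    (h : StepInv I O a opt l j k s) (hq : I.Q ≤ s.q) :
    StepInv I O a opt l j 0 (I.reset { s with B := 2 * s.B + if s.B = 0 then 1 else 0 }) := by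
  have hlt := lt_opt_of_Q_le hm hO hopt h hq
  have hb := h.base
  set B' := 2 * s.B + if s.B = 0 then 1 else 0 with hB'
  have h1 : B' ≤ 2 * opt := by rw [hB']; split_ifs <;> omega
  have h2 : 2 * s.B ≤ B' := by omega
  refine ⟨baseInv_reset hm h1 (fun i hi ho => ?_) hb.served hb.edge, h.done, Nat.zero_le _, rfl,
    fun _ => Nat.zero_le _, ⟨0, costInv_reset hm ?_, le_rfl, Or.inl rfl⟩, lowerInv_reset ?_⟩
  · have := hb.opn.le i hi ho
    change _ ≤ B'
    omega
  · obtain ⟨q0, h3, h4, -⟩ := h.cost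
    have h5 := cost_le hm hn hl hb (q0 := q0) (by omega) h3
    change (I.fac s : ℝ) + I.conn s ≤ 16 * I.lam * I.mu * (B' : ℕ)
    refine h5.trans ?_
    have h6 : 2 * (s.B : ℝ) ≤ (B' : ℕ) := by exact_mod_cast h2
    have h7 : (0 : ℝ) ≤ 16 * I.lam * I.mu := by positivity
    nlinarith
  · exact ⟨Nat.zero_le _, fun _ => Nat.zero_le _⟩

/-- The `mu * m * pk` rounds at the radius that is left suffice to pay, with factor 2, for a
connection at twice that radius. For the lower bound, the rounds at all radii so far add up to `mu *
m * (2 * pk - 1)`, a geometric sum. -/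
theorem stepInv_enlarge (h : StepInv I O a opt l j k s) (ht : I.mu * I.m * s.pk ≤ s.tau)
    (hp : s.pk < I.NN) :
    StepInv I O a opt l j (k + 1) { s with pk := 2 * s.pk, tau := 0 } := by
  have hb := h.base
  have htau := h.tau_le hp
  have hk : k < I.L := by
    rw [h.pk] at hp
    exact (Nat.pow_lt_pow_iff_right (by norm_num)).1 hp
  have hc : ∀ j pk r, I.cover { s with pk := 2 * s.pk, tau := 0 } j pk r = I.cover s j pk r :=
    fun j pk r => cover_congr (by rfl) (by rfl) j pk r
  refine ⟨⟨⟨hb.weight.pow, hb.weight.le, hb.weight.counter⟩, ⟨hb.opn.le, hb.opn.free, ?_⟩,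
    hb.q_le, hb.B_le, hb.c_le, hb.frac_le, hb.served, hb.edge⟩, h.done, hk, ?_,
    fun _ => Nat.zero_le _, ?_, ?_⟩
  · intro j' hj' k' hk' hc'
    rw [hc] at hc'
    exact hb.opn.expo_lt j' hj' k' hk' hc'
  · change 2 * s.pk = _
    rw [h.pk, pow_succ, mul_comm]
  · obtain ⟨q0, h1, h2, -⟩ := h.cost
    refine ⟨q0, costInv_of_pot_le h1 (le_of_eq ?_) rfl rfl, by simp only; omega, Or.inr ?_⟩
    · exact pot_congr rfl rfl rfl
    · change 2 * q0 + 2 * s.pk * (I.mu * I.m) ≤ 2 * s.q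
      have : 2 * s.pk * (I.mu * I.m) = 2 * (I.mu * I.m * s.pk) := by ring
      omega
  · intro hopt
    obtain ⟨h0, sd, z, h1, h2, h3, h4⟩ := h.lower hopt
    refine ⟨h0, sd, z, h1, h2, h3, fun h5 => ?_⟩
    change s.B * (2 * s.pk) < _ at h5
    change z ≤ s.B * (I.mu * I.m * (2 * s.pk - 1) + 0)
    have h6 : s.B * s.pk ≤ s.B * (2 * s.pk) := Nat.mul_le_mul_left _ (by omega)
    refine (h4 (by omega)).trans (Nat.mul_le_mul_left _ ?_)
    have hpk : 0 < s.pk := by rw [h.pk]; positivity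
    have h7 : I.mu * I.m * (s.pk - 1) + I.mu * I.m * s.pk = I.mu * I.m * (2 * s.pk - 1) := by
      rw [← mul_add]; congr 1; omega
    omega

/-- When `opt ≤ B`, the new round is charged either to the progress of the facility `a j`, if it is
within the radius, or to `z`, if the offline connection is longer than the radius. -/
theorem stepInv_round (hm : 0 < I.m) (hj : j < I.n) (hO : O ⊆ Finset.range I.m)
    (haj : a j ∈ O) (hedge : I.e (a j) j ≠ 0)
    (hopt : I.costOpt O a (l ++ [j]) ≤ opt) (h : StepInv I O a opt l j k s)
    (hc : I.cover s j s.pk I.m = 0) (hq : s.q < I.Q)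
    (ht : ¬(I.mu * I.m * s.pk ≤ s.tau ∧ s.pk < I.NN)) :
    StepInv I O a opt l j k (I.touchAll { s with q := s.q + 1, tau := s.tau + 1 } j I.m) := by
  have hb := h.base
  set s1 : Config := { s with q := s.q + 1, tau := s.tau + 1 } with hs1
  have hc1 : ∀ j pk r, I.cover s1 j pk r = I.cover s j pk r :=
    fun j pk r => cover_congr (by rfl) (by rfl) j pk r
  have hw1 : WeightInv I s1 := ⟨hb.weight.pow, hb.weight.le, hb.weight.counter⟩
  have ho1 : OpenInv I s1 := ⟨hb.opn.le, hb.opn.free, fun j' hj' k' hk' hc' =>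
    hb.opn.expo_lt j' hj' k' hk' (by rwa [hc1] at hc')⟩
  have hu : ∀ i < I.m, I.Near s1.B s1.pk i j → s1.u i ≤ I.m :=
    fun i hi hn => weight_le_m h hj hc hi hn
  have hopn : ∀ i < I.m, I.Near s1.B s1.pk i j → s1.opn i = 0 :=
    fun i hi hn => not_open_of_near hc hi hn
  have hexpo : I.expo s1 j s1.pk < I.m :=
    show I.expo s j s.pk < I.m from expo_lt_of_uncovered h hj hc
  -- A near facility is closed and so is not very cheap: `f * m > B`. One full counter is therefore
  -- worth at least `B`.
  have hnf : ∀ i < I.m, I.Near s1.B s1.pk i j → s1.B ≤ I.f i * (I.m * I.NN) := by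
    intro i hi hn
    have h1 := hopn i hi hn
    have h2 : ¬ I.f i * I.m ≤ s.B := fun h2 => hb.opn.free i hi h2 h1
    have h3 : I.f i * I.m ≤ I.f i * I.m * I.NN := Nat.le_mul_of_pos_right _ NN_pos
    rw [← mul_assoc]
    change s.B ≤ _
    omega
  obtain ⟨g1, g2, g3, g4, g5, g6⟩ := I.touchAll_fields s1 j I.m
  obtain ⟨ho', hpot⟩ := openInv_touchAll hm hw1 ho1 hu hopn I.m le_rfl
  obtain ⟨hprog, hprog'⟩ := progress_touchAll hO hw1 hnf
  set t := I.touchAll s1 j I.m with ht'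
  have G1 : t.B = s.B := g1
  have G2 : t.q = s.q + 1 := g2
  have G3 : t.tau = s.tau + 1 := g3
  have G4 : t.pk = s.pk := g4
  have hpk : 0 < s.pk := by rw [h.pk]; positivity
  have htau : s.pk < I.NN → s.tau + 1 ≤ I.mu * I.m * s.pk := fun hp => by
    by_contra h'
    exact ht ⟨by omega, hp⟩
  refine ⟨⟨weightInv_touchAll hw1 hu _, ho', by omega, by rw [G1]; exact hb.B_le, ?_, ?_, ?_, ?_⟩,
    g5.trans h.done, h.k_le, by rw [G4]; exact h.pk, ?_, ?_, ?_⟩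
  · intro i hi
    rw [G2, (I.touchAll_cu s1 j I.m i).1]
    have := hb.c_le i hi
    have e : s1.c i = s.c i := rfl
    split_ifs
    · simp only [count, Function.update_self]
      split_ifs <;> omega
    · omega
  · have e1 : I.fracNat t ≤ _ := fracNat_touchAll_le hw1 hexpo
    have e2 : I.fracNat s1 = I.fracNat s := rfl
    have e3 : s1.B = s.B := rfl
    have e4 := hb.frac_le
    rw [G1, G2]
    rw [e2, e3] at e1
    have e5 : 2 * I.m * (s.q + 1) * s.B = 2 * I.m * s.q * s.B + 2 * I.m * s.B := by ring
    omega
  · intro j' hj'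
    obtain ⟨i', h1, h2, h3⟩ := hb.served j' hj'
    exact ⟨i', h1, touchAll_opn_mono _ _ _ _ h2, by rw [g6]; exact h3⟩
  · intro i' hi' j' hj' h'
    rw [g6] at h'
    exact hb.edge i' hi' j' hj' h'
  · rw [G3, G4]
    exact htau
  · obtain ⟨q0, h1, h2, h3⟩ := h.cost
    refine ⟨q0, costInv_of_pot_le h1 (hpot.trans (le_of_eq ?_)) g6 g1, by omega, ?_⟩
    · exact pot_congr rfl rfl rfl
    · rw [G2, G4]
      rcases h3 with h3 | h3
      · exact Or.inl h3
      · exact Or.inr (by omega)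
  · intro hB
    rw [G1] at hB
    obtain ⟨h0, sd, z, h1, h2, h3, h4⟩ := h.lower hB
    have him := Finset.mem_range.1 (hO haj)
    have hcost : I.costOpt O a (l ++ [j]) = ∑ i ∈ O, I.f i + (I.connOpt a l + I.d (a j) j) := by
      rw [costOpt, connOpt_append_singleton]
    have hf : I.f (a j) ≤ s.B := by
      have := Finset.single_le_sum (f := I.f) (fun _ _ => Nat.zero_le _) haj
      omega
    have hd : I.d (a j) j ≤ s.B := by omega
    have e1 : I.progress O s1 = I.progress O s := rfl
    have e2 : s1.B = s.B := rfl
    have e3 : s1.pk = s.pk := rfl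
    rw [e1] at hprog
    rw [e1, e2, e3] at hprog'
    rw [G1, G2, G3, G4]
    refine ⟨fun hB0 => ?_, ?_⟩
    -- With guess 0 at least `opt`, the facility `a j` is free, hence open since the reset, and it
    -- has distance 0; no round would take place.
    · exfalso
      have hd0 : I.d (a j) j = 0 := by omega
      have hf0 : I.f (a j) = 0 := by omega
      have hopen := hb.opn.free (a j) him (by rw [hf0]; omega)
      exact hopen (hopn (a j) him ⟨hedge, by rw [hd0]; omega⟩)
    · by_cases hn : I.Near s.B s.pk (a j) j
      · have := hprog' (a j) haj hn hf
        refine ⟨sd, z, ?_, h2, h3, fun h5 => ?_⟩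
        · rw [add_mul]; omega
        · have := hn.2
          omega
      · have hlt : s.B * s.pk < I.d (a j) j * I.NN := by
          by_contra h'
          exact hn ⟨hedge, by omega⟩
        -- At the largest radius `B` the facility `a j` is near, because `d ≤ opt ≤ B`. Hence the
        -- number of rounds at the current radius is limited.
        have hpN : s.pk < I.NN := by
          by_contra h'
          rw [not_lt] at h'
          have := Nat.mul_le_mul hd h'
          omega
        have hτ := htau hpN
        have hz := h4 hlt
        have e5 : s.B * (I.mu * I.m * (s.pk - 1) + (s.tau + 1)) =
          s.B * (I.mu * I.m * (s.pk - 1) + s.tau) + s.B := by ring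
        refine ⟨sd, z + s.B, ?_, h2, ?_, fun _ => by omega⟩
        · rw [add_mul]; omega
        -- The client has spent at most `2 * mu * m * pk` rounds, and the failure to be near
        -- converts `B * pk` into `d * NN`.
        · have e6 : I.mu * I.m * (s.pk - 1) + (s.tau + 1) ≤ 2 * (I.mu * I.m) * s.pk := by
            have e7 : I.mu * I.m * (s.pk - 1) ≤ I.mu * I.m * s.pk :=
              Nat.mul_le_mul_left _ (by omega)
            have e8 : 2 * (I.mu * I.m) * s.pk = I.mu * I.m * s.pk + I.mu * I.m * s.pk := by ring
            omega
          calc z + s.B ≤ s.B * (I.mu * I.m * (s.pk - 1) + (s.tau + 1)) := by omega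
            _ ≤ s.B * (2 * (I.mu * I.m) * s.pk) := Nat.mul_le_mul_left _ e6
            _ = 2 * (I.mu * I.m) * (s.B * s.pk) := by ring
            _ ≤ 2 * (I.mu * I.m) * (I.d (a j) j * I.NN) := Nat.mul_le_mul_left _ hlt.le
            _ = _ := by ring

/-! ### Termination of the service of a client -/

theorem stepInv_begin (h : ClientInv I O a opt l s) : StepInv I O a opt l j 0 (begin s) := by
  have hb := h.base
  have hc : ∀ j pk r, I.cover (begin s) j pk r = I.cover s j pk r :=
    fun j pk r => cover_congr (by rfl) (by rfl) j pk r
  refine ⟨⟨⟨hb.weight.pow, hb.weight.le, hb.weight.counter⟩, ⟨hb.opn.le, hb.opn.free, ?_⟩,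
    hb.q_le, hb.B_le, hb.c_le, hb.frac_le, hb.served, hb.edge⟩, rfl, Nat.zero_le _, rfl,
    fun _ => Nat.zero_le _, ⟨s.q, costInv_of_pot_le h.cost (le_of_eq ?_) rfl rfl, le_rfl,
      Or.inl rfl⟩, fun hopt => ?_⟩
  · intro j' hj' k' hk' hc'
    rw [hc] at hc'
    exact hb.opn.expo_lt j' hj' k' hk' hc'
  · exact pot_congr rfl rfl rfl
  · obtain ⟨h0, sd, z, h1, h2, rfl⟩ := h.lower hopt
    exact ⟨h0, sd, 0, h1, h2, Nat.zero_le _, fun _ => Nat.zero_le _⟩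

/-- The invariants after `t` steps for the client `j`. -/
def Progress (I : IntGraph) (O : Finset ℕ) (a : ℕ → ℕ) (opt : ℕ) (l : List ℕ) (j t : ℕ)
    (s : Config) : Prop :=
  (∃ k, StepInv I O a opt l j k s ∧ t ≤ s.B.size * (I.Q + I.L + 1) + s.q + k) ∨
    (s.done ≠ 0 ∧ ClientInv I O a opt (l ++ [j]) s)

/-- The bit length of the guess is the leading part of the termination measure, since it grows with
every new phase. -/
theorem size_next_le (B : ℕ) : B.size + 1 ≤ (2 * B + if B = 0 then 1 else 0).size := by
  rcases Nat.eq_zero_or_pos B with rfl | hB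
  · simp
  · have h1 : 0 < B.size := Nat.size_pos.2 hB
    obtain ⟨p, hp⟩ : ∃ p, B.size = p + 1 := ⟨B.size - 1, by omega⟩
    have h2 : 2 ^ p ≤ B := Nat.lt_size.1 (by omega)
    have h3 : p + 1 < (2 * B + if B = 0 then 1 else 0).size := by
      rw [Nat.lt_size, pow_succ]
      omega
    omega

/-- Every step before the connection raises the measure `B.size * (Q + L + 1) + q + k`: a round
raises `q`, a larger radius raises `k`, and a new phase adds at least `Q + L + 1` while it discards
`q + k ≤ Q + L`. -/
theorem progress_step (hm : 0 < I.m) (hj : j < I.n) (hl : l.length ≤ I.n)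
    (hO : O ⊆ Finset.range I.m) (haj : a j ∈ O) (hedge : I.e (a j) j ≠ 0)
    (hopt : I.costOpt O a (l ++ [j]) ≤ opt) {t : ℕ} (h : Progress I O a opt l j t s) :
    Progress I O a opt l j (t + 1) (I.step j s) := by
  rcases h with ⟨k, h, ht⟩ | ⟨hd, h⟩
  · unfold step
    rw [if_neg (by simpa using h.done)]
    by_cases h1 : I.cover s j s.pk I.m ≠ 0
    · rw [if_pos h1]
      exact Or.inr ⟨one_ne_zero, clientInv_connect hj h h1⟩
    rw [if_neg h1]
    by_cases h2 : I.Q ≤ s.q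
    · rw [if_pos h2]
      refine Or.inl ⟨0, stepInv_newPhase hm (by omega) hl hO hopt h h2, ?_⟩
      have e1 := size_next_le s.B
      have e2 := Nat.mul_le_mul_right (I.Q + I.L + 1) e1
      have e3 := h.base.q_le
      have e4 := h.k_le
      change t + 1 ≤ (2 * s.B + if s.B = 0 then 1 else 0).size * (I.Q + I.L + 1) + 0 + 0
      rw [add_mul] at e2
      omega
    rw [if_neg h2]
    by_cases h3 : I.mu * I.m * s.pk ≤ s.tau ∧ s.pk < I.NN
    · rw [if_pos h3]
      exact Or.inl ⟨k + 1, stepInv_enlarge h h3.1 h3.2, by simp only; omega⟩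
    · rw [if_neg h3]
      refine Or.inl ⟨k, stepInv_round hm hj hO haj hedge hopt h (by simpa using h1)
        (by omega) h3, ?_⟩
      obtain ⟨g1, g2, -⟩ := I.touchAll_fields { s with q := s.q + 1, tau := s.tau + 1 } j I.m
      rw [g1, g2]
      simp only
      omega
  · unfold step
    rw [if_pos hd]
    exact Or.inr ⟨hd, h⟩

/-- The number of steps that suffices for a client. -/
def fuel (I : IntGraph) (opt : ℕ) : ℕ := (2 * opt).size * (I.Q + I.L + 1) + I.Q + I.L + 1

theorem progress_iterate (hm : 0 < I.m) (hj : j < I.n) (hl : l.length ≤ I.n)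
    (hO : O ⊆ Finset.range I.m) (haj : a j ∈ O) (hedge : I.e (a j) j ≠ 0)
    (hopt : I.costOpt O a (l ++ [j]) ≤ opt) (h : ClientInv I O a opt l s) (t : ℕ) :
    Progress I O a opt l j t ((I.step j)^[t] (begin s)) := by
  induction t with
  | zero => exact Or.inl ⟨0, stepInv_begin h, Nat.zero_le _⟩
  | succ t ih =>
    rw [Function.iterate_succ_apply']
    exact progress_step hm hj hl hO haj hedge hopt ih

theorem Progress.done {t : ℕ} (h : Progress I O a opt l j t s) (ht : I.fuel opt ≤ t) :
    s.done ≠ 0 ∧ ClientInv I O a opt (l ++ [j]) s := by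
  rcases h with ⟨k, h, h'⟩ | h
  · exfalso
    have h1 : s.B.size ≤ (2 * opt).size := Nat.size_le_size h.base.B_le
    have h2 := Nat.mul_le_mul_right (I.Q + I.L + 1) h1
    have h3 := h.base.q_le
    have h4 := h.k_le
    unfold fuel at ht
    omega
  · exact h

theorem step_of_done (h : s.done ≠ 0) (t : ℕ) : (I.step j)^[t] s = s := by
  induction t with
  | zero => rfl
  | succ t ih =>
    rw [Function.iterate_succ_apply', ih]
    unfold step
    rw [if_pos h]

theorem serve_spec (hm : 0 < I.m) (hj : j < I.n) (hl : l.length ≤ I.n)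
    (hO : O ⊆ Finset.range I.m) (haj : a j ∈ O) (hedge : I.e (a j) j ≠ 0)
    (hopt : I.costOpt O a (l ++ [j]) ≤ opt) (h : ClientInv I O a opt l s) {F : ℕ}
    (hF : I.fuel opt ≤ F) : ClientInv I O a opt (l ++ [j]) (I.serve F s j) ∧
      I.serve F s j = I.serve (I.fuel opt) s j := by
  have h1 := progress_iterate hm hj hl hO haj hedge hopt h
  refine ⟨((h1 F).done hF).2, ?_⟩
  unfold serve
  obtain ⟨r, rfl⟩ := Nat.exists_eq_add_of_le hF
  rw [add_comm, Function.iterate_add_apply]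
  exact step_of_done ((h1 _).done le_rfl).1 r

/-! ### The whole sequence of clients -/

theorem clientInv_init (hm : 0 < I.m) : ClientInv I O a opt [] I.init := by
  refine ⟨baseInv_reset hm (Nat.zero_le _) ?_ ?_ ?_, costInv_reset hm ?_, lowerInv_reset rfl⟩
  · simp
  · simp
  · simp
  · simp [fac, conn]

theorem run_append_singleton (F : ℕ) : I.run F (l ++ [j]) = I.serve F (I.run F l) j := by
  simp [run]

theorem Solution.of_append {l' : List ℕ} (h : Solution I O a (l ++ l')) : Solution I O a l :=
  ⟨h.subset, fun j hj => h.lt j (List.mem_append_left _ hj),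
    fun j hj => h.mem j (List.mem_append_left _ hj),
    fun j hj => h.edge j (List.mem_append_left _ hj)⟩

theorem length_le_of_nodup (hs : ∀ j ∈ l, j < I.n) (hl : l.Nodup) : l.length ≤ I.n := by
  rw [← List.toFinset_card_of_nodup hl]
  have : l.toFinset ⊆ Finset.range I.n := fun j hj =>
    Finset.mem_range.2 (hs j (List.mem_toFinset.1 hj))
  simpa using Finset.card_le_card this

theorem costOpt_le_append (l' : List ℕ) : I.costOpt O a l ≤ I.costOpt O a (l ++ l') := by
  simp [costOpt, connOpt]

/-- The invariants hold after any sequence of clients, and the state does not depend on the number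
of steps if this is large enough. -/
theorem run_spec (hm : 0 < I.m) (hs : Solution I O a l) (hl : l.Nodup)
    (hopt : I.costOpt O a l ≤ opt) {F : ℕ} (hF : I.fuel opt ≤ F) :
    ClientInv I O a opt l (I.run F l) ∧ I.run F l = I.run (I.fuel opt) l := by
  induction l using List.reverseRecOn with
  | nil => exact ⟨clientInv_init hm, rfl⟩
  | append_singleton l j ih =>
    obtain ⟨h1, h2⟩ := ih hs.of_append (List.Nodup.of_append_left hl)
      ((costOpt_le_append _).trans hopt)
    have hmem : j ∈ l ++ [j] := by simp
    have h3 := serve_spec hm (hs.lt j hmem)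
      (length_le_of_nodup hs.of_append.lt (List.Nodup.of_append_left hl)) hs.subset
      (hs.mem j hmem) (hs.edge j hmem) hopt h1 hF
    rw [run_append_singleton, run_append_singleton, ← h2]
    exact h3

/-- The total cost is at most a logarithmic multiple of the optimum. -/
theorem run_cost_le (hm : 0 < I.m) (hn : 0 < I.n) (hs : Solution I O a l) (hl : l.Nodup)
    {F : ℕ} (hF : I.fuel (I.costOpt O a l) ≤ F) :
    (I.fac (I.run F l) : ℝ) + I.conn (I.run F l) ≤ 64 * I.lam * I.mu * I.costOpt O a l := by
  have h := (run_spec hm hs hl le_rfl hF).1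
  have h1 := cost_le hm hn (length_le_of_nodup hs.lt hl) h.base le_rfl h.cost
  have h2 : ((I.run F l).B : ℝ) ≤ 2 * I.costOpt O a l := by exact_mod_cast h.base.B_le
  have h3 : (0 : ℝ) ≤ I.lam * I.mu := by positivity
  nlinarith

/-! ### Purchases are never revoked -/

theorem step_mono (j i x : ℕ) : (s.opn i ≠ 0 → (I.step j s).opn i ≠ 0) ∧
    (s.be x ≠ 0 → (I.step j s).be x ≠ 0) := by
  unfold step
  split_ifs
  · exact ⟨id, id⟩
  · refine ⟨id, fun h => ?_⟩
    simp only [Function.update_apply]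
    split_ifs
    · exact one_ne_zero
    · exact h
  · exact ⟨fun h => reset_opn_mono h, id⟩
  · exact ⟨fun h => reset_opn_mono h, id⟩
  · exact ⟨id, id⟩
  · refine ⟨fun h => touchAll_opn_mono _ _ _ _ h, fun h => ?_⟩
    rw [(I.touchAll_fields _ j I.m).2.2.2.2.2]
    exact h

theorem serve_mono (F j i x : ℕ) : (s.opn i ≠ 0 → (I.serve F s j).opn i ≠ 0) ∧
    (s.be x ≠ 0 → (I.serve F s j).be x ≠ 0) := by
  unfold serve
  induction F with
  | zero => exact ⟨id, id⟩
  | succ F ih =>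
    rw [Function.iterate_succ_apply']
    exact ⟨fun h => (step_mono j i x).1 (ih.1 h), fun h => (step_mono j i x).2 (ih.2 h)⟩

theorem run_mono (F i x : ℕ) (l l' : List ℕ) :
    ((I.run F l).opn i ≠ 0 → (I.run F (l ++ l')).opn i ≠ 0) ∧
    ((I.run F l).be x ≠ 0 → (I.run F (l ++ l')).be x ≠ 0) := by
  induction l' using List.reverseRecOn with
  | nil => simp
  | append_singleton l' j ih =>
    rw [← List.append_assoc, run_append_singleton]
    exact ⟨fun h => (serve_mono F j i x).1 (ih.1 h), fun h => (serve_mono F j i x).2 (ih.2 h)⟩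

end IntGraph

/-! ## The program -/

namespace Cmd

/-- Assignment to a scalar variable. -/
def asg (a : ℕ) (e : Expr) : Cmd := .set a (.lit 0) e

theorem run_skip (σ : Memory) : skip.run σ = σ := rfl

theorem run_seq (p q : Cmd) (σ : Memory) : (seq p q).run σ = q.run (p.run σ) := rfl

theorem run_ite_pos {b : Expr} {p q : Cmd} {σ : Memory} (h : b.eval σ ≠ 0) :
    (ite b p q).run σ = p.run σ := if_pos h

theorem run_ite_neg {b : Expr} {p q : Cmd} {σ : Memory} (h : ¬ b.eval σ ≠ 0) :
    (ite b p q).run σ = q.run σ := if_neg h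

theorem run_set {a : ℕ} {i e : Expr} {σ : Memory} {x v : ℕ} (hi : i.eval σ = x)
    (he : e.eval σ = v) (h : v ≤ σ 2 0) : (set a i e).run σ = store σ a x v := by
  subst hi he
  change store σ a (i.eval σ) (min (e.eval σ) (σ 2 0)) = _
  rw [min_eq_left h]

theorem run_asg {a : ℕ} {e : Expr} {σ : Memory} {v : ℕ} (he : e.eval σ = v) (h : v ≤ σ 2 0) :
    (asg a e).run σ = store σ a 0 v :=
  run_set rfl he h

end Cmd

/-- The expressions for the input data.  Array `10` holds the factor by which all costs are
multiplied. -/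
def mE : Expr := .get 0 (.lit 1)
def nE : Expr := .get 0 (.lit 2)
-- Cell `i` holds a numerator and the next cell its denominator, which divides the common factor.
def scaledE (i : Expr) : Expr := .get 0 i * (.var 10 / .get 0 (i + .lit 1))
def fE (i : Expr) : Expr := scaledE (.lit 3 + .lit 2 * i)
-- Cells 0, 1, 2 hold the word length, `m` and `n`; two cells per facility follow, then flag,
-- numerator and denominator for each pair.
def flagPosE (i j : Expr) : Expr := .lit 3 + .lit 2 * mE + .lit 3 * (i * nE + j)
def eE (i j : Expr) : Expr := .get 0 (flagPosE i j)
def dE (i j : Expr) : Expr := scaledE (flagPosE i j + .lit 1)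

/-- Array `13` holds the resolution of radii, array `20` the current guess. -/
def nearE (i j pk : Expr) : Expr := eE i j * (dE i j * .var 13).le (.var 20 * pk)

/-- Arrays `30` and `32` receive `cover` and `expo` for the client in array `36` and the radius
given by array `34`. -/
def scanCmd : Cmd :=
  .seq (.asg 30 (.lit 0)) (.seq (.asg 32 (.lit 0))
    (.rep 64 65 mE
      (.ite (nearE (.var 64) (.var 36) (.var 34))
        (.seq (.ite (.get 25 (.var 64)) (.asg 30 (.var 64 + .lit 1)) .skip)
          (.asg 32 (.var 32 + (.get 27 (.var 64) - .lit 1))))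
        .skip)))

/-- Array `31` receives `gain` for the facility in array `58`. -/
def gainCmd : Cmd :=
  .seq (.asg 31 (.lit 0))
    (.rep 60 61 nE
      (.seq (.asg 36 (.var 60)) (.seq (.asg 34 (.lit 1))
        (.rep 62 63 (.var 12 + .lit 1)
          (.seq
            (.ite (nearE (.var 58) (.var 36) (.var 34))
              (.seq scanCmd (.ite (.var 30) .skip
                (.asg 31 (.var 31 + .get 16 (.lit 2 * .var 12 * .var 32)))))
              .skip)
            (.asg 34 (.lit 2 * .var 34)))))))

/-- The facility in array `58` is touched. -/
def touchCmd : Cmd :=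
  .seq
    (.ite ((fE (.var 58) * (mE * .var 13)).le ((.get 26 (.var 58) + .lit 1) * .var 20))
      (.seq (.set 26 (.var 58) (.lit 0)) (.set 27 (.var 58) (.lit 2 * .get 27 (.var 58))))
      (.set 26 (.var 58) (.get 26 (.var 58) + .lit 1)))
    (.seq gainCmd
      (.ite ((fE (.var 58) * (.var 14 * .var 15)).le (.var 20 * .var 31))
        (.set 25 (.var 58) (.lit 1)) .skip))

/-- All facilities near the client in array `29` are touched. -/
def touchAllCmd : Cmd :=
  .rep 58 59 mE
    (.ite (nearE (.var 58) (.var 29) (.var 23) * (fE (.var 58)).le (.var 20)) touchCmd .skip)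

def resetCmd : Cmd :=
  .seq (.asg 21 (.lit 0)) (.seq (.asg 22 (.lit 0)) (.seq (.asg 23 (.lit 1))
    (.rep 50 51 mE
      (.seq (.set 26 (.var 50) (.lit 0)) (.seq (.set 27 (.var 50) (.lit 1))
        (.ite ((fE (.var 50) * mE).le (.var 20)) (.set 25 (.var 50) (.lit 1)) .skip))))))

/-- One step for the client in array `29`. -/
def stepCmd : Cmd :=
  .ite (.var 24) .skip
    (.seq (.asg 36 (.var 29)) (.seq (.asg 34 (.var 23)) (.seq scanCmd
      (.ite (.var 30)
        (.seq (.set 28 ((.var 30 - .lit 1) * nE + .var 29) (.lit 1)) (.asg 24 (.lit 1)))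
        (.ite ((Expr.lit 3 * .var 11 * mE * .var 13 + .lit 1).le (.var 21))
          (.seq (.asg 20 (.lit 2 * .var 20 + (Expr.var 20).eq (.lit 0))) resetCmd)
          (.ite ((Expr.var 11 * mE * .var 23).le (.var 22) * (Expr.var 23).lt (.var 13))
            (.seq (.asg 23 (.lit 2 * .var 23)) (.asg 22 (.lit 0)))
            (.seq (.asg 21 (.var 21 + .lit 1)) (.seq (.asg 22 (.var 22 + .lit 1))
              touchAllCmd))))))))

/-- All clients are served in their order of arrival. -/
def serveCmd : Cmd :=
  .rep 52 53 (.get 0 (.lit 3 + .lit 2 * mE + .lit 3 * (mE * nE)))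
    (.seq (.asg 29 (.get 0 (.lit 4 + .lit 2 * mE + .lit 3 * (mE * nE) + .var 52)))
      (.seq (.asg 23 (.lit 1)) (.seq (.asg 22 (.lit 0)) (.seq (.asg 24 (.lit 0))
        (.rep 54 55 (.var 3) stepCmd)))))

/-! ### Reading the parameters -/

namespace IntGraph

/-- The input data and the parameters are found in the memory `σ`. -/
structure Params (I : IntGraph) (C R : ℕ) (σ : Memory) : Prop where
  cap : σ 2 0 = C
  rep : σ 3 0 = R
  m : σ 0 1 = I.m
  n : σ 0 2 = I.n
  f : ∀ i < I.m, σ 0 (3 + 2 * i) * (σ 10 0 / σ 0 (3 + 2 * i + 1)) = I.f i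
  e : ∀ i < I.m, ∀ j < I.n, σ 0 (3 + 2 * I.m + 3 * (i * I.n + j)) = I.e i j
  d : ∀ i < I.m, ∀ j < I.n, σ 0 (3 + 2 * I.m + 3 * (i * I.n + j) + 1) *
    (σ 10 0 / σ 0 (3 + 2 * I.m + 3 * (i * I.n + j) + 1 + 1)) = I.d i j
  mu : σ 11 0 = I.mu
  L : σ 12 0 = I.L
  NN : σ 13 0 = I.NN
  lam : σ 14 0 = 2 ^ I.lam
  mX : σ 15 0 = I.m ^ I.X
  pw : σ 16 = I.pw

/-- The arrays that hold the parameters. -/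
def paramArrays : List ℕ := [0, 2, 3, 10, 11, 12, 13, 14, 15, 16]

/-- The bounds are large enough; `b` bounds the guesses. -/
structure Fits (I : IntGraph) (C R b : ℕ) : Prop where
  m : I.m ≤ R
  n : I.n ≤ R
  L : I.L + 1 ≤ R
  rep : R ≤ C
  u : 4 * I.m ≤ C
  expo : 4 * I.m * I.m ≤ C
  gain : I.n * (I.L + 1) * (I.m + 1) ^ I.X ≤ C
  pk : 2 * I.NN ≤ C
  q : I.Q + 1 ≤ C
  b : 2 * b + 1 ≤ C

variable {I : IntGraph} {C R : ℕ} {s : Config} {σ τ : Memory}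

theorem Params.congr (h : Params I C R σ) (hτ : ∀ a ∈ paramArrays, τ a = σ a) :
    Params I C R τ := by
  simp only [paramArrays, List.forall_mem_cons, List.not_mem_nil, false_imp_iff,
    implies_true, and_true] at hτ
  obtain ⟨h0, h2, h3, h10, h11, h12, h13, h14, h15, h16⟩ := hτ
  constructor <;> simp only [h0, h2, h3, h10, h11, h12, h13, h14, h15, h16]
  exacts [h.cap, h.rep, h.m, h.n, h.f, h.e, h.d, h.mu, h.L, h.NN, h.lam, h.mX, h.pw]

theorem Params.run (h : Params I C R σ) {p : Cmd}
    (hp : ∀ a ∈ paramArrays, p.writes a = false) : Params I C R (p.run σ) :=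
  h.congr fun a ha => Cmd.run_eq_of_not_writes (hp a ha) σ

theorem Params.store (h : Params I C R σ) {a i v : ℕ} (ha : a ∉ paramArrays) :
    Params I C R (store σ a i v) :=
  h.congr fun _ hb => store_of_ne fun hab => ha (hab ▸ hb)

theorem Params.eval_m (h : Params I C R σ) : mE.eval σ = I.m := h.m
theorem Params.eval_n (h : Params I C R σ) : nE.eval σ = I.n := h.n

theorem Params.eval_f (h : Params I C R σ) {x : Expr} {i : ℕ} (hx : x.eval σ = i) (hi : i < I.m) :
    (fE x).eval σ = I.f i := by
  subst hx
  exact h.f _ hi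

theorem Params.eval_near (h : Params I C R σ) {x y z : Expr} {i j pk B : ℕ} (hx : x.eval σ = i)
    (hy : y.eval σ = j) (hz : z.eval σ = pk) (hB : σ 20 0 = B) (hi : i < I.m) (hj : j < I.n) :
    (nearE x y z).eval σ ≠ 0 ↔ I.Near B pk i j := by
  have hpos : (flagPosE x y).eval σ = 3 + 2 * I.m + 3 * (i * I.n + j) := by
    simp only [flagPosE, Expr.eval_add, Expr.eval_mul, Expr.eval_lit, h.eval_m, h.eval_n, hx, hy]
  have he : (eE x y).eval σ = I.e i j := by
    rw [eE, Expr.eval_get, hpos, h.e i hi j hj]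
  have hd : (dE x y).eval σ = I.d i j := by
    rw [← h.d i hi j hj]
    simp only [dE, scaledE, Expr.eval_add, Expr.eval_mul, Expr.eval_div, Expr.eval_get,
      Expr.eval_var, Expr.eval_lit, hpos]
  rw [nearE, Expr.eval_mul, he, Expr.eval_le, Expr.eval_mul, hd, Expr.eval_mul, Expr.eval_var,
    Expr.eval_var, h.NN, hB, hz, Near]
  by_cases h0 : I.e i j = 0 <;> by_cases h1 : I.d i j * I.NN ≤ B * pk <;> simp [h0, h1]

/-- The number of iterations of a loop. -/
theorem Params.count_eq (h : Params I C R σ) (hRC : R ≤ C) {e : Expr} {x : ℕ} (he : e.eval σ = x)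
    (hx : x ≤ R) : min (min (e.eval σ) (σ 3 0)) (σ 2 0) = x := by
  rw [he, h.rep, h.cap]; omega

/-! ### Scanning the facilities near a client -/

theorem expo_partial_le (hu : ∀ i < I.m, s.u i ≤ 4 * I.m) (j pk r : ℕ) (hr : r ≤ I.m) :
    ∑ i ∈ Finset.range r, (if I.Near s.B pk i j then s.u i - 1 else 0) ≤ 4 * I.m * I.m := by
  calc _ ≤ ∑ _i ∈ Finset.range r, 4 * I.m := by
        refine Finset.sum_le_sum fun i hi => ?_
        have := hu i (by rw [Finset.mem_range] at hi; omega)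
        split_ifs <;> omega
    _ = r * (4 * I.m) := by simp
    _ ≤ I.m * (4 * I.m) := Nat.mul_le_mul_right _ hr
    _ = _ := by ring

/-- The loop computes `cover` and the partial sums of `expo` together. Weights up to `4 * m` are
admitted because the scan also runs inside `gainCmd`, just after a weight of up to `2 * m` may have
been doubled. -/
theorem run_scanCmd {b : ℕ} (h : Params I C R σ) (hf : Fits I C R b) (hB : σ 20 0 = s.B)
    (ho : σ 25 = s.opn) (hu : σ 27 = s.u) (hu' : ∀ i < I.m, s.u i ≤ 4 * I.m) {j pk : ℕ}
    (hj : σ 36 0 = j) (hjn : j < I.n) (hpk : σ 34 0 = pk) :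
    scanCmd.run σ 30 0 = I.cover s j pk I.m ∧ scanCmd.run σ 32 0 = I.expo s j pk := by
  unfold scanCmd
  rw [Cmd.run_seq, Cmd.run_seq, Cmd.run_asg (v := 0) rfl (Nat.zero_le _),
    Cmd.run_asg (v := 0) rfl (Nat.zero_le _)]
  set σ1 := store (store σ 30 0 0) 32 0 0 with hσ1
  have h1 : Params I C R σ1 := (h.store (by decide)).store (by decide)
  refine Cmd.run_rep I.m (fun r τ => τ 30 0 = I.cover s j pk r ∧
    τ 32 0 = ∑ i ∈ Finset.range r, (if I.Near s.B pk i j then s.u i - 1 else 0)) rfl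
    (h1.count_eq hf.rep h1.eval_m hf.m) ?_ ?_
  · constructor <;> simp [hσ1, store_of_ne, cover]
  · intro r hr τ hc hfr ⟨p1, p2⟩
    have hτ : Params I C R τ := h1.congr fun a ha => hfr a (by revert a; decide)
    have e20 : τ 20 0 = s.B := by rw [hfr 20 rfl, hσ1, store_of_ne, store_of_ne, hB] <;> decide
    have e25 : τ 25 = s.opn := by rw [hfr 25 rfl, hσ1, store_of_ne, store_of_ne, ho] <;> decide
    have e27 : τ 27 = s.u := by rw [hfr 27 rfl, hσ1, store_of_ne, store_of_ne, hu] <;> decide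
    have e36 : τ 36 0 = j := by rw [hfr 36 rfl, hσ1, store_of_ne, store_of_ne, hj] <;> decide
    have e34 : τ 34 0 = pk := by rw [hfr 34 rfl, hσ1, store_of_ne, store_of_ne, hpk] <;> decide
    have hnear := hτ.eval_near (x := .var 64) (y := .var 36) (z := .var 34) hc e36 e34 e20 hr hjn
    rw [Finset.sum_range_succ]
    have hle := expo_partial_le hu' j pk (r + 1) hr
    rw [Finset.sum_range_succ] at hle
    have := hf.expo
    have := hf.m
    have := hf.rep
    simp only [cover]
    by_cases hn : I.Near s.B pk r j
    · rw [if_pos hn] at hle ⊢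
      rw [Cmd.run_ite_pos (hnear.2 hn), Cmd.run_seq]
      by_cases hopn : s.opn r ≠ 0
      · rw [Cmd.run_ite_pos (by simpa [hc, e25] using hopn), if_pos ⟨hn, hopn⟩,
          Cmd.run_asg (a := 30) (e := .var 64 + .lit 1) (v := r + 1) (by simp [hc]) (by rw [hτ.cap]; omega),
          Cmd.run_asg (v := τ 32 0 + (s.u r - 1)) (by simp [store_of_ne, hc, e27])
            (by rw [store_of_ne (by decide), hτ.cap, p2]; omega)]
        simp [store_of_ne, p2]
      · rw [Cmd.run_ite_neg (by simpa [hc, e25] using hopn), if_neg (fun h => hopn h.2),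
          Cmd.run_skip,
          Cmd.run_asg (v := τ 32 0 + (s.u r - 1)) (by simp [hc, e27])
            (by rw [hτ.cap, p2]; omega)]
        simp [store_of_ne, p2, p1]
    · rw [if_neg hn, Cmd.run_ite_neg (fun h => hn (hnear.1 h)), if_neg (fun h => hn h.1),
        Cmd.run_skip]
      simp [store_of_ne, p1, p2]

/-! ### Computing the gain of a facility -/

theorem pw_le (x : ℕ) : I.pw x ≤ (I.m + 1) ^ I.X := by
  unfold pw
  split_ifs with hx
  · calc (I.m + 1) ^ x * I.m ^ (I.X - x) ≤ (I.m + 1) ^ x * (I.m + 1) ^ (I.X - x) := by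
          gcongr; omega
      _ = _ := by rw [← pow_add]; congr 1; omega
  · exact Nat.zero_le _

theorem term_le (j pk : ℕ) : I.term s j pk ≤ (I.m + 1) ^ I.X := by
  unfold term
  split_ifs
  · exact pw_le _
  · exact Nat.zero_le _

theorem inner_le (i j r : ℕ) :
    ∑ k ∈ Finset.range r, (if I.Near s.B (2 ^ k) i j then I.term s j (2 ^ k) else 0) ≤
      r * (I.m + 1) ^ I.X := by
  calc _ ≤ ∑ _k ∈ Finset.range r, (I.m + 1) ^ I.X := by
        refine Finset.sum_le_sum fun k _ => ?_
        split_ifs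
        · exact term_le _ _
        · exact Nat.zero_le _
    _ = _ := by simp

/-- Every partial sum in the double loop is below the bound for stored numbers, so none is
truncated. -/
theorem outer_le (i r r' : ℕ) (hr : r < I.n) (hr' : r' ≤ I.L + 1) :
    ∑ j ∈ Finset.range r, ∑ k ∈ Finset.range (I.L + 1),
      (if I.Near s.B (2 ^ k) i j then I.term s j (2 ^ k) else 0) +
      ∑ k ∈ Finset.range r', (if I.Near s.B (2 ^ k) i r then I.term s r (2 ^ k) else 0) ≤
      I.n * (I.L + 1) * (I.m + 1) ^ I.X := by
  calc _ ≤ ∑ _j ∈ Finset.range r, (I.L + 1) * (I.m + 1) ^ I.X + r' * (I.m + 1) ^ I.X :=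
        Nat.add_le_add (Finset.sum_le_sum fun j _ => inner_le i j _) (inner_le i r r')
    _ ≤ r * ((I.L + 1) * (I.m + 1) ^ I.X) + (I.L + 1) * (I.m + 1) ^ I.X := by
        rw [Finset.sum_const, Finset.card_range, smul_eq_mul]
        gcongr
    _ = (r + 1) * ((I.L + 1) * (I.m + 1) ^ I.X) := by ring
    _ ≤ I.n * ((I.L + 1) * (I.m + 1) ^ I.X) := Nat.mul_le_mul_right _ hr
    _ = _ := by ring

/-- The invariants of the nested loops are the partial double sums of `gain`. Powers are looked up
in array 16 at index `2 * L * expo`, which is `lam * expo`. -/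
theorem run_gainCmd {b : ℕ} (h : Params I C R σ) (hf : Fits I C R b) (hB : σ 20 0 = s.B)
    (ho : σ 25 = s.opn) (hu : σ 27 = s.u) (hu' : ∀ i < I.m, s.u i ≤ 4 * I.m) {i : ℕ}
    (hi : σ 58 0 = i) (him : i < I.m) : gainCmd.run σ 31 0 = I.gain s i := by
  unfold gainCmd
  rw [Cmd.run_seq, Cmd.run_asg (v := 0) rfl (Nat.zero_le _)]
  set σ1 := store σ 31 0 0 with hσ1
  have h1 : Params I C R σ1 := h.store (by decide)
  have hC1 : 1 ≤ C := by have := hf.u; omega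
  refine Cmd.run_rep I.n (fun r τ => τ 31 0 = ∑ j ∈ Finset.range r, ∑ k ∈ Finset.range (I.L + 1),
      (if I.Near s.B (2 ^ k) i j then I.term s j (2 ^ k) else 0)) rfl
    (h1.count_eq hf.rep h1.eval_n hf.n) ?_ ?_
  · simp [hσ1, store_of_ne]
  · intro r hr τ hc hfr hp
    have hτ : Params I C R τ := h1.congr fun a ha => hfr a (by revert a; decide)
    have e20 : τ 20 0 = s.B := by rw [hfr 20 rfl, hσ1, store_of_ne, hB]; decide
    have e25 : τ 25 = s.opn := by rw [hfr 25 rfl, hσ1, store_of_ne, ho]; decide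
    have e27 : τ 27 = s.u := by rw [hfr 27 rfl, hσ1, store_of_ne, hu]; decide
    have e58 : τ 58 0 = i := by rw [hfr 58 rfl, hσ1, store_of_ne, hi]; decide
    rw [Cmd.run_seq, Cmd.run_seq, Cmd.run_asg (a := 36) (e := .var 60) (σ := τ) (v := r) hc (by
        have := hf.n; have := hf.rep; rw [hτ.cap]; omega),
      Cmd.run_asg (v := 1) rfl (by rw [store_of_ne (by decide), hτ.cap]; exact hC1)]
    set τ1 := store (store τ 36 0 r) 34 0 1 with hτ1
    have h2 : Params I C R τ1 := (hτ.store (by decide)).store (by decide)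
    rw [store_of_ne (by decide)]
    have := Cmd.run_rep (c := 62) (l := 63) (e := .var 12 + .lit 1) (p := .seq
            (.ite (nearE (.var 58) (.var 36) (.var 34))
              (.seq scanCmd (.ite (.var 30) .skip
                (.asg 31 (.var 31 + .get 16 (.lit 2 * .var 12 * .var 32)))))
              .skip)
            (.asg 34 (.lit 2 * .var 34))) (σ := τ1) (I.L + 1) (fun k υ => υ 34 0 = 2 ^ k ∧
      υ 31 0 = ∑ j ∈ Finset.range r, ∑ k ∈ Finset.range (I.L + 1),
        (if I.Near s.B (2 ^ k) i j then I.term s j (2 ^ k) else 0) +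
        ∑ k ∈ Finset.range k, (if I.Near s.B (2 ^ k) i r then I.term s r (2 ^ k) else 0)) rfl
      (h2.count_eq hf.rep (by simp [h2.L]) hf.L) ?_ ?_
    · rw [this.2, Finset.sum_range_succ _ r]
    · constructor <;> simp [hτ1, store_of_ne, hp]
    · intro k hk υ hc' hfr' ⟨p1, p2⟩
      have hυ : Params I C R υ := h2.congr fun a ha => hfr' a (by revert a; decide)
      have d20 : υ 20 0 = s.B := by rw [hfr' 20 rfl, hτ1, store_of_ne, store_of_ne, e20] <;> decide
      have d25 : υ 25 = s.opn := by rw [hfr' 25 rfl, hτ1, store_of_ne, store_of_ne, e25] <;> decide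
      have d27 : υ 27 = s.u := by rw [hfr' 27 rfl, hτ1, store_of_ne, store_of_ne, e27] <;> decide
      have d58 : υ 58 0 = i := by rw [hfr' 58 rfl, hτ1, store_of_ne, store_of_ne, e58] <;> decide
      have d36 : υ 36 0 = r := by rw [hfr' 36 rfl, hτ1, store_of_ne, store_cell]; decide
      have hnear := hυ.eval_near (x := .var 58) (y := .var 36) (z := .var 34) d58 d36 p1 d20 him hr
      have hle := outer_le (s := s) i r (k + 1) hr hk
      have hg := hf.gain
      have hpk : 2 * 2 ^ k ≤ C := by
        have h3 : 2 ^ k ≤ 2 ^ I.L := Nat.pow_le_pow_right (by norm_num) (by omega)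
        have := hf.pk
        unfold NN at this
        omega
      rw [Finset.sum_range_succ _ k] at hle
      rw [Cmd.run_seq, Finset.sum_range_succ _ k]
      by_cases hn : I.Near s.B (2 ^ k) i r
      · rw [if_pos hn] at hle ⊢
        rw [Cmd.run_ite_pos (hnear.2 hn), Cmd.run_seq]
        obtain ⟨s1, s2⟩ := run_scanCmd hυ hf d20 d25 d27 hu' d36 hr p1
        have hω : Params I C R (scanCmd.run υ) := hυ.run (by decide)
        have f31 : scanCmd.run υ 31 = υ 31 := Cmd.run_eq_of_not_writes rfl υ
        have f34 : scanCmd.run υ 34 = υ 34 := Cmd.run_eq_of_not_writes rfl υ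
        set ω := scanCmd.run υ
        have ht : I.term s r (2 ^ k) = if I.cover s r (2 ^ k) I.m = 0 then
          I.pw (I.lam * I.expo s r (2 ^ k)) else 0 := rfl
        rw [ht] at hle ⊢
        by_cases hcov : I.cover s r (2 ^ k) I.m = 0
        · rw [if_pos hcov] at hle ⊢
          rw [Cmd.run_ite_neg (by simp [s1, hcov]),
            Cmd.run_asg (a := 31) (σ := ω)
              (e := .var 31 + .get 16 (.lit 2 * .var 12 * .var 32)) (v := υ 31 0 + I.pw (I.lam * I.expo s r (2 ^ k)))
              (by simp [hω.L, hω.pw, s2, f31, lam]) (by rw [hω.cap, p2]; omega),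
            Cmd.run_asg (v := 2 * 2 ^ k) (by simp [store_of_ne, f34, p1])
              (by rw [store_of_ne (by decide), hω.cap]; exact hpk)]
          simp [store_of_ne, p2, pow_succ, mul_comm, add_assoc]
        · rw [if_neg hcov]
          rw [Cmd.run_ite_pos (by simpa [s1] using hcov), Cmd.run_skip,
            Cmd.run_asg (v := 2 * 2 ^ k) (by simp [f34, p1]) (by rw [hω.cap]; exact hpk)]
          simp [store_of_ne, f31, p2, pow_succ, mul_comm]
      · rw [if_neg hn]
        rw [Cmd.run_ite_neg (fun h => hn (hnear.1 h)), Cmd.run_skip,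
          Cmd.run_asg (v := 2 * 2 ^ k) (by simp [p1]) (by rw [hυ.cap]; exact hpk)]
        simp [store_of_ne, p2, pow_succ, mul_comm]

end IntGraph

namespace IntGraph

/-! ### Simulation of the online algorithm -/

/-- The memory `σ` represents the state `s`. -/
structure Rel (s : Config) (σ : Memory) : Prop where
  B : σ 20 0 = s.B
  q : σ 21 0 = s.q
  tau : σ 22 0 = s.tau
  pk : σ 23 0 = s.pk
  done : σ 24 0 = s.done
  opn : σ 25 = s.opn
  c : σ 26 = s.c
  u : σ 27 = s.u
  be : σ 28 = s.be

/-- The arrays that hold the state. -/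
def stateArrays : List ℕ := [20, 21, 22, 23, 24, 25, 26, 27, 28]

variable {I : IntGraph} {C R b : ℕ} {s : Config} {σ τ : Memory}

theorem Rel.congr (h : Rel s σ) (hτ : ∀ a ∈ stateArrays, τ a = σ a) : Rel s τ := by
  simp only [stateArrays, List.forall_mem_cons, List.not_mem_nil, false_imp_iff,
    implies_true, and_true] at hτ
  obtain ⟨h0, h1, h2, h3, h4, h5, h6, h7, h8⟩ := hτ
  constructor <;> simp only [h0, h1, h2, h3, h4, h5, h6, h7, h8]
  exacts [h.B, h.q, h.tau, h.pk, h.done, h.opn, h.c, h.u, h.be]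

theorem Rel.run (h : Rel s σ) {p : Cmd} (hp : ∀ a ∈ stateArrays, p.writes a = false) :
    Rel s (p.run σ) :=
  h.congr fun a ha => Cmd.run_eq_of_not_writes (hp a ha) σ

theorem Rel.store (h : Rel s σ) {a i v : ℕ} (ha : a ∉ stateArrays) : Rel s (store σ a i v) :=
  h.congr fun _ hb => store_of_ne fun hab => ha (hab ▸ hb)

theorem run_countCmd (h : Params I C R σ) (hr : Rel s σ) {i : ℕ} (hi : σ 58 0 = i)
    (him : i < I.m) (hu : (I.count s i).u i ≤ C) (hc : s.c i + 1 ≤ C) :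
    Rel (I.count s i) ((Cmd.ite
      ((fE (.var 58) * (mE * .var 13)).le ((.get 26 (.var 58) + .lit 1) * .var 20))
      (.seq (.set 26 (.var 58) (.lit 0)) (.set 27 (.var 58) (.lit 2 * .get 27 (.var 58))))
      (.set 26 (.var 58) (.get 26 (.var 58) + .lit 1))).run σ) := by
  have hcond : ((fE (.var 58) * (mE * .var 13)).le
      ((Expr.get 26 (.var 58) + .lit 1) * .var 20)).eval σ ≠ 0 ↔
      I.f i * (I.m * I.NN) ≤ (s.c i + 1) * s.B := by
    rw [Expr.eval_le, Expr.eval_mul, h.eval_f (x := .var 58) (i := i) hi him]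
    simp [h.eval_m, h.NN, hr.c, hr.B, hi]
  by_cases hx : I.f i * (I.m * I.NN) ≤ (s.c i + 1) * s.B
  · simp only [count, if_pos hx, Function.update_self] at hu
    rw [Cmd.run_ite_pos (hcond.2 hx), Cmd.run_seq,
      Cmd.run_set (a := 26) (i := .var 58) (σ := σ) (x := i) (v := 0) hi rfl (Nat.zero_le _),
      Cmd.run_set (x := i) (v := 2 * s.u i) (by simp [store_of_ne, hi])
        (by simp [store_of_ne, hi, hr.u]) (by rw [store_of_ne (by decide), h.cap]; exact hu)]
    constructor <;> simp [store_of_ne, count, hx, hr.B, hr.q, hr.tau, hr.pk, hr.done, hr.opn,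
      hr.c, hr.u, hr.be]
  · rw [Cmd.run_ite_neg (fun h' => hx (hcond.1 h')),
      Cmd.run_set (a := 26) (i := .var 58) (σ := σ) (x := i) (v := s.c i + 1) hi (by simp [hi, hr.c])
        (by rw [h.cap]; exact hc)]
    constructor <;> simp [store_of_ne, count, hx, hr.B, hr.q, hr.tau, hr.pk, hr.done, hr.opn,
      hr.c, hr.u, hr.be]

theorem run_touchCmd (h : Params I C R σ) (hf : Fits I C R b) (hr : Rel s σ) {i : ℕ}
    (hi : σ 58 0 = i) (him : i < I.m) (hu : ∀ i' < I.m, (I.count s i).u i' ≤ 4 * I.m)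
    (hc : s.c i + 1 ≤ C) : Rel (I.touch s i) (touchCmd.run σ) := by
  have hfu := hf.u
  have h1 := run_countCmd h hr hi him ((hu i him).trans hfu) hc
  unfold touchCmd
  rw [Cmd.run_seq]
  set p : Cmd := Cmd.ite
      ((fE (.var 58) * (mE * .var 13)).le ((.get 26 (.var 58) + .lit 1) * .var 20))
      (.seq (.set 26 (.var 58) (.lit 0)) (.set 27 (.var 58) (.lit 2 * .get 27 (.var 58))))
      (.set 26 (.var 58) (.get 26 (.var 58) + .lit 1)) with hp
  have h2 : Params I C R (p.run σ) := h.run (by decide)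
  have hi2 : p.run σ 58 0 = i := by rw [Cmd.run_eq_of_not_writes rfl, hi]
  have h3 := run_gainCmd h2 hf h1.B h1.opn h1.u hu hi2 him
  have h4 : Params I C R (gainCmd.run (p.run σ)) := h2.run (by decide)
  have h5 : Rel (I.count s i) (gainCmd.run (p.run σ)) := h1.run (by decide)
  have hi3 : gainCmd.run (p.run σ) 58 0 = i := by rw [Cmd.run_eq_of_not_writes rfl, hi2]
  rw [Cmd.run_seq]
  set ω := gainCmd.run (p.run σ)
  have hcond : ((fE (.var 58) * (Expr.var 14 * .var 15)).le (Expr.var 20 * .var 31)).eval ω ≠ 0 ↔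
      I.f i * (2 ^ I.lam * I.m ^ I.X) ≤ (I.count s i).B * I.gain (I.count s i) i := by
    rw [Expr.eval_le, Expr.eval_mul, h4.eval_f (x := .var 58) (i := i) hi3 him]
    simp [h4.lam, h4.mX, h5.B, h3]
  unfold touch
  by_cases hx : I.f i * (2 ^ I.lam * I.m ^ I.X) ≤ (I.count s i).B * I.gain (I.count s i) i
  · rw [if_pos hx, Cmd.run_ite_pos (hcond.2 hx), Cmd.run_set (i := .var 58) (σ := ω) (x := i) (v := 1) hi3 rfl
      (by rw [h4.cap]; omega)]
    constructor <;> simp [store_of_ne, openFac, h5.B, h5.q, h5.tau, h5.pk, h5.done, h5.opn,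
      h5.c, h5.u, h5.be]
  · rw [if_neg hx, Cmd.run_ite_neg (fun h' => hx (hcond.1 h'))]
    exact h5

theorem count_u_le {i : ℕ} (x : ℕ) : (I.count s i).u x ≤ 2 * s.u x := by
  by_cases hx : x = i
  · subst hx
    have := I.count_u_self s x
    omega
  · rw [count_u_of_ne _ hx]
    omega

/-- When facility `r` is reached, its counter and weight are still those of the start of the round.
The bound `2 * m` on the weights thus becomes at most `4 * m` during the round. -/
theorem run_touchAllCmd (h : Params I C R σ) (hf : Fits I C R b) (hr : Rel s σ) {j : ℕ}
    (hj : σ 29 0 = j) (hjn : j < I.n) (hu : ∀ i < I.m, s.u i ≤ 2 * I.m)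
    (hc : ∀ i < I.m, s.c i + 1 ≤ C) : Rel (I.touchAll s j I.m) (touchAllCmd.run σ) := by
  unfold touchAllCmd
  refine Cmd.run_rep I.m (fun r τ => Rel (I.touchAll s j r) τ) rfl
    (h.count_eq hf.rep h.eval_m hf.m) ?_ ?_
  · exact (hr.store (by decide)).store (by decide)
  · intro r hrm τ hcr hfr hp
    have hτ : Params I C R τ := h.congr fun a ha => hfr a (by revert a; decide)
    have e29 : τ 29 0 = j := by rw [hfr 29 rfl, hj]
    obtain ⟨g1, -, -, g4, -⟩ := I.touchAll_fields s j r
    have hnear := hτ.eval_near (x := .var 58) (y := .var 29) (z := .var 23) hcr e29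
      (hp.pk.trans g4) (hp.B.trans g1) hrm hjn
    have hcond : (nearE (.var 58) (.var 29) (.var 23) * (fE (.var 58)).le (.var 20)).eval τ ≠ 0 ↔
        I.Near s.B s.pk r j ∧ I.f r ≤ s.B := by
      rw [Expr.eval_mul, mul_ne_zero_iff, hnear, Expr.eval_le, hτ.eval_f (x := .var 58) (i := r) hcr hrm,
        Expr.eval_var, hp.B, g1]
      simp
    refine Rel.store ?_ (by decide)
    simp only [touchAll]
    by_cases hx : I.Near s.B s.pk r j ∧ I.f r ≤ s.B
    · rw [if_pos hx, Cmd.run_ite_pos (hcond.2 hx)]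
      refine run_touchCmd hτ hf hp hcr hrm (fun i' hi' => ?_) ?_
      · by_cases hir : i' = r
        · refine (count_u_le _).trans ?_
          rw [(I.touchAll_cu s j r i').2, if_neg (by omega)]
          have := hu i' hi'
          omega
        · rw [count_u_of_ne _ hir, (I.touchAll_cu s j r i').2]
          have h1 := count_u_le (I := I) (s := s) (i := i') i'
          have := hu i' hi'
          split_ifs <;> omega
      · rw [(I.touchAll_cu s j r r).1, if_neg (by omega)]
        exact hc r hrm
    · rw [if_neg hx, Cmd.run_ite_neg (fun h' => hx (hcond.1 h'))]
      exact hp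

/-- With `ite_lt_succ`, the induction step for loops that overwrite the cells below `r` that satisfy
`p`. -/
theorem update_ite_lt {r v : ℕ} (g : ℕ → ℕ) (p : ℕ → Prop) [DecidablePred p] (hp : p r) :
    Function.update (fun i => if i < r ∧ p i then v else g i) r v =
      fun i => if i < r + 1 ∧ p i then v else g i := by
  funext i
  by_cases hi : i = r
  · subst hi; simp [hp]
  · have : i < r + 1 ↔ i < r := by omega
    simp [Function.update_of_ne hi, this]

theorem ite_lt_succ {r v : ℕ} (g : ℕ → ℕ) (p : ℕ → Prop) [DecidablePred p] (hp : ¬ p r) :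
    (fun i => if i < r ∧ p i then v else g i) = fun i => if i < r + 1 ∧ p i then v else g i := by
  funext i
  by_cases hi : i = r
  · subst hi; simp [hp]
  · have : i < r + 1 ↔ i < r := by omega
    simp [this]

theorem run_resetCmd (h : Params I C R σ) (hf : Fits I C R b) (hr : Rel s σ) (hC : 1 ≤ C) :
    Rel (I.reset s) (resetCmd.run σ) := by
  unfold resetCmd
  rw [Cmd.run_seq, Cmd.run_seq, Cmd.run_seq,
    Cmd.run_asg (a := 21) (σ := σ) (v := 0) rfl (Nat.zero_le _),
    Cmd.run_asg (a := 22) (σ := store σ 21 0 0) (v := 0) rfl (Nat.zero_le _),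
    Cmd.run_asg (a := 23) (σ := store (store σ 21 0 0) 22 0 0) (v := 1) rfl
      (by simpa [store_of_ne, h.cap] using hC)]
  set σ1 := store (store (store σ 21 0 0) 22 0 0) 23 0 1 with hσ1
  have h1 : Params I C R σ1 := ((h.store (by decide)).store (by decide)).store (by decide)
  refine Cmd.run_rep I.m (fun r τ => Rel { s with
    q := 0
    tau := 0
    pk := 1
    c := fun i => if i < r ∧ True then 0 else s.c i
    u := fun i => if i < r ∧ True then 1 else s.u i
    opn := fun i => if i < r ∧ I.f i * I.m ≤ s.B then 1 else s.opn i } τ) rfl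
    (h1.count_eq hf.rep h1.eval_m hf.m) ?_ ?_ |> fun h => by simpa [reset] using h
  · constructor <;> simp [hσ1, store_of_ne, hr.B, hr.done, hr.opn, hr.c, hr.u, hr.be]
  · intro r hrm τ hcr hfr hp
    have hτ : Params I C R τ := h1.congr fun a ha => hfr a (by revert a; decide)
    rw [Cmd.run_seq, Cmd.run_seq,
      Cmd.run_set (a := 26) (i := .var 50) (σ := τ) (x := r) (v := 0) hcr rfl (Nat.zero_le _),
      Cmd.run_set (a := 27) (σ := store τ 26 r 0) (x := r) (v := 1)
        (by simpa [store_of_ne] using hcr) rfl (by simpa [store_of_ne, hτ.cap] using hC)]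
    set τ1 := store (store τ 26 r 0) 27 r 1 with hτ1
    have h2 : Params I C R τ1 := (hτ.store (by decide)).store (by decide)
    have hcr1 : τ1 50 0 = r := by simpa [hτ1, store_of_ne] using hcr
    have hB1 : τ1 20 0 = s.B := by simpa [hτ1, store_of_ne] using hp.B
    have hcond : ((fE (.var 50) * mE).le (.var 20)).eval τ1 ≠ 0 ↔ I.f r * I.m ≤ s.B := by
      rw [Expr.eval_le, Expr.eval_mul, h2.eval_f (x := .var 50) (i := r) hcr1 hrm]
      simp [h2.eval_m, hB1]
    refine Rel.store ?_ (by decide)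
    by_cases hx : I.f r * I.m ≤ s.B
    · rw [Cmd.run_ite_pos (hcond.2 hx), Cmd.run_set (i := .var 50) (σ := τ1) (x := r) (v := 1) hcr1 rfl
        (by rw [h2.cap]; exact hC)]
      have e1 := update_ite_lt (v := 1) s.opn (fun i => I.f i * I.m ≤ s.B) hx
      have e2 := update_ite_lt (r := r) (v := 0) s.c (fun _ => True) trivial
      have e3 := update_ite_lt (r := r) (v := 1) s.u (fun _ => True) trivial
      constructor
      · exact hp.B
      · exact hp.q
      · exact hp.tau
      · exact hp.pk
      · exact hp.done
      · simp only [hτ1, store_same, store_of_ne (show (25 : ℕ) ≠ 27 by decide),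
          store_of_ne (show (25 : ℕ) ≠ 26 by decide), hp.opn]
        exact e1
      · rw [store_of_ne (by decide), hτ1, store_of_ne (by decide), store_same, hp.c]
        exact e2
      · rw [store_of_ne (by decide), hτ1, store_same, store_of_ne (by decide), hp.u]
        exact e3
      · exact hp.be
    · rw [Cmd.run_ite_neg (fun h' => hx (hcond.1 h')), Cmd.run_skip]
      have e1 := ite_lt_succ (v := 1) s.opn (fun i => I.f i * I.m ≤ s.B) hx
      have e2 := update_ite_lt (r := r) (v := 0) s.c (fun _ => True) trivial
      have e3 := update_ite_lt (r := r) (v := 1) s.u (fun _ => True) trivial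
      constructor
      · exact hp.B
      · exact hp.q
      · exact hp.tau
      · exact hp.pk
      · exact hp.done
      · exact hp.opn.trans e1
      · rw [hτ1, store_of_ne (by decide), store_same, hp.c]
        exact e2
      · rw [hτ1, store_same, store_of_ne (by decide), hp.u]
        exact e3
      · exact hp.be

/-- The bounds for the numbers in a state that are needed for the simulation of a step. -/
structure Tame (I : IntGraph) (b : ℕ) (s : Config) : Prop where
  u_le : ∀ i < I.m, s.u i ≤ 2 * I.m
  c_le : ∀ i < I.m, s.c i ≤ I.Q
  tau_le : s.tau ≤ I.Q
  pk_le : s.pk ≤ I.NN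
  B_le : s.B ≤ b

/-- The tests of the program and of `step` agree because all quantities are read exactly. `Tame`
serves only to exclude truncation, and is needed only while the client is not yet served. -/
theorem run_stepCmd (h : Params I C R σ) (hf : Fits I C R b) (hr : Rel s σ) {j : ℕ}
    (hj : σ 29 0 = j) (hjn : j < I.n) (ht : s.done = 0 → Tame I b s) :
    Rel (I.step j s) (stepCmd.run σ) := by
  have hQ := hf.q
  have hC : 1 ≤ C := by omega
  unfold step stepCmd
  by_cases hd : s.done ≠ 0
  · rw [if_pos hd, Cmd.run_ite_pos (by rw [Expr.eval_var, hr.done]; exact hd)]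
    exact hr
  rw [if_neg hd, Cmd.run_ite_neg (by rw [Expr.eval_var, hr.done]; exact hd)]
  have ht := ht (not_not.1 hd)
  have hrep := hf.rep
  have hnR := hf.n
  have hpkC := hf.pk
  have hpk := ht.pk_le
  have hB := ht.B_le
  have hb := hf.b
  rw [Cmd.run_seq, Cmd.run_seq, Cmd.run_seq,
    Cmd.run_asg (a := 36) (e := .var 29) (σ := σ) (v := j) hj (by rw [h.cap]; omega),
    Cmd.run_asg (a := 34) (e := .var 23) (σ := store σ 36 0 j) (v := s.pk)
      (by simpa [store_of_ne] using hr.pk) (by rw [store_of_ne (by decide), h.cap]; omega)]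
  set σ1 := store (store σ 36 0 j) 34 0 s.pk with hσ1
  have h1 : Params I C R σ1 := (h.store (by decide)).store (by decide)
  have hr1 : Rel s σ1 := (hr.store (by decide)).store (by decide)
  have hj1 : σ1 29 0 = j := by simpa [hσ1, store_of_ne] using hj
  have hcov := (run_scanCmd h1 hf hr1.B hr1.opn hr1.u
    (fun i hi => (ht.u_le i hi).trans (by omega)) (by simp [hσ1, store_of_ne]) hjn
    (store_cell _ _ _ _)).1
  have h2 : Params I C R (scanCmd.run σ1) := h1.run (by decide)
  have hr2 : Rel s (scanCmd.run σ1) := hr1.run (by decide)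
  have hj2 : scanCmd.run σ1 29 0 = j := by rw [Cmd.run_eq_of_not_writes rfl, hj1]
  set ω := scanCmd.run σ1
  by_cases hx : I.cover s j s.pk I.m ≠ 0
  · rw [if_pos hx, Cmd.run_ite_pos (by rw [Expr.eval_var, hcov]; exact hx), Cmd.run_seq,
      Cmd.run_set (a := 28) (σ := ω) (x := (I.cover s j s.pk I.m - 1) * I.n + j) (v := 1)
        (by simp [hcov, h2.eval_n, hj2]) rfl (by rw [h2.cap]; exact hC),
      Cmd.run_asg (v := 1) rfl (by rw [store_of_ne (by decide), h2.cap]; exact hC)]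
    constructor <;> simp [store_of_ne, hr2.B, hr2.q, hr2.tau, hr2.pk, hr2.opn,
      hr2.c, hr2.u, hr2.be]
  rw [if_neg hx, Cmd.run_ite_neg (by rw [Expr.eval_var, hcov]; exact hx)]
  have hq : ((Expr.lit 3 * .var 11 * mE * .var 13 + .lit 1).le (.var 21)).eval ω ≠ 0 ↔
      I.Q ≤ s.q := by
    simp [h2.eval_m, h2.mu, h2.NN, hr2.q, Q]
  by_cases hx : I.Q ≤ s.q
  · rw [if_pos hx, Cmd.run_ite_pos (hq.2 hx), Cmd.run_seq,
      Cmd.run_asg (a := 20) (e := .lit 2 * .var 20 + (Expr.var 20).eq (.lit 0)) (σ := ω)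
        (v := 2 * s.B + if s.B = 0 then 1 else 0)
        (by simp [hr2.B]) (by rw [h2.cap]; split_ifs <;> omega)]
    refine run_resetCmd (h2.store (by decide)) hf ?_ hC
    constructor <;> simp [store_of_ne, hr2.q, hr2.tau, hr2.pk, hr2.done, hr2.opn,
      hr2.c, hr2.u, hr2.be]
  rw [if_neg hx, Cmd.run_ite_neg (fun h' => hx (hq.1 h'))]
  have hp : ((Expr.var 11 * mE * .var 23).le (.var 22) * (Expr.var 23).lt (.var 13)).eval ω ≠ 0 ↔
      I.mu * I.m * s.pk ≤ s.tau ∧ s.pk < I.NN := by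
    simp [h2.eval_m, h2.mu, h2.NN, hr2.pk, hr2.tau, and_comm]
  by_cases hx' : I.mu * I.m * s.pk ≤ s.tau ∧ s.pk < I.NN
  · rw [if_pos hx', Cmd.run_ite_pos (hp.2 hx'), Cmd.run_seq,
      Cmd.run_asg (a := 23) (e := .lit 2 * .var 23) (σ := ω) (v := 2 * s.pk)
        (by simp [hr2.pk]) (by rw [h2.cap]; omega),
      Cmd.run_asg (v := 0) rfl (Nat.zero_le _)]
    constructor <;> simp [store_of_ne, hr2.B, hr2.q, hr2.done, hr2.opn,
      hr2.c, hr2.u, hr2.be]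
  rw [if_neg hx', Cmd.run_ite_neg (fun h' => hx' (hp.1 h')), Cmd.run_seq, Cmd.run_seq,
    Cmd.run_asg (a := 21) (e := .var 21 + .lit 1) (σ := ω) (v := s.q + 1)
      (by simp [hr2.q]) (by rw [h2.cap]; omega),
    Cmd.run_asg (a := 22) (e := .var 22 + .lit 1) (σ := store ω 21 0 (s.q + 1)) (v := s.tau + 1)
      (by simp [store_of_ne, hr2.tau])
      (by have := ht.tau_le; rw [store_of_ne (by decide), h2.cap]; omega)]
  refine run_touchAllCmd ((h2.store (by decide)).store (by decide)) hf ?_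
    (by simpa [store_of_ne] using hj2) hjn ht.u_le
    (fun i hi => by have := ht.c_le i hi; simp only; omega)
  constructor <;> simp [store_of_ne, hr2.B, hr2.pk, hr2.done, hr2.opn, hr2.c, hr2.u, hr2.be]

variable {O : Finset ℕ} {a : ℕ → ℕ} {opt : ℕ} {l : List ℕ}

/-- The invariants of the analysis also keep the numbers small: counters and `tau` are at most `q ≤
Q`, the guess at most `2 * opt`. -/
theorem Progress.tame {j t : ℕ} (h : Progress I O a opt l j t s) (hd : s.done = 0) :
    Tame I (2 * opt) s := by
  rcases h with ⟨k, h, -⟩ | ⟨h, -⟩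
  · have hb := h.base
    obtain ⟨q0, -, hq, -⟩ := h.cost
    have := hb.q_le
    refine ⟨hb.weight.le, fun i hi => (hb.c_le i hi).trans hb.q_le, by omega, ?_, hb.B_le⟩
    rw [h.pk]
    exact Nat.pow_le_pow_right (by norm_num) h.k_le
  · exact absurd hd h

/-- The program `serveCmd` simulates the online algorithm. -/
theorem run_serveCmd (hm : 0 < I.m) (h : Params I C R σ) (hf : Fits I C R (2 * opt))
    (hs : Solution I O a l) (hnd : l.Nodup) (hopt : I.costOpt O a l ≤ opt)
    (hF : I.fuel opt ≤ R) (hr : Rel I.init σ)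
    (hlen : σ 0 (3 + 2 * I.m + 3 * (I.m * I.n)) = l.length)
    (hcl : ∀ (k : ℕ) (hk : k < l.length), σ 0 (4 + 2 * I.m + 3 * (I.m * I.n) + k) = l[k]) :
    Rel (I.run R l) (serveCmd.run σ) := by
  have hln := length_le_of_nodup hs.lt hnd
  have hnR := hf.n
  have hRC := hf.rep
  have hQ := hf.q
  unfold serveCmd
  have key : ∀ P : Config → Prop, P (I.run R (l.take l.length)) → P (I.run R l) := by simp
  refine key (fun s => Rel s _) (Cmd.run_rep l.length (fun r τ => Rel (I.run R (l.take r)) τ) rfl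
    (h.count_eq hf.rep (by simpa [h.eval_m, h.eval_n] using hlen) (by omega)) ?_ ?_)
  · exact (hr.store (by decide)).store (by decide)
  · intro r hrl τ hcr hfr hp
    have hτ : Params I C R τ := h.congr fun a ha => hfr a (by revert a; decide)
    have hsplit : l = l.take r ++ [l[r]] ++ l.drop (r + 1) := by
      rw [List.take_append_getElem]; simp
    have hs2 : Solution I O a (l.take r ++ [l[r]]) := by
      rw [hsplit] at hs; exact hs.of_append
    have hnd2 : (l.take r).Nodup := hnd.sublist (List.take_sublist r l)
    have hopt2 : I.costOpt O a (l.take r ++ [l[r]]) ≤ opt := by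
      refine le_trans ?_ hopt
      conv_rhs => rw [hsplit]
      exact costOpt_le_append _
    have hmem : l[r] ∈ l.take r ++ [l[r]] :=
      List.mem_append_right _ (List.mem_singleton_self _)
    have hj := hs2.lt _ hmem
    rw [List.take_succ_eq_append_getElem hrl, run_append_singleton]
    set j := l[r] with hjdef
    have hcli := (run_spec hm hs2.of_append hnd2 ((costOpt_le_append _).trans hopt2) hF).1
    have hprog := progress_iterate hm hj (length_le_of_nodup hs2.of_append.lt hnd2) hs2.subset
      (hs2.mem j hmem) (hs2.edge j hmem) hopt2 hcli
    set s := I.run R (l.take r)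
    refine Rel.store ?_ (by decide)
    rw [Cmd.run_seq, Cmd.run_seq, Cmd.run_seq, Cmd.run_seq,
      Cmd.run_asg (a := 29) (σ := τ)
        (e := .get 0 (.lit 4 + .lit 2 * mE + .lit 3 * (mE * nE) + .var 52)) (v := j)
        (by simpa [hτ.eval_m, hτ.eval_n, hcr, hfr 0 rfl] using hcl r hrl)
        (by rw [hτ.cap]; omega),
      Cmd.run_asg (a := 23) (e := .lit 1) (σ := store τ 29 0 j) (v := 1) rfl
        (by rw [store_of_ne (by decide), hτ.cap]; omega),
      Cmd.run_asg (a := 22) (e := .lit 0) (σ := store (store τ 29 0 j) 23 0 1) (v := 0) rfl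
        (Nat.zero_le _),
      Cmd.run_asg (a := 24) (e := .lit 0) (σ := store (store (store τ 29 0 j) 23 0 1) 22 0 0)
        (v := 0) rfl (Nat.zero_le _)]
    set τ1 := store (store (store (store τ 29 0 j) 23 0 1) 22 0 0) 24 0 0 with hτ1
    have h1 : Params I C R τ1 := (((hτ.store (by decide)).store (by decide)).store
      (by decide)).store (by decide)
    refine Cmd.run_rep R (fun t υ => Rel ((I.step j)^[t] (begin s)) υ) rfl
      (h1.count_eq hf.rep h1.rep le_rfl) ?_ ?_
    -- The inner loop always makes `R` steps; after the connection they change nothing.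
    · constructor <;> simp [hτ1, store_of_ne, begin, hp.B, hp.q, hp.opn, hp.c, hp.u, hp.be]
    · intro t _ υ _ hfr' hp'
      rw [Function.iterate_succ_apply']
      have hυ : Params I C R υ := h1.congr fun a ha => hfr' a (by revert a; decide)
      refine Rel.store (run_stepCmd hυ hf hp' ?_ hj (hprog t).tame) (by decide)
      rw [hfr' 29 rfl]
      simp [hτ1, store_of_ne]

end IntGraph

/-! ## Initialization and output -/

/-- Array `10` receives the product of the nonzero numbers in the description of the graph. -/
def scaleCmd : Cmd :=
  .seq (.asg 10 (.lit 1))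
    (.rep 66 67 (.lit 2 + .lit 2 * mE + .lit 3 * (mE * nE))
      (.asg 10 (.var 10 *
        (.get 0 (.var 66 + .lit 1) + (Expr.get 0 (.var 66 + .lit 1)).eq (.lit 0)))))

/-- Array `a` receives the bit length of the value of `e`, and array `p` the corresponding power
of `2`. -/
def sizeCmd (a p : ℕ) (e : Expr) : Cmd :=
  .seq (.asg a (.lit 0)) (.seq (.asg p (.lit 1))
    (.rep 66 67 e
      (.ite ((Expr.var p).le e)
        (.seq (.asg a (.var a + .lit 1)) (.asg p (.lit 2 * .var p))) .skip)))

def powCmd : Cmd :=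
  .seq (.asg 15 (.lit 1)) (.rep 66 67 (.lit 4 * .var 12 * mE) (.asg 15 (.var 15 * mE)))

def tableCmd : Cmd :=
  .seq (.asg 16 (.var 15)) (.rep 66 67 (.lit 4 * .var 12 * mE)
    (.set 16 (.var 66 + .lit 1) (.get 16 (.var 66) / mE * (mE + .lit 1))))

def initCmd : Cmd :=
  .seq scaleCmd (.seq (sizeCmd 11 40 mE) (.seq (sizeCmd 12 13 nE)
    (.seq (.asg 14 (.var 13 * .var 13)) (.seq powCmd (.seq tableCmd resetCmd)))))

def outputCmd : Cmd :=
  .seq (.set 1 (.lit 0) (mE + mE * nE)) (.seq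
    (.rep 66 67 mE (.set 1 (.var 66 + .lit 1) ((Expr.lit 0).lt (.get 25 (.var 66)))))
    (.rep 66 67 (mE * nE)
      (.set 1 (mE + .var 66 + .lit 1) ((Expr.lit 0).lt (.get 28 (.var 66))))))

/-- The factor by which all costs are multiplied. -/
def costScale (w : ℕ → ℕ) : ℕ :=
  ∏ k ∈ Finset.range (2 + 2 * w 1 + 3 * (w 1 * w 2)), max (w (k + 1)) 1

theorem run_scaleCmd {σ : Memory} (hR : 2 + 2 * σ 0 1 + 3 * (σ 0 1 * σ 0 2) ≤ σ 3 0)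
    (hRC : σ 3 0 ≤ σ 2 0) (hC : costScale (σ 0) ≤ σ 2 0) :
    scaleCmd.run σ 10 0 = costScale (σ 0) := by
  have hle : ∀ r ≤ 2 + 2 * σ 0 1 + 3 * (σ 0 1 * σ 0 2),
      ∏ k ∈ Finset.range r, max (σ 0 (k + 1)) 1 ≤ σ 2 0 := fun r hr =>
    (Finset.prod_le_prod_of_subset_of_one_le' (by simpa using hr)
      fun _ _ _ => le_max_right _ _).trans hC
  unfold scaleCmd
  rw [Cmd.run_seq, Cmd.run_asg (v := 1) rfl (by simpa using hle 0 (Nat.zero_le _))]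
  refine Cmd.run_rep (2 + 2 * σ 0 1 + 3 * (σ 0 1 * σ 0 2)) (fun r τ => τ 10 0 =
    ∏ k ∈ Finset.range r, max (σ 0 (k + 1)) 1) rfl ?_ ?_ ?_
  · change min (min (2 + 2 * σ 0 1 + 3 * (σ 0 1 * σ 0 2)) (σ 3 0)) (σ 2 0) = _
    omega
  · simp [store_of_ne]
  · intro r hr τ hcr hfr hp
    have e0 : τ 0 = σ 0 := by rw [hfr 0 rfl, store_of_ne (by decide)]
    have e2 : τ 2 = σ 2 := by rw [hfr 2 rfl, store_of_ne (by decide)]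
    have hmax : ∀ x : ℕ, (x + if x = 0 then 1 else 0) = max x 1 := fun x => by
      split_ifs <;> omega
    rw [Cmd.run_asg (v := ∏ k ∈ Finset.range (r + 1), max (σ 0 (k + 1)) 1)
      (by simp [hcr, hp, e0, hmax, Finset.prod_range_succ]) (by rw [e2]; exact hle _ hr)]
    simp [store_of_ne]

/-- The loop runs `m` times, more often than needed, and advances as long as the current power of 2
is at most `m`; this stops at the bit length. -/
theorem run_sizeCmd {σ : Memory} {a p m : ℕ} {e : Expr}
    (ha : a ≠ 0 ∧ a ≠ 2 ∧ a ≠ 3 ∧ a ≠ 66 ∧ a ≠ 67)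
    (hp : p ≠ 0 ∧ p ≠ 2 ∧ p ≠ 3 ∧ p ≠ 66 ∧ p ≠ 67) (hap : a ≠ p)
    (he : ∀ τ : Memory, τ 0 = σ 0 → e.eval τ = m)
    (hR : m ≤ σ 3 0) (hRC : σ 3 0 ≤ σ 2 0) (hC : 2 * m + 1 ≤ σ 2 0) :
    (sizeCmd a p e).run σ a 0 = m.size ∧ (sizeCmd a p e).run σ p 0 = 2 ^ m.size := by
  obtain ⟨ha0, ha2, ha3, ha66, ha67⟩ := ha
  obtain ⟨hp0, hp2, hp3, hp66, hp67⟩ := hp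
  unfold sizeCmd
  rw [Cmd.run_seq, Cmd.run_seq, Cmd.run_asg (a := a) (σ := σ) (v := 0) rfl (Nat.zero_le _),
    Cmd.run_asg (v := 1) rfl (by rw [store_of_ne ha2.symm]; omega)]
  have hms := Nat.size_le_self m
  have key := Cmd.run_rep (c := 66) (l := 67) (e := e) (σ := store (store σ a 0 0) p 0 1)
    (p := (.ite ((Expr.var p).le e)
        (.seq (.asg a (.var a + .lit 1)) (.asg p (.lit 2 * .var p))) .skip)) m
    (fun r τ => τ a 0 = min r m.size ∧ τ p 0 = 2 ^ min r m.size) (by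
      simp [Cmd.writes, Cmd.asg, ha66.symm, hp66.symm]) ?_ ?_ ?_
  · rwa [min_eq_right hms] at key
  · rw [he _ (by rw [store_of_ne hp0.symm, store_of_ne ha0.symm]), store_of_ne hp3.symm,
      store_of_ne ha3.symm, store_of_ne hp2.symm, store_of_ne ha2.symm]
    omega
  · simp [store_of_ne, ha66, ha67, hp66, hp67, hap]
  · intro r hr τ hcr hfr ⟨p1, p2⟩
    have e0 : τ 0 = σ 0 := by
      rw [hfr 0 (by simp [Cmd.writes, Cmd.asg, ha0.symm, hp0.symm]), store_of_ne hp0.symm,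
        store_of_ne ha0.symm]
    have e2 : τ 2 = σ 2 := by
      rw [hfr 2 (by simp [Cmd.writes, Cmd.asg, ha2.symm, hp2.symm]), store_of_ne hp2.symm,
        store_of_ne ha2.symm]
    have hcond : ((Expr.var p).le e).eval τ ≠ 0 ↔ 2 ^ min r m.size ≤ m := by
      simp [he τ e0, p2]
    rw [store_of_ne ha66, store_of_ne hp66]
    by_cases hx : 2 ^ min r m.size ≤ m
    · have h1 : min r m.size < m.size := Nat.lt_size.2 hx
      rw [Cmd.run_ite_pos (hcond.2 hx), Cmd.run_seq,
        Cmd.run_asg (a := a) (σ := τ) (v := min r m.size + 1) (by simp [p1]) (by rw [e2]; omega),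
        Cmd.run_asg (v := 2 * 2 ^ min r m.size) (by simp [store_of_ne hap.symm, p2])
          (by rw [store_of_ne ha2.symm, e2]; omega)]
      have h2 : min (r + 1) m.size = min r m.size + 1 := by omega
      simp [store_of_ne hap, h2, pow_succ, mul_comm]
    · rw [Cmd.run_ite_neg (fun h => hx (hcond.1 h)), Cmd.run_skip]
      have h1 : ¬ min r m.size < m.size := fun h => hx (Nat.lt_size.1 h)
      have h2 : min (r + 1) m.size = min r m.size := by omega
      rw [h2]
      exact ⟨p1, p2⟩

theorem run_powCmd {σ : Memory} {m X : ℕ} (hm : σ 0 1 = m) (hX : 4 * σ 12 0 * m = X)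
    (hR : X ≤ σ 3 0) (hRC : σ 3 0 ≤ σ 2 0) (hC : (m + 1) ^ X ≤ σ 2 0) :
    powCmd.run σ 15 0 = m ^ X := by
  unfold powCmd
  have hle : ∀ r ≤ X, m ^ r ≤ σ 2 0 := fun r hr =>
    ((Nat.pow_le_pow_left (Nat.le_succ m) r).trans
      (Nat.pow_le_pow_right (Nat.succ_pos m) hr)).trans hC
  rw [Cmd.run_seq, Cmd.run_asg (v := 1) rfl (by simpa using hle 0 (Nat.zero_le _))]
  refine Cmd.run_rep X (fun r τ => τ 15 0 = m ^ r) rfl ?_ ?_ ?_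
  · have : (Expr.lit 4 * .var 12 * mE).eval (store σ 15 0 1) = X := by
      simp [mE, store_of_ne, hm, hX]
    rw [this, store_of_ne (by decide), store_of_ne (by decide)]
    omega
  · simp [store_of_ne]
  · intro r hr τ hcr hfr hp
    have e0 : τ 0 = σ 0 := by rw [hfr 0 rfl, store_of_ne (by decide)]
    have e2 : τ 2 = σ 2 := by rw [hfr 2 rfl, store_of_ne (by decide)]
    rw [Cmd.run_asg (v := m ^ (r + 1)) (by simp [mE, hp, e0, hm, pow_succ])
      (by rw [e2]; exact hle _ hr)]
    simp [store_of_ne]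

namespace IntGraph

variable {I : IntGraph} {C R b : ℕ} {σ : Memory}

theorem pw_succ (hm : 0 < I.m) {x : ℕ} (hx : x < I.X) : I.pw x / I.m * (I.m + 1) = I.pw (x + 1) := by
  unfold pw
  rw [if_pos hx.le, if_pos (Nat.succ_le_of_lt hx)]
  obtain ⟨y, hy⟩ : ∃ y, I.X - x = y + 1 := ⟨I.X - x - 1, by omega⟩
  rw [hy, show I.X - (x + 1) = y by omega, pow_succ, ← mul_assoc, Nat.mul_div_cancel _ hm]
  ring

/-- As `pw` is 0 beyond `X`, the finite table in a fresh array agrees with `pw` at every index.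
Divisions by `m` are exact by `pw_succ`. -/
theorem run_tableCmd (hm0 : 0 < I.m) (hm : σ 0 1 = I.m) (hL : σ 12 0 = I.L)
    (h15 : σ 15 0 = I.m ^ I.X) (h16 : σ 16 = 0)
    (hR : I.X ≤ σ 3 0) (hRC : σ 3 0 ≤ σ 2 0) (hC : (I.m + 1) ^ I.X ≤ σ 2 0) :
    tableCmd.run σ 16 = I.pw := by
  unfold tableCmd
  rw [Cmd.run_seq, Cmd.run_asg (e := .var 15) (σ := σ) (v := I.m ^ I.X) h15
    ((Nat.pow_le_pow_left (Nat.le_succ _) _).trans hC)]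
  have key : ∀ f : ℕ → ℕ, f = (fun x => if x ≤ I.X then I.pw x else 0) → f = I.pw := by
    rintro f rfl
    funext x
    unfold pw
    split_ifs <;> rfl
  refine key _ (Cmd.run_rep I.X (fun r τ => τ 16 = fun x => if x ≤ r then I.pw x else 0) rfl
    ?_ ?_ ?_)
  · have : (Expr.lit 4 * .var 12 * mE).eval (store σ 16 0 (I.m ^ I.X)) = I.X := by
      simp [mE, store_of_ne, hm, hL, X, lam]; left; ring
    rw [this, store_of_ne (by decide), store_of_ne (by decide)]
    omega
  · rw [store_of_ne (by decide), store_of_ne (by decide), store_same, h16]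
    funext x
    by_cases hx : x = 0
    · subst hx; simp [pw]
    · simp [hx]
  · intro r hr τ hcr hfr hp
    have e0 : τ 0 = σ 0 := by rw [hfr 0 rfl, store_of_ne (by decide)]
    have e2 : τ 2 = σ 2 := by rw [hfr 2 rfl, store_of_ne (by decide)]
    rw [Cmd.run_set (x := r + 1) (v := I.pw (r + 1)) (by simp [hcr])
      (by simp [mE, hcr, hp, e0, hm, pw_succ hm0 hr]) (by rw [e2]; exact (pw_le _).trans hC),
      store_of_ne (by decide), store_same, hp]
    funext x
    by_cases hx : x = r + 1
    · subst hx; simp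
    · have : x ≤ r + 1 ↔ x ≤ r := by omega
      simp [hx, this]

/-- The word `w` (with its length in front) describes the graph `I`. -/
structure Describes (I : IntGraph) (w : ℕ → ℕ) : Prop where
  m : w 1 = I.m
  n : w 2 = I.n
  f : ∀ i < I.m, w (3 + 2 * i) * (costScale w / w (3 + 2 * i + 1)) = I.f i
  e : ∀ i < I.m, ∀ j < I.n, w (3 + 2 * I.m + 3 * (i * I.n + j)) = I.e i j
  d : ∀ i < I.m, ∀ j < I.n, w (3 + 2 * I.m + 3 * (i * I.n + j) + 1) *
    (costScale w / w (3 + 2 * I.m + 3 * (i * I.n + j) + 1 + 1)) = I.d i j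

theorem run_initCmd (hm : 0 < I.m) (hw : Describes I (σ 0)) (h2 : σ 2 0 = C) (h3 : σ 3 0 = R)
    (hz : ∀ a, 10 ≤ a → σ a = 0) (hf : Fits I C R b) (hlen : 2 + 2 * I.m + 3 * (I.m * I.n) ≤ R)
    (hscale : costScale (σ 0) ≤ C) (hX : I.X ≤ R) (hpw : (I.m + 1) ^ I.X ≤ C)
    (hlam : 2 ^ I.lam ≤ C) :
    Params I C R (initCmd.run σ) ∧ Rel I.init (initCmd.run σ) := by
  have hRC := hf.rep
  have hmR := hf.m
  have hnR := hf.n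
  have hu := hf.u
  have hpk := hf.pk
  have hnN : I.n < I.NN := n_lt_NN
  have t1 : scaleCmd.run σ 10 0 = costScale (σ 0) :=
    run_scaleCmd (by rw [hw.m, hw.n, h3]; exact hlen) (by omega) (by omega)
  have f1 : ∀ a, scaleCmd.writes a = false → scaleCmd.run σ a = σ a :=
    fun a ha => Cmd.run_eq_of_not_writes ha σ
  set σ1 := scaleCmd.run σ
  have t2 := run_sizeCmd (σ := σ1) (a := 11) (p := 40) (m := I.m) (e := mE) (by decide)
    (by decide) (by decide) (fun τ hτ => by simp [mE, hτ, f1 0 rfl, hw.m])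
    (by rw [f1 3 rfl]; omega) (by rw [f1 3 rfl, f1 2 rfl]; omega) (by rw [f1 2 rfl]; omega)
  have f2 : ∀ a, (sizeCmd 11 40 mE).writes a = false → (sizeCmd 11 40 mE).run σ1 a = σ1 a :=
    fun a ha => Cmd.run_eq_of_not_writes ha σ1
  set σ2 := (sizeCmd 11 40 mE).run σ1
  have t3 := run_sizeCmd (σ := σ2) (a := 12) (p := 13) (m := I.n) (e := nE) (by decide)
    (by decide) (by decide) (fun τ hτ => by simp [nE, hτ, f2 0 rfl, f1 0 rfl, hw.n])
    (by rw [f2 3 rfl, f1 3 rfl]; omega) (by rw [f2 3 rfl, f1 3 rfl, f2 2 rfl, f1 2 rfl]; omega)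
    (by rw [f2 2 rfl, f1 2 rfl]; omega)
  have f3 : ∀ a, (sizeCmd 12 13 nE).writes a = false → (sizeCmd 12 13 nE).run σ2 a = σ2 a :=
    fun a ha => Cmd.run_eq_of_not_writes ha σ2
  set σ3 := (sizeCmd 12 13 nE).run σ2
  have e3 : ∀ a ∈ [0, 2, 3, 15, 16, 20, 21, 22, 23, 24, 25, 26, 27, 28], σ3 a = σ a :=
    fun a ha => by
      rw [f3 a (by revert a; decide), f2 a (by revert a; decide), f1 a (by revert a; decide)]
  have t4 : (Cmd.asg 14 (.var 13 * .var 13)).run σ3 = store σ3 14 0 (2 ^ I.lam) :=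
    Cmd.run_asg (by simp [t3.2, lam, L, two_mul, pow_add]) (by rw [e3 2 (by decide), h2]; exact hlam)
  set σ4 := store σ3 14 0 (2 ^ I.lam)
  have e4 : ∀ a, a ≠ 14 → σ4 a = σ3 a := fun a ha => store_of_ne ha
  have hcap4 : σ4 2 0 = C := by rw [e4 2 (by decide), e3 2 (by decide), h2]
  have hrep4 : σ4 3 0 = R := by rw [e4 3 (by decide), e3 3 (by decide), h3]
  have hm4 : σ4 0 1 = I.m := by rw [e4 0 (by decide), e3 0 (by decide), hw.m]
  have hL4 : σ4 12 0 = I.L := by rw [e4 12 (by decide), t3.1]; rfl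
  have t5 : powCmd.run σ4 15 0 = I.m ^ I.X := run_powCmd hm4
    (by rw [hL4]; unfold X lam; ring) (by omega) (by omega) (by omega)
  have f5 : ∀ a, powCmd.writes a = false → powCmd.run σ4 a = σ4 a :=
    fun a ha => Cmd.run_eq_of_not_writes ha σ4
  set σ5 := powCmd.run σ4
  have t6 : tableCmd.run σ5 16 = I.pw := run_tableCmd hm (by rw [f5 0 rfl, hm4])
    (by rw [f5 12 rfl, hL4]) t5
    (by rw [f5 16 rfl, e4 16 (by decide), e3 16 (by decide), hz 16 (by decide)])
    (by rw [f5 3 rfl]; omega) (by rw [f5 3 rfl, f5 2 rfl]; omega) (by rw [f5 2 rfl]; omega)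
  have f6 : ∀ a, tableCmd.writes a = false → tableCmd.run σ5 a = σ5 a :=
    fun a ha => Cmd.run_eq_of_not_writes ha σ5
  have hrun : initCmd.run σ = resetCmd.run (tableCmd.run σ5) := by
    unfold initCmd
    rw [Cmd.run_seq, Cmd.run_seq, Cmd.run_seq, Cmd.run_seq, t4, Cmd.run_seq, Cmd.run_seq]
  rw [hrun]
  set σ6 := tableCmd.run σ5
  have e0 : σ6 0 = σ 0 := by rw [f6 0 rfl, f5 0 rfl, e4 0 (by decide), e3 0 (by decide)]
  have e10 : σ6 10 0 = costScale (σ 0) := by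
    rw [f6 10 rfl, f5 10 rfl, e4 10 (by decide), f3 10 rfl, f2 10 rfl, t1]
  have hpar : Params I C R σ6 := by
    constructor
    · rw [f6 2 rfl, f5 2 rfl, hcap4]
    · rw [f6 3 rfl, f5 3 rfl, hrep4]
    · rw [e0, hw.m]
    · rw [e0, hw.n]
    · rw [e0, e10]; exact hw.f
    · rw [e0]; exact hw.e
    · rw [e0, e10]; exact hw.d
    · rw [f6 11 rfl, f5 11 rfl, e4 11 (by decide), f3 11 rfl, t2.1]; rfl
    · rw [f6 12 rfl, f5 12 rfl, hL4]
    · rw [f6 13 rfl, f5 13 rfl, e4 13 (by decide), t3.2]; rfl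
    · rw [f6 14 rfl, f5 14 rfl]; exact store_cell _ _ _ _
    · rw [f6 15 rfl, t5]
    · exact t6
  have e20 : ∀ a ∈ stateArrays, σ6 a = 0 := fun a ha => by
    rw [f6 a (by revert a; decide), f5 a (by revert a; decide), e4 a (by revert a; decide),
      e3 a (by revert a; decide), hz a (by revert a; decide)]
  -- Untouched memory represents the zero state, whose reset is `init`.
  have hrel : Rel ⟨0, 0, 0, 0, 0, fun _ => 0, fun _ => 0, fun _ => 0, fun _ => 0⟩ σ6 := by
    constructor <;> rw [e20 _ (by decide)] <;> rfl
  exact ⟨hpar.run (by decide), run_resetCmd hpar hf hrel (by omega)⟩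

end IntGraph

theorem run_outputCmd {σ : Memory} {m n : ℕ} (hm : σ 0 1 = m) (hn : σ 0 2 = n)
    (hR : m + m * n ≤ σ 3 0) (hRC : σ 3 0 ≤ σ 2 0) (hC : 1 ≤ σ 2 0) :
    outputCmd.run σ 1 0 = m + m * n ∧
    (∀ i < m, outputCmd.run σ 1 (i + 1) = if σ 25 i ≠ 0 then 1 else 0) ∧
    ∀ x < m * n, outputCmd.run σ 1 (m + x + 1) = if σ 28 x ≠ 0 then 1 else 0 := by
  have hif : ∀ y : ℕ, (if 0 < y then 1 else 0) = if y ≠ 0 then 1 else 0 := fun y => by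
    simp [Nat.pos_iff_ne_zero]
  unfold outputCmd
  rw [Cmd.run_seq, Cmd.run_seq, Cmd.run_set (σ := σ) (x := 0) (v := m + m * n) rfl
    (by simp [mE, nE, hm, hn]) (by omega)]
  set σ1 := store σ 1 0 (m + m * n) with hσ1
  have f1 : ∀ a ≠ 1, σ1 a = σ a := fun a ha => store_of_ne ha
  set p : Cmd := .rep 66 67 mE
    (.set 1 (.var 66 + .lit 1) ((Expr.lit 0).lt (.get 25 (.var 66)))) with hp
  have t2 : p.run σ1 1 0 = m + m * n ∧
      ∀ i < m, p.run σ1 1 (i + 1) = if σ 25 i ≠ 0 then 1 else 0 := by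
    refine Cmd.run_rep m (fun r τ => τ 1 0 = m + m * n ∧
      ∀ i < r, τ 1 (i + 1) = if σ 25 i ≠ 0 then 1 else 0) rfl ?_ ?_ ?_
    · have : mE.eval σ1 = m := by simp [mE, f1, hm]
      rw [this, f1 2 (by decide), f1 3 (by decide)]
      omega
    · simp [store_of_ne, hσ1]
    · intro r hr τ hcr hfr ⟨p1, p2⟩
      have e2 : τ 2 = σ 2 := by rw [hfr 2 rfl, f1 2 (by decide)]
      have e25 : τ 25 = σ 25 := by rw [hfr 25 rfl, f1 25 (by decide)]
      rw [Cmd.run_set (x := r + 1) (v := if σ 25 r ≠ 0 then 1 else 0) (by simp [hcr])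
        (by rw [← hif]; simp [hcr, e25]) (by rw [e2]; split_ifs <;> omega),
        store_of_ne (by decide), store_same]
      refine ⟨by simp [p1], fun i hi => ?_⟩
      by_cases hir : i = r
      · subst hir; simp
      · rw [Function.update_of_ne (by omega)]
        exact p2 i (by omega)
  have f2 : ∀ a, p.writes a = false → p.run σ1 a = σ1 a :=
    fun a ha => Cmd.run_eq_of_not_writes ha σ1
  set σ2 := p.run σ1
  have e0 : σ2 0 = σ 0 := by rw [f2 0 rfl, f1 0 (by decide)]
  have := Cmd.run_rep (c := 66) (l := 67) (e := mE * nE) (σ := σ2)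
    (p := .set 1 (mE + .var 66 + .lit 1) ((Expr.lit 0).lt (.get 28 (.var 66)))) (m * n)
    (fun r τ => τ 1 0 = m + m * n ∧
      (∀ i < m, τ 1 (i + 1) = if σ 25 i ≠ 0 then 1 else 0) ∧
      ∀ x < r, τ 1 (m + x + 1) = if σ 28 x ≠ 0 then 1 else 0) rfl ?_ ?_ ?_
  · exact this
  · have : (mE * nE).eval σ2 = m * n := by simp [mE, nE, e0, hm, hn]
    rw [this, f2 2 rfl, f2 3 rfl, f1 2 (by decide), f1 3 (by decide)]
    omega
  · simpa [store_of_ne] using t2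
  · intro r hr τ hcr hfr ⟨p1, p2, p3⟩
    have e0' : τ 0 = σ 0 := by rw [hfr 0 rfl, e0]
    have e2 : τ 2 = σ 2 := by rw [hfr 2 rfl, f2 2 rfl, f1 2 (by decide)]
    have e28 : τ 28 = σ 28 := by rw [hfr 28 rfl, f2 28 rfl, f1 28 (by decide)]
    rw [Cmd.run_set (x := m + r + 1) (v := if σ 28 r ≠ 0 then 1 else 0)
      (by simp [mE, hcr, e0', hm])
      (by rw [← hif]; simp [hcr, e28]) (by rw [e2]; split_ifs <;> omega),
      store_of_ne (by decide), store_same]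
    refine ⟨by simp [p1], fun i hi => ?_, fun x hx => ?_⟩
    · rw [Function.update_of_ne (by omega)]
      exact p2 i hi
    · by_cases hir : x = r
      · subst hir; simp
      · rw [Function.update_of_ne (by omega)]
        exact p3 x (by omega)

/-! ## Encodings -/

theorem getD_flatMap {α : Type} {l : List α} {g : α → List ℕ} {k : ℕ}
    (hg : ∀ x ∈ l, (g x).length = k) {i r : ℕ} (hi : i < l.length) (hr : r < k) :
    (l.flatMap g).getD (k * i + r) 0 = (g l[i]).getD r 0 := by
  induction l generalizing i with
  | nil => simp at hi
  | cons x l ih =>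
    rw [List.flatMap_cons]
    have hx := hg x List.mem_cons_self
    cases i with
    | zero =>
      rw [List.getD_append _ _ _ _ (by rw [hx]; simpa using hr)]
      simp
    | succ i =>
      rw [List.getD_append_right _ _ _ _ (by rw [hx, mul_add]; omega), hx,
        show k * (i + 1) + r - k = k * i + r by rw [mul_add]; omega,
        ih (fun y hy => hg y (List.mem_cons_of_mem _ hy)) (by simpa using hi)]
      simp

theorem length_flatMap_eq {α : Type} {l : List α} {g : α → List ℕ} {k : ℕ}
    (hg : ∀ x ∈ l, (g x).length = k) : (l.flatMap g).length = k * l.length := by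
  induction l with
  | nil => simp
  | cons x l ih =>
    rw [List.flatMap_cons, List.length_append, hg x List.mem_cons_self,
      ih fun y hy => hg y (List.mem_cons_of_mem _ hy), List.length_cons, mul_add]
    omega

theorem prod_range_getD (w : List ℕ) (f : ℕ → ℕ) :
    ∏ k ∈ Finset.range w.length, f (w.getD k 0) = (w.map f).prod := by
  induction w with
  | nil => simp
  | cons x w ih =>
    rw [List.length_cons, Finset.prod_range_succ', List.map_cons, List.prod_cons, ← ih, mul_comm]
    simp

/-- The words that describe the opening costs and the connections. -/
def facilityWord (G : FCGraph) : List ℕ :=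
  (List.finRange G.nF).flatMap fun f => encodeCost (G.facilityCost f)

def edgeWord (G : FCGraph) (f : Fin G.nF) (c : Fin G.nC) : List ℕ :=
  if (f, c) ∈ G.edges then 1 :: encodeCost (G.edgeCost (f, c)) else [0, 0, 0]

def connectionWord (G : FCGraph) : List ℕ :=
  (List.finRange G.nF).flatMap fun f => (List.finRange G.nC).flatMap fun c => edgeWord G f c

theorem encodeGraph_eq (G : FCGraph) :
    encodeGraph G = [G.nF, G.nC] ++ facilityWord G ++ connectionWord G := rfl

theorem length_edgeWord (G : FCGraph) (f : Fin G.nF) (c : Fin G.nC) :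
    (edgeWord G f c).length = 3 := by
  unfold edgeWord
  split_ifs <;> rfl

theorem length_facilityWord (G : FCGraph) : (facilityWord G).length = 2 * G.nF := by
  unfold facilityWord
  rw [length_flatMap_eq (k := 2) fun _ _ => rfl, List.length_finRange]

theorem length_edgeWords (G : FCGraph) (f : Fin G.nF) :
    ((List.finRange G.nC).flatMap fun c => edgeWord G f c).length = 3 * G.nC := by
  rw [length_flatMap_eq fun _ _ => length_edgeWord G f _, List.length_finRange]

theorem length_connectionWord (G : FCGraph) :
    (connectionWord G).length = 3 * (G.nF * G.nC) := by
  unfold connectionWord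
  rw [length_flatMap_eq fun f _ => length_edgeWords G f, List.length_finRange]
  ring

theorem length_encodeGraph (G : FCGraph) :
    (encodeGraph G).length = 2 + 2 * G.nF + 3 * (G.nF * G.nC) := by
  rw [encodeGraph_eq, List.length_append, List.length_append, length_facilityWord,
    length_connectionWord]
  rfl

theorem getD_encodeGraph_facility (G : FCGraph) (i : Fin G.nF) {r : ℕ} (hr : r < 2) :
    (encodeGraph G).getD (2 + 2 * i + r) 0 = (encodeCost (G.facilityCost i)).getD r 0 := by
  have hi := i.2
  rw [encodeGraph_eq, List.getD_append _ _ _ _ (by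
    rw [List.length_append, length_facilityWord]
    simp only [List.length_cons, List.length_nil]; omega),
    List.getD_append_right _ _ _ _ (by simp only [List.length_cons, List.length_nil]; omega)]
  simp only [List.length_cons, List.length_nil]
  rw [show 2 + 2 * (i : ℕ) + r - (0 + 1 + 1) = 2 * i + r by omega, facilityWord,
    getD_flatMap (k := 2) (fun _ _ => rfl) (by simp) hr]
  simp

theorem getD_encodeGraph_edge (G : FCGraph) (i : Fin G.nF) (j : Fin G.nC) {r : ℕ} (hr : r < 3) :
    (encodeGraph G).getD (2 + 2 * G.nF + 3 * (i * G.nC + j) + r) 0 =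
      (edgeWord G i j).getD r 0 := by
  have hj := j.2
  rw [encodeGraph_eq, List.getD_append_right _ _ _ _ (by
    rw [List.length_append, length_facilityWord]
    simp only [List.length_cons, List.length_nil]; omega),
    List.length_append, length_facilityWord]
  simp only [List.length_cons, List.length_nil]
  have e : 2 + 2 * G.nF + 3 * (i * G.nC + j) + r - (0 + 1 + 1 + 2 * G.nF) =
      (3 * G.nC) * i + (3 * j + r) := by
    have : 3 * (i * G.nC + j) = (3 * G.nC) * i + 3 * j := by ring
    omega
  rw [e, connectionWord, getD_flatMap (fun f _ => length_edgeWords G f) (by simp) (by omega),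
    getD_flatMap (fun c _ => length_edgeWord G _ c) (by simp) hr]
  simp

theorem getD_encodeInput_graph (G : FCGraph) (A : List (Fin G.nC)) {k : ℕ}
    (hk : k < (encodeGraph G).length) :
    (encodeInput ⟨G, A⟩).getD k 0 = (encodeGraph G).getD k 0 :=
  List.getD_append _ _ _ _ hk

theorem getD_encodeInput_client (G : FCGraph) (A : List (Fin G.nC)) (k : ℕ) :
    (encodeInput ⟨G, A⟩).getD (2 + 2 * G.nF + 3 * (G.nF * G.nC) + k) 0 =
      (A.length :: A.map Fin.val).getD k 0 := by
  change (encodeGraph G ++ A.length :: A.map Fin.val).getD _ 0 = _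
  rw [List.getD_append_right _ _ _ _ (by rw [length_encodeGraph]; omega), length_encodeGraph,
    Nat.add_sub_cancel_left]

theorem length_encodeInput (G : FCGraph) (A : List (Fin G.nC)) :
    (encodeInput ⟨G, A⟩).length = 2 + 2 * G.nF + 3 * (G.nF * G.nC) + (A.length + 1) := by
  change (encodeGraph G ++ A.length :: A.map Fin.val).length = _
  rw [List.length_append, length_encodeGraph, List.length_cons, List.length_map]

/-! ### Clearing denominators -/

/-- A common multiple of the denominators of all costs. -/
def FCGraph.scale (G : FCGraph) : ℕ :=
  ∏ k ∈ Finset.range (encodeGraph G).length, max ((encodeGraph G).getD k 0) 1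

theorem FCGraph.scale_pos (G : FCGraph) : 0 < G.scale :=
  Finset.prod_pos fun _ _ => lt_max_of_lt_right one_pos

theorem dvd_scale (G : FCGraph) {k x : ℕ} (hk : k < (encodeGraph G).length)
    (hx : (encodeGraph G).getD k 0 = x) (h : 0 < x) : x ∣ G.scale := by
  have := Finset.dvd_prod_of_mem (fun k => max ((encodeGraph G).getD k 0) 1)
    (Finset.mem_range.2 hk)
  rwa [hx, max_eq_left (Nat.succ_le_of_lt h)] at this

theorem den_facilityCost_dvd (G : FCGraph) (i : Fin G.nF) :
    (G.facilityCost i).den ∣ G.scale := by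
  have hi := i.2
  exact dvd_scale G (by rw [length_encodeGraph]; omega)
    (getD_encodeGraph_facility G i (r := 1) (by omega)) (NNRat.den_pos _)

theorem den_edgeCost_dvd (G : FCGraph) {i : Fin G.nF} {j : Fin G.nC} (h : (i, j) ∈ G.edges) :
    (G.edgeCost (i, j)).den ∣ G.scale := by
  have hlt := IntGraph.flat_index_lt i.2 j.2
  have hw := getD_encodeGraph_edge G i j (r := 2) (by omega)
  rw [edgeWord, if_pos h] at hw
  exact dvd_scale G (by rw [length_encodeGraph]; omega) hw (NNRat.den_pos _)

/-- The cost `q`, multiplied by the common multiple. -/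
def FCGraph.scaled (G : FCGraph) (q : ℚ≥0) : ℕ := q.num * (G.scale / q.den)

theorem scaled_eq (G : FCGraph) {q : ℚ≥0} (h : q.den ∣ G.scale) :
    (G.scaled q : ℝ) = (q : ℝ) * G.scale := by
  have hq : (q.den : ℝ) ≠ 0 := by exact_mod_cast q.den_ne_zero
  rw [FCGraph.scaled, Nat.cast_mul, Nat.cast_div h hq, NNRat.cast_def]
  ring

/-- The graph with integral costs. -/
def FCGraph.toInt (G : FCGraph) : IntGraph where
  m := G.nF
  n := G.nC
  f i := if h : i < G.nF then G.scaled (G.facilityCost ⟨i, h⟩) else 0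
  d i j := if h : i < G.nF ∧ j < G.nC then
    if (⟨i, h.1⟩, ⟨j, h.2⟩) ∈ G.edges then G.scaled (G.edgeCost (⟨i, h.1⟩, ⟨j, h.2⟩)) else 0 else 0
  e i j := if h : i < G.nF ∧ j < G.nC then
    if (⟨i, h.1⟩, ⟨j, h.2⟩) ∈ G.edges then 1 else 0 else 0

theorem FCGraph.toInt_f (G : FCGraph) (i : Fin G.nF) :
    G.toInt.f i = G.scaled (G.facilityCost i) := by
  simp [toInt]

theorem FCGraph.toInt_d (G : FCGraph) (i : Fin G.nF) (j : Fin G.nC) :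
    G.toInt.d i j = if (i, j) ∈ G.edges then G.scaled (G.edgeCost (i, j)) else 0 := by
  simp [toInt]

theorem FCGraph.toInt_e (G : FCGraph) (i : Fin G.nF) (j : Fin G.nC) :
    G.toInt.e i j = if (i, j) ∈ G.edges then 1 else 0 := by
  simp [toInt]

/-! ### The input word describes the integral graph -/

/-- The input as it is found in the memory. -/
def inputArray (w : List ℕ) (i : ℕ) : ℕ := (w.length :: w).getD i 0

theorem inputArray_succ (w : List ℕ) (i : ℕ) : inputArray w (i + 1) = w.getD i 0 := by
  simp [inputArray]

theorem inputArray_graph (G : FCGraph) (A : List (Fin G.nC)) {k : ℕ}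
    (hk : k < 2 + 2 * G.nF + 3 * (G.nF * G.nC)) :
    inputArray (encodeInput ⟨G, A⟩) (k + 1) = (encodeGraph G).getD k 0 := by
  rw [inputArray_succ, getD_encodeInput_graph _ _ (by rwa [length_encodeGraph])]

theorem inputArray_one (G : FCGraph) (A : List (Fin G.nC)) :
    inputArray (encodeInput ⟨G, A⟩) 1 = G.nF := by
  rw [inputArray_graph G A (k := 0) (by omega)]; rfl

theorem inputArray_two (G : FCGraph) (A : List (Fin G.nC)) :
    inputArray (encodeInput ⟨G, A⟩) 2 = G.nC := by
  rw [inputArray_graph G A (k := 1) (by omega)]; rfl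

theorem costScale_inputArray (G : FCGraph) (A : List (Fin G.nC)) :
    costScale (inputArray (encodeInput ⟨G, A⟩)) = G.scale := by
  unfold costScale FCGraph.scale
  rw [inputArray_one, inputArray_two, length_encodeGraph]
  refine Finset.prod_congr rfl fun k hk => ?_
  rw [inputArray_graph G A (Finset.mem_range.1 hk)]

theorem describes_inputArray (G : FCGraph) (A : List (Fin G.nC)) :
    IntGraph.Describes G.toInt (inputArray (encodeInput ⟨G, A⟩)) := by
  refine ⟨inputArray_one G A, inputArray_two G A, fun i hi => ?_, fun i hi j hj => ?_,
    fun i hi j hj => ?_⟩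
  · change i < G.nF at hi
    have h0 : (encodeGraph G).getD (2 + 2 * i) 0 = _ :=
      getD_encodeGraph_facility G ⟨i, hi⟩ (r := 0) (by omega)
    have h1 : (encodeGraph G).getD (2 + 2 * i + 1) 0 = _ :=
      getD_encodeGraph_facility G ⟨i, hi⟩ (r := 1) (by omega)
    rw [costScale_inputArray, show 3 + 2 * i = 2 + 2 * i + 1 by omega,
      inputArray_graph G A (by omega), inputArray_graph G A (by omega), h0, h1,
      G.toInt_f ⟨i, hi⟩]
    rfl
  · change i < G.nF at hi
    change j < G.nC at hj
    have hlt := IntGraph.flat_index_lt hi hj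
    have h0 : (encodeGraph G).getD (2 + 2 * G.nF + 3 * (i * G.nC + j)) 0 = _ :=
      getD_encodeGraph_edge G ⟨i, hi⟩ ⟨j, hj⟩ (r := 0) (by omega)
    change inputArray _ (3 + 2 * G.nF + 3 * (i * G.nC + j)) = _
    rw [show 3 + 2 * G.nF + 3 * (i * G.nC + j) = 2 + 2 * G.nF + 3 * (i * G.nC + j) + 1 by omega,
      inputArray_graph G A (by omega), h0, G.toInt_e ⟨i, hi⟩ ⟨j, hj⟩, edgeWord]
    split_ifs <;> rfl
  · change i < G.nF at hi
    change j < G.nC at hj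
    have hlt := IntGraph.flat_index_lt hi hj
    change inputArray _ (3 + 2 * G.nF + 3 * (i * G.nC + j) + 1) *
      (_ / inputArray _ (3 + 2 * G.nF + 3 * (i * G.nC + j) + 1 + 1)) = _
    have h1 : (encodeGraph G).getD (2 + 2 * G.nF + 3 * (i * G.nC + j) + 1) 0 = _ :=
      getD_encodeGraph_edge G ⟨i, hi⟩ ⟨j, hj⟩ (r := 1) (by omega)
    have h2 : (encodeGraph G).getD (2 + 2 * G.nF + 3 * (i * G.nC + j) + 1 + 1) 0 = _ :=
      getD_encodeGraph_edge G ⟨i, hi⟩ ⟨j, hj⟩ (r := 2) (by omega)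
    rw [costScale_inputArray,
      show 3 + 2 * G.nF + 3 * (i * G.nC + j) = 2 + 2 * G.nF + 3 * (i * G.nC + j) + 1 by omega,
      inputArray_graph G A (by omega), inputArray_graph G A (by omega), h1, h2,
      G.toInt_d ⟨i, hi⟩ ⟨j, hj⟩, edgeWord]
    split_ifs
    · rfl
    -- A pair that is not an edge is encoded with numerator 0, in agreement with the value 0 of `d`.
    · exact Nat.zero_mul _

theorem length_encodePurchase {G : FCGraph} (S : Purchase G) :
    (encodePurchase S).length = G.nF + G.nF * G.nC := by
  unfold encodePurchase
  rw [List.length_append, length_flatMap_eq (k := G.nC) (fun _ _ => by simp)]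
  simp [mul_comm]

theorem getD_encodePurchase_facility {G : FCGraph} (S : Purchase G) (i : Fin G.nF) :
    (encodePurchase S).getD i 0 = if i ∈ S.facilities then 1 else 0 := by
  unfold encodePurchase
  rw [List.getD_append _ _ _ _ (by simp)]
  simp

theorem getD_encodePurchase_edge {G : FCGraph} (S : Purchase G) (i : Fin G.nF) (j : Fin G.nC) :
    (encodePurchase S).getD (G.nF + (i * G.nC + j)) 0 = if (i, j) ∈ S.edges then 1 else 0 := by
  unfold encodePurchase
  rw [List.getD_append_right _ _ _ _ (by simp), List.length_map, List.length_finRange,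
    Nat.add_sub_cancel_left, mul_comm, getD_flatMap (k := G.nC) (fun _ _ => by simp) (by simp) j.2]
  simp

/-! ## The bounds suffice -/

namespace IntGraph

variable {I : IntGraph} {W b : ℕ}

theorem NN_le (hn : 0 < I.n) : I.NN ≤ 2 * I.n := by
  unfold NN L
  obtain ⟨p, hp⟩ : ∃ p, I.n.size = p + 1 := ⟨I.n.size - 1, by have := Nat.size_pos.2 hn; omega⟩
  have : 2 ^ p ≤ I.n := Nat.lt_size.1 (by omega)
  rw [hp, pow_succ]
  omega

/-- With `mu ≤ m` and `NN ≤ 2 * n`, the number of rounds is bounded by the product of the summands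
`2 * m` and `3 * (m * n)` of the input length. -/
theorem Q_le (hn : 0 < I.n) (hW : 2 + 2 * I.m + 3 * (I.m * I.n) < W) : I.Q + 1 ≤ W ^ 2 := by
  have h1 : 3 * I.mu * I.m * I.NN ≤ 3 * I.m * I.m * (2 * I.n) :=
    Nat.mul_le_mul (Nat.mul_le_mul_right _ (Nat.mul_le_mul_left _ (Nat.size_le_self _))) (NN_le hn)
  have h2 : 3 * I.m * I.m * (2 * I.n) = (2 * I.m) * (3 * (I.m * I.n)) := by ring
  have h3 : (2 * I.m + 3 * (I.m * I.n) + 3) ^ 2 ≤ W ^ 2 := Nat.pow_le_pow_left (by omega) 2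
  have h4 : ∀ x y : ℕ, x * y + 2 ≤ (x + y + 3) ^ 2 := fun x y => by nlinarith
  have h5 := h4 (2 * I.m) (3 * (I.m * I.n))
  unfold Q
  omega

theorem le_of_size_bound (hm : 0 < I.m) (hn : 0 < I.n) (hW : 2 + 2 * I.m + 3 * (I.m * I.n) < W) :
    8 ≤ W ∧ I.m + I.n ≤ W ∧ I.X ≤ 2 * W ∧ I.L ≤ I.n := by
  have hL : I.L ≤ I.n := Nat.size_le_self _
  have h1 : I.n ≤ I.m * I.n := Nat.le_mul_of_pos_left _ hm
  have h2 : I.X ≤ 2 * (2 * I.n) * I.m * 1 := by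
    unfold X lam
    calc 2 * (2 * I.L) * I.m ≤ 2 * (2 * I.n) * I.m := by gcongr
      _ = _ := by ring
  refine ⟨by omega, by omega, ?_, hL⟩
  nlinarith

/-- The largest numbers are the powers `(m + 1) ^ X ≤ 2 ^ (2 * W ^ 2)`, for which `X ≤ 2 * W` is
decisive. The exponent 10 is generous, and `W ≥ 8` absorbs the constants. -/
theorem fits_of_bound (hm : 0 < I.m) (hn : 0 < I.n) (hW : 2 + 2 * I.m + 3 * (I.m * I.n) < W)
    (hb : b ≤ 2 ^ (4 * W)) : Fits I (2 ^ W ^ 10) (W ^ 10) b ∧ I.X ≤ W ^ 10 ∧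
      (I.m + 1) ^ I.X ≤ 2 ^ W ^ 10 ∧ 2 ^ I.lam ≤ 2 ^ W ^ 10 := by
  obtain ⟨h8, hmn, hX, hL⟩ := le_of_size_bound hm hn hW
  have hQ := Q_le hn hW
  have h3 : 8 * W ^ 2 ≤ W ^ 10 := by
    calc 8 * W ^ 2 ≤ W * W ^ 2 := Nat.mul_le_mul_right _ h8
      _ = W ^ 3 := by ring
      _ ≤ W ^ 10 := Nat.pow_le_pow_right (by omega) (by norm_num)
  have h4 : 8 * W ≤ W ^ 2 := by rw [sq]; exact Nat.mul_le_mul_right _ h8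
  have hR : W ^ 10 < 2 ^ W ^ 10 := Nat.lt_two_pow_self
  have hpow : ∀ x ≤ W ^ 10, 2 ^ x ≤ 2 ^ W ^ 10 := fun x hx => Nat.pow_le_pow_right (by norm_num) hx
  have hp : (I.m + 1) ^ I.X ≤ 2 ^ (W * (2 * W)) := by
    have : I.m + 1 ≤ 2 ^ W := by
      have : W < 2 ^ W := Nat.lt_two_pow_self
      omega
    calc (I.m + 1) ^ I.X ≤ (2 ^ W) ^ I.X := Nat.pow_le_pow_left this _
      _ ≤ (2 ^ W) ^ (2 * W) := Nat.pow_le_pow_right (by positivity) hX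
      _ = _ := by rw [← pow_mul]
  have h5 : W * (2 * W) = 2 * W ^ 2 := by ring
  have h6 : W < 2 ^ W := Nat.lt_two_pow_self
  refine ⟨⟨by omega, by omega, by omega, hR.le, by omega, ?_, ?_, ?_, by omega, ?_⟩, by omega,
    hp.trans (hpow _ (by omega)), hpow _ (by unfold lam; omega)⟩
  · have : 4 * I.m * I.m ≤ W ^ 2 := by nlinarith
    omega
  · calc I.n * (I.L + 1) * (I.m + 1) ^ I.X ≤ 2 ^ W * 2 ^ W * 2 ^ (W * (2 * W)) := by
          refine Nat.mul_le_mul (Nat.mul_le_mul ?_ ?_) hp <;> omega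
      _ = 2 ^ (W + W + W * (2 * W)) := by rw [pow_add, pow_add]
      _ ≤ _ := hpow _ (by omega)
  · calc 2 * I.NN = 2 ^ (I.L + 1) := by rw [pow_succ, mul_comm]; rfl
      _ ≤ _ := hpow _ (by omega)
  · have h7 : 0 < 2 ^ (4 * W) := by positivity
    calc 2 * b + 1 ≤ 2 ^ (4 * W) * 2 ^ 2 := by omega
      _ = 2 ^ (4 * W + 2) := by rw [pow_add]
      _ ≤ _ := hpow _ (by omega)

/-- At most `8 * W` guesses with `8 * W ^ 2` steps each, hence at most `W ^ 5` steps. -/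
theorem fuel_le {opt : ℕ} (hm : 0 < I.m) (hn : 0 < I.n)
    (hW : 2 + 2 * I.m + 3 * (I.m * I.n) < W) (hb : 2 * opt ≤ 2 ^ (4 * W)) :
    I.fuel opt ≤ W ^ 10 := by
  obtain ⟨h8, hmn, hX, hL⟩ := le_of_size_bound hm hn hW
  have hQ := Q_le hn hW
  have hs : (2 * opt).size ≤ 4 * W + 1 := by
    rw [Nat.size_le, pow_succ]
    have : 0 < 2 ^ (4 * W) := by positivity
    omega
  have h1 : W ≤ W ^ 2 := Nat.le_self_pow (by norm_num) W
  calc I.fuel opt = ((2 * opt).size + 1) * (I.Q + L I + 1) := by unfold fuel; ring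
    _ ≤ (8 * W) * (8 * W ^ 2) := Nat.mul_le_mul (by omega) (by omega)
    _ ≤ (W * W) * (W * W ^ 2) := by gcongr
    _ = W ^ 5 := by ring
    _ ≤ W ^ 10 := Nat.pow_le_pow_right (by omega) (by norm_num)

theorem costOpt_le_mul {O : Finset ℕ} {a : ℕ → ℕ} {l : List ℕ} (hs : Solution I O a l)
    (hl : l.Nodup) {c : ℕ} (hf : ∀ i < I.m, I.f i ≤ c)
    (hd : ∀ i < I.m, ∀ j < I.n, I.d i j ≤ c) : I.costOpt O a l ≤ (I.m + I.n) * c := by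
  have h1 : ∑ i ∈ O, I.f i ≤ I.m * c := by
    calc ∑ i ∈ O, I.f i ≤ ∑ _i ∈ O, c :=
          Finset.sum_le_sum fun i hi => hf i (Finset.mem_range.1 (hs.subset hi))
      _ = O.card * c := by simp
      _ ≤ I.m * c := Nat.mul_le_mul_right _ (by simpa using Finset.card_le_card hs.subset)
  have h2 : I.connOpt a l ≤ I.n * c := by
    have := List.sum_le_card_nsmul (l.map fun j => I.d (a j) j) c (by
      intro x hx
      obtain ⟨j, hj, rfl⟩ := List.mem_map.1 hx
      exact hd _ (Finset.mem_range.1 (hs.subset (hs.mem j hj))) j (hs.lt j hj))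
    rw [List.length_map, smul_eq_mul] at this
    exact this.trans (Nat.mul_le_mul_right _ (length_le_of_nodup hs.lt hl))
  unfold costOpt
  rw [add_mul]
  omega

end IntGraph

theorem getD_lt_two_pow_inputBits (w : List ℕ) (k : ℕ) : w.getD k 0 < 2 ^ inputBits w := by
  by_cases h : k < w.length
  · rw [List.getD_eq_getElem _ _ h]
    exact lt_two_pow_inputBits (List.getElem_mem h)
  · rw [List.getD_eq_default _ _ (by omega)]
    positivity

/-- The common multiple is a product of input entries (zeros replaced by 1), so it is dominated by
the product that defines `inputBits`. -/
theorem scale_lt (G : FCGraph) (A : List (Fin G.nC)) :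
    G.scale < 2 ^ inputBits (encodeInput ⟨G, A⟩) := by
  refine lt_of_le_of_lt ?_ (prod_lt_two_pow_inputBits _)
  rw [← prod_range_getD _ fun x => 2 * x + 2]
  have hlen : (encodeGraph G).length ≤ (encodeInput ⟨G, A⟩).length := by
    rw [length_encodeInput, length_encodeGraph]; omega
  calc G.scale ≤ ∏ k ∈ Finset.range (encodeGraph G).length,
        (2 * (encodeInput ⟨G, A⟩).getD k 0 + 2) := by
        refine Finset.prod_le_prod' fun k hk => ?_
        rw [getD_encodeInput_graph G A (Finset.mem_range.1 hk)]
        omega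
    _ ≤ _ := Finset.prod_le_prod_of_subset_of_one_le' (by simpa using hlen)
        fun _ _ _ => by omega

theorem scaled_le (G : FCGraph) (A : List (Fin G.nC)) {q : ℚ≥0} {k : ℕ}
    (hk : k < (encodeGraph G).length) (hq : (encodeGraph G).getD k 0 = q.num) :
    G.scaled q ≤ 2 ^ (2 * inputBits (encodeInput ⟨G, A⟩)) := by
  have h1 := getD_lt_two_pow_inputBits (encodeInput ⟨G, A⟩) k
  rw [getD_encodeInput_graph G A hk, hq] at h1
  rw [two_mul, pow_add]
  exact Nat.mul_le_mul h1.le ((Nat.div_le_self _ _).trans (scale_lt G A).le)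

theorem toInt_f_le (G : FCGraph) (A : List (Fin G.nC)) (i : ℕ) (hi : i < G.nF) :
    G.toInt.f i ≤ 2 ^ (2 * inputBits (encodeInput ⟨G, A⟩)) := by
  rw [G.toInt_f ⟨i, hi⟩]
  exact scaled_le G A (k := 2 + 2 * i) (by rw [length_encodeGraph]; omega)
    (getD_encodeGraph_facility G ⟨i, hi⟩ (r := 0) (by omega))

theorem toInt_d_le (G : FCGraph) (A : List (Fin G.nC)) (i : ℕ) (hi : i < G.nF) (j : ℕ)
    (hj : j < G.nC) : G.toInt.d i j ≤ 2 ^ (2 * inputBits (encodeInput ⟨G, A⟩)) := by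
  rw [G.toInt_d ⟨i, hi⟩ ⟨j, hj⟩]
  have hlt := IntGraph.flat_index_lt hi hj
  split_ifs with h
  · have hw := getD_encodeGraph_edge G ⟨i, hi⟩ ⟨j, hj⟩ (r := 1) (by omega)
    rw [edgeWord, if_pos h] at hw
    exact scaled_le G A (by rw [length_encodeGraph]; simp only; omega) hw
  · exact Nat.zero_le _

/-! ## The online algorithm -/

/-- The memory on input `w` after the bounds have been computed. -/
def startMem (w : List ℕ) : Memory :=
  boundsMem w (2 ^ inputBits w ^ 10) (inputBits w ^ 10) w.length 0 0

theorem startMem_zero (w : List ℕ) : startMem w 0 = inputArray w := rfl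

theorem startMem_two (w : List ℕ) : startMem w 2 0 = 2 ^ inputBits w ^ 10 := rfl

theorem startMem_three (w : List ℕ) : startMem w 3 0 = inputBits w ^ 10 := rfl

theorem startMem_of_le (w : List ℕ) {a : ℕ} (ha : 10 ≤ a) : startMem w a = 0 := by
  funext i
  simp only [startMem, boundsMem, Pi.zero_apply]
  split_ifs <;> first | rfl | omega

/-- The memory on input `w` after all clients have been served. -/
def servedMem (w : List ℕ) : Memory := (Cmd.seq initCmd serveCmd).run (startMem w)

/-- The purchases are read off from the final memory. -/
def onlineAlg : OnlineAlgorithm := fun G A =>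
  { facilities := Finset.univ.filter fun i => servedMem (encodeInput ⟨G, A⟩) 25 i ≠ 0
    edges := Finset.univ.filter fun e =>
      servedMem (encodeInput ⟨G, A⟩) 28 (e.1 * G.nC + e.2) ≠ 0 }

theorem size_bound (G : FCGraph) (A : List (Fin G.nC)) :
    2 + 2 * G.nF + 3 * (G.nF * G.nC) < inputBits (encodeInput ⟨G, A⟩) := by
  have := length_lt_inputBits (encodeInput ⟨G, A⟩)
  rw [length_encodeInput] at this
  omega

/-- The final memory represents the state of the algorithm. -/
theorem rel_servedMem {G : FCGraph} (hF : 0 < G.nF) (hC : 0 < G.nC) {A : List (Fin G.nC)}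
    (hA : A.Nodup) {O : Finset ℕ} {a : ℕ → ℕ} (hs : G.toInt.Solution O a (A.map Fin.val))
    {opt : ℕ} (hopt : G.toInt.costOpt O a (A.map Fin.val) ≤ opt)
    (hopt' : ∀ c, (∀ i < G.nF, G.toInt.f i ≤ c) →
      (∀ i < G.nF, ∀ j < G.nC, G.toInt.d i j ≤ c) → opt ≤ (G.nF + G.nC) * c) :
    IntGraph.Rel (G.toInt.run (G.toInt.fuel opt) (A.map Fin.val))
      (servedMem (encodeInput ⟨G, A⟩)) := by
  set w := encodeInput ⟨G, A⟩ with hw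
  have hW : 2 + 2 * G.toInt.m + 3 * (G.toInt.m * G.toInt.n) < inputBits w := size_bound G A
  have hmn := (IntGraph.le_of_size_bound (I := G.toInt) hF hC hW).2.1
  -- Scaled costs are less than a product of two numbers below `2 ^ W`, and there are at most `m + n
  -- ≤ 2 ^ W` of them. Only the graph enters, so `opt` may belong to a longer sequence than `A`.
  have h1 : opt ≤ 2 ^ (3 * inputBits w) := by
    refine (hopt' _ (toInt_f_le G A) (toInt_d_le G A)).trans ?_
    rw [show 3 * inputBits w = inputBits w + 2 * inputBits w by omega, pow_add]
    exact Nat.mul_le_mul_right _ (hmn.trans Nat.lt_two_pow_self.le)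
  have hb : 2 * opt ≤ 2 ^ (4 * inputBits w) := by
    calc 2 * opt ≤ 2 ^ 1 * 2 ^ (3 * inputBits w) := Nat.mul_le_mul_left _ h1
      _ = 2 ^ (1 + 3 * inputBits w) := by rw [pow_add]
      _ ≤ _ := Nat.pow_le_pow_right (by norm_num) (by omega)
  obtain ⟨hfit, hX, hpw, hlam⟩ := IntGraph.fits_of_bound (I := G.toInt) hF hC hW hb
  have hfuel := IntGraph.fuel_le (I := G.toInt) hF hC hW hb
  have hnd : (A.map Fin.val).Nodup := hA.map Fin.val_injective
  -- The step limit of the program depends on the input, but beyond `fuel opt` the state does not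
  -- depend on the limit.
  rw [← (IntGraph.run_spec hF hs hnd hopt hfuel).2]
  have hWR : inputBits w ≤ inputBits w ^ 10 := Nat.le_self_pow (by norm_num) _
  have hdes : G.toInt.Describes (startMem w 0) := describes_inputArray G A
  have hscale : costScale (startMem w 0) ≤ 2 ^ inputBits w ^ 10 := by
    rw [startMem_zero, costScale_inputArray]
    exact (scale_lt G A).le.trans (Nat.pow_le_pow_right (by norm_num) hWR)
  obtain ⟨hpar, hrel⟩ := IntGraph.run_initCmd hF hdes (startMem_two w) (startMem_three w)
    (fun _ => startMem_of_le w) hfit (by omega) hscale hX hpw hlam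
  have e1 : initCmd.run (startMem w) 0 = inputArray w := Cmd.run_eq_of_not_writes rfl _
  have hcl : ∀ k, inputArray w (3 + 2 * G.nF + 3 * (G.nF * G.nC) + k) =
      (A.length :: A.map Fin.val).getD k 0 := fun k => by
    rw [← getD_encodeInput_client, show 3 + 2 * G.nF + 3 * (G.nF * G.nC) + k =
      2 + 2 * G.nF + 3 * (G.nF * G.nC) + k + 1 by omega, inputArray_succ]
  refine IntGraph.run_serveCmd hF hpar hfit hs hnd hopt hfuel hrel ?_ fun k hk => ?_
  · rw [e1, List.length_map]
    exact hcl 0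
  · rw [e1]
    have := hcl (k + 1)
    rw [List.getD_cons_succ, List.getD_eq_getElem _ _ hk] at this
    change inputArray w (4 + 2 * G.nF + 3 * (G.nF * G.nC) + k) = _
    rw [← this, show 4 + 2 * G.nF + 3 * (G.nF * G.nC) + k =
      3 + 2 * G.nF + 3 * (G.nF * G.nC) + (k + 1) by omega]

/-! ### Running time -/

/-- No feasibility is needed: truncation bounds the time on every input, and `onlineAlg` is by
definition what the program leaves in arrays 25 and 28, so only the output format has to be checked.
-/
theorem isPolyTime_onlineAlg : onlineAlg.IsPolyTime := by
  obtain ⟨K, hK⟩ := exists_exec_boundsProg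
  obtain ⟨K', d, hK'⟩ := Cmd.exists_exec (.seq (.seq initCmd serveCmd) outputCmd) (by decide)
  -- The polynomial form of `boundsScale`.
  let S : Polynomial ℕ := (2 * Polynomial.X + 1) ^ 10 + 20 * (2 * Polynomial.X + 1)
  refine ⟨.seq boundsProg (Cmd.seq (.seq initCmd serveCmd) outputCmd).compile,
    Polynomial.C K * (S + 1) ^ 2 + Polynomial.C K' * (S + 1) ^ d * (S + 2), fun ⟨G, A⟩ => ?_⟩
  set w := encodeInput ⟨G, A⟩ with hw
  obtain ⟨t, ht, he⟩ := hK w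
  obtain ⟨-, t', he', ht'⟩ := hK' _ (bounded_boundsMem w)
  refine ⟨_, t + t', Exec.seq he he', ?_, ?_⟩
  · have hserved : (Cmd.seq (.seq initCmd serveCmd) outputCmd).run
        (boundsMem w (2 ^ inputBits w ^ 10) (inputBits w ^ 10) w.length 0 0) =
        outputCmd.run (servedMem w) := rfl
    have hkeep : ∀ b ∈ [0, 2, 3], servedMem w b = startMem w b := fun b hb =>
      Cmd.run_eq_of_not_writes (by revert b; decide) _
    have e0 : servedMem w 0 = inputArray w := hkeep 0 (by decide)
    have e2 : servedMem w 2 0 = 2 ^ inputBits w ^ 10 := by rw [hkeep 2 (by decide)]; rfl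
    have e3 : servedMem w 3 0 = inputBits w ^ 10 := by rw [hkeep 3 (by decide)]; rfl
    have hWR : inputBits w ≤ inputBits w ^ 10 := Nat.le_self_pow (by norm_num) _
    have hR : inputBits w ^ 10 < 2 ^ inputBits w ^ 10 := Nat.lt_two_pow_self
    have hsb : 2 + 2 * G.nF + 3 * (G.nF * G.nC) < inputBits w := size_bound G A
    obtain ⟨h1, h2, h3⟩ := run_outputCmd (σ := servedMem w) (m := G.nF) (n := G.nC)
      (by rw [e0]; exact inputArray_one G A) (by rw [e0]; exact inputArray_two G A)
      (by rw [e3]; omega) (by rw [e2, e3]; exact hR.le) (by rw [e2]; omega)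
    rw [hserved]
    intro i hi
    rw [length_encodePurchase] at hi ⊢
    change i < G.nF + G.nF * G.nC + 1 at hi
    change _ = ((G.nF + G.nF * G.nC) :: encodePurchase (onlineAlg G A)).getD i 0
    cases i with
    | zero => rw [h1]; simp
    | succ i =>
      rw [List.getD_cons_succ]
      by_cases him : i < G.nF
      · rw [h2 i him]
        have := getD_encodePurchase_facility (onlineAlg G A) ⟨i, him⟩
        rw [this]
        simp [onlineAlg, ← hw]
      · obtain ⟨x, rfl⟩ := Nat.exists_eq_add_of_le (not_lt.1 him)
        have hx : x < G.nF * G.nC := by omega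
        have hn : 0 < G.nC := Nat.pos_of_ne_zero fun h => by simp [h] at hx
        rw [h3 x hx]
        have hdm := Nat.div_add_mod' x G.nC
        have := getD_encodePurchase_edge (onlineAlg G A)
          ⟨x / G.nC, (Nat.div_lt_iff_lt_mul hn).2 hx⟩ ⟨x % G.nC, Nat.mod_lt _ hn⟩
        simp only [hdm] at this
        rw [this]
        simp [onlineAlg, ← hw, hdm]
  · have hS : S.eval (wordSize w) = boundsScale (wordSize w) := by
      simp [S, boundsScale]
    simp only [Polynomial.eval_add, Polynomial.eval_mul, Polynomial.eval_pow, Polynomial.eval_C,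
      Polynomial.eval_one, hS, Polynomial.eval_ofNat]
    refine Nat.add_le_add ht (ht'.trans ?_)
    have h2 : boundsMem w (2 ^ inputBits w ^ 10) (inputBits w ^ 10) w.length 0 0 2 0 =
      2 ^ inputBits w ^ 10 := rfl
    have h3 : boundsMem w (2 ^ inputBits w ^ 10) (inputBits w ^ 10) w.length 0 0 3 0 =
      inputBits w ^ 10 := rfl
    rw [h2, h3, Nat.size_pow]
    have := inputBits_pow_le w
    exact Nat.mul_le_mul (Nat.mul_le_mul_left _ (Nat.pow_le_pow_left (by omega) _)) (by omega)

/-! ## Competitiveness -/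

theorem mem_total_facilities {alg : OnlineAlgorithm} {G : FCGraph} {A : List (Fin G.nC)}
    {i : Fin G.nF} : i ∈ (alg.total G A).facilities ↔
      ∃ k < A.length, i ∈ (alg G (A.take (k + 1))).facilities := by
  simp [OnlineAlgorithm.total]

theorem mem_total_edges {alg : OnlineAlgorithm} {G : FCGraph} {A : List (Fin G.nC)}
    {e : Fin G.nF × Fin G.nC} : e ∈ (alg.total G A).edges ↔
      ∃ k < A.length, e ∈ (alg G (A.take (k + 1))).edges := by
  simp [OnlineAlgorithm.total]

/-- A property of the final state that is preserved during the algorithm holds if and only if it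
holds after some client. -/
theorem exists_take_iff {α : Type} {A : List α} (hne : A ≠ []) (p : List α → Prop)
    (hp : ∀ l l', p l → p (l ++ l')) : (∃ k < A.length, p (A.take (k + 1))) ↔ p A := by
  have hlen := List.length_pos_of_ne_nil hne
  constructor
  · rintro ⟨k, -, hk⟩
    have := hp _ (A.drop (k + 1)) hk
    rwa [List.take_append_drop] at this
  · intro h
    refine ⟨A.length - 1, by omega, ?_⟩
    rwa [Nat.sub_add_cancel hlen, List.take_length]

/-- The total purchases of the online algorithm are described by the final state. -/
theorem total_onlineAlg {G : FCGraph} (hF : 0 < G.nF) (hC : 0 < G.nC) {A : List (Fin G.nC)}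
    (hne : A ≠ []) (hA : A.Nodup) {O : Finset ℕ} {a : ℕ → ℕ}
    (hs : G.toInt.Solution O a (A.map Fin.val)) :
    ∃ s : Config, G.toInt.BaseInv (G.toInt.costOpt O a (A.map Fin.val)) (A.map Fin.val) s ∧
      (∀ i, i ∈ (onlineAlg.total G A).facilities ↔ s.opn i ≠ 0) ∧
      (∀ e, e ∈ (onlineAlg.total G A).edges ↔ s.be (e.1 * G.nC + e.2) ≠ 0) ∧
      (G.toInt.fac s : ℝ) + G.toInt.conn s ≤
        64 * G.toInt.lam * G.toInt.mu * G.toInt.costOpt O a (A.map Fin.val) := by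
  set opt := G.toInt.costOpt O a (A.map Fin.val) with hopt
  set F := G.toInt.fuel opt
  have hnd : (A.map Fin.val).Nodup := hA.map Fin.val_injective
  have hrel : ∀ k, IntGraph.Rel (G.toInt.run F ((A.take (k + 1)).map Fin.val))
      (servedMem (encodeInput ⟨G, A.take (k + 1)⟩)) := fun k => by
    have hsplit : A.map Fin.val =
        (A.take (k + 1)).map Fin.val ++ (A.drop (k + 1)).map Fin.val := by
      rw [← List.map_append, List.take_append_drop]
    -- All prefixes are run with the step number belonging to the optimum of the whole sequence, so
    -- that their states are stages of a single run and `run_mono` applies.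
    refine rel_servedMem hF hC (hA.sublist (List.take_sublist _ _)) (O := O) (a := a) ?_ ?_
      fun c hf hd => IntGraph.costOpt_le_mul hs hnd hf hd
    · rw [hsplit] at hs
      exact hs.of_append
    · rw [hopt, hsplit]
      exact IntGraph.costOpt_le_append _
  refine ⟨G.toInt.run F (A.map Fin.val), (IntGraph.run_spec hF hs hnd le_rfl le_rfl).1.base,
    fun i => ?_, fun e => ?_, IntGraph.run_cost_le hF hC hs hnd le_rfl⟩
  · rw [mem_total_facilities, ← exists_take_iff hne
      (fun l => (G.toInt.run F (l.map Fin.val)).opn i ≠ 0) fun l l' h => by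
        rw [List.map_append]; exact (IntGraph.run_mono F i 0 _ _).1 h]
    refine exists_congr fun k => and_congr_right fun _ => ?_
    rw [← (hrel k).opn]
    simp [onlineAlg]
  · rw [mem_total_edges, ← exists_take_iff hne
      (fun l => (G.toInt.run F (l.map Fin.val)).be (e.1 * G.nC + e.2) ≠ 0) fun l l' h => by
        rw [List.map_append]; exact (IntGraph.run_mono F 0 _ _ _).2 h]
    refine exists_congr fun k => and_congr_right fun _ => ?_
    rw [← (hrel k).be]
    simp [onlineAlg]

/-- A feasible solution, in terms of the graph with integral costs. -/
theorem exists_solution {G : FCGraph} {A : List (Fin G.nC)} (hA : A.Nodup) (hne : A ≠ [])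
    {S : Purchase G} (hS : S.Feasible A.toFinset) : 0 < G.nF ∧ 0 < G.nC ∧
    ∃ (O : Finset ℕ) (a : ℕ → ℕ), G.toInt.Solution O a (A.map Fin.val) ∧
      (G.toInt.costOpt O a (A.map Fin.val) : ℝ) ≤ S.cost * G.scale := by
  obtain ⟨hsub, hS⟩ := hS
  obtain ⟨c0, hc0⟩ := List.exists_mem_of_ne_nil A hne
  obtain ⟨f0, -⟩ := hS c0 (List.mem_toFinset.2 hc0)
  have : Nonempty (Fin G.nF) := ⟨f0⟩
  choose! g hg hge using hS
  obtain ⟨a, hval⟩ : ∃ a : ℕ → ℕ, ∀ c : Fin G.nC, a c = g c :=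
    ⟨fun j => if h : j < G.nC then g ⟨j, h⟩ else 0, fun c => by simp⟩
  refine ⟨f0.pos, c0.pos, S.facilities.map Fin.valEmbedding, a, ⟨?_, ?_, ?_, ?_⟩, ?_⟩
  · intro x hx
    obtain ⟨i, -, rfl⟩ := Finset.mem_map.1 hx
    exact Finset.mem_range.2 i.2
  · intro j hj
    obtain ⟨c, -, rfl⟩ := List.mem_map.1 hj
    exact c.2
  · intro j hj
    obtain ⟨c, hc, rfl⟩ := List.mem_map.1 hj
    rw [hval]
    exact Finset.mem_map.2 ⟨g c, hg c (List.mem_toFinset.2 hc), rfl⟩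
  · intro j hj
    obtain ⟨c, hc, rfl⟩ := List.mem_map.1 hj
    rw [hval, G.toInt_e, if_pos (hsub (hge c (List.mem_toFinset.2 hc)))]
    exact one_ne_zero
  · have h1 : ((∑ i ∈ S.facilities.map Fin.valEmbedding, G.toInt.f i : ℕ) : ℝ) =
        (∑ f ∈ S.facilities, (G.facilityCost f : ℝ)) * G.scale := by
      rw [Finset.sum_map, Nat.cast_sum, Finset.sum_mul]
      refine Finset.sum_congr rfl fun i _ => ?_
      rw [← scaled_eq G (den_facilityCost_dvd G i), ← G.toInt_f i]
      rfl
    have h2 : (G.toInt.connOpt a (A.map Fin.val) : ℝ) =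
        (∑ c ∈ A.toFinset, (G.edgeCost (g c, c) : ℝ)) * G.scale := by
      unfold IntGraph.connOpt
      rw [List.map_map, ← List.sum_toFinset _ hA, Nat.cast_sum, Finset.sum_mul]
      refine Finset.sum_congr rfl fun c hc => ?_
      have he := hsub (hge c hc)
      rw [← scaled_eq G (den_edgeCost_dvd G he), Function.comp_apply, hval, G.toInt_d, if_pos he]
    -- One chosen edge per client: the edges differ in their client, so their sum is part of the
    -- purchased connection cost.
    have h3 : ∑ c ∈ A.toFinset, (G.edgeCost (g c, c) : ℝ) ≤ ∑ e ∈ S.edges, (G.edgeCost e : ℝ) := by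
      let ι : Fin G.nC ↪ Fin G.nF × Fin G.nC :=
        ⟨fun c => (g c, c), fun c c' h => (Prod.ext_iff.1 h).2⟩
      calc _ = ∑ e ∈ A.toFinset.map ι, (G.edgeCost e : ℝ) := by rw [Finset.sum_map]; rfl
        _ ≤ _ := Finset.sum_le_sum_of_subset_of_nonneg (fun e he => by
            obtain ⟨c, hc, rfl⟩ := Finset.mem_map.1 he
            exact hge c hc) fun _ _ _ => NNRat.cast_nonneg _
    unfold IntGraph.costOpt Purchase.cost
    rw [Nat.cast_add, h1, h2, NNRat.cast_add, NNRat.cast_sum, NNRat.cast_sum, ← add_mul]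
    gcongr

theorem isFeasible_onlineAlg : onlineAlg.IsFeasible := by
  rintro G A hA ⟨S, hS⟩
  by_cases hne : A = []
  · subst hne
    simp [OnlineAlgorithm.total, Purchase.Feasible]
  obtain ⟨hF, hC, O, a, hs, -⟩ := exists_solution hA hne hS
  obtain ⟨s, hb, hfac, hedge, -⟩ := total_onlineAlg hF hC hne hA hs
  refine ⟨fun ⟨i, j⟩ he => ?_, fun c hc => ?_⟩
  · have := hb.edge i i.2 j j.2 ((hedge (i, j)).1 he)
    rw [G.toInt_e] at this
    by_contra h
    exact this (if_neg h)
  · obtain ⟨i, hi, h1, h2⟩ := hb.served c (List.mem_map_of_mem (List.mem_toFinset.1 hc))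
    exact ⟨⟨i, hi⟩, (hfac ⟨i, hi⟩).2 h1, (hedge (⟨i, hi⟩, c)).2 h2⟩

/-- Links the rational cost of the purchases to the integral cost of the state. Cell `x` of the edge
indicator is identified with the pair of quotient and remainder modulo `n`, and scaling is exact on
edges. -/
theorem total_cost_mul_scale {G : FCGraph} {S : Purchase G} (hsub : S.edges ⊆ G.edges) {s : Config}
    (hfac : ∀ i, i ∈ S.facilities ↔ s.opn i ≠ 0)
    (hedge : ∀ e, e ∈ S.edges ↔ s.be (e.1 * G.nC + e.2) ≠ 0) :
    (S.cost : ℝ) * G.scale = G.toInt.fac s + G.toInt.conn s := by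
  have h1 : (G.toInt.fac s : ℝ) = (∑ f ∈ S.facilities, (G.facilityCost f : ℝ)) * G.scale := by
    unfold IntGraph.fac
    change ((∑ i ∈ Finset.range G.nF, if s.opn i ≠ 0 then G.toInt.f i else 0 : ℕ) : ℝ) = _
    rw [Finset.sum_range, Nat.cast_sum, Finset.sum_mul, ← Finset.sum_filter_add_sum_filter_not
      Finset.univ (fun i : Fin G.nF => i ∈ S.facilities)]
    rw [Finset.filter_mem_eq_inter, Finset.univ_inter, Finset.sum_eq_zero (s := Finset.filter _ _),
      add_zero]
    · refine Finset.sum_congr rfl fun i hi => ?_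
      rw [if_pos ((hfac i).1 hi), G.toInt_f, scaled_eq G (den_facilityCost_dvd G i)]
    · intro i hi
      rw [if_neg fun h => (Finset.mem_filter.1 hi).2 ((hfac i).2 h), Nat.cast_zero]
  have h2 : (G.toInt.conn s : ℝ) = (∑ e ∈ S.edges, (G.edgeCost e : ℝ)) * G.scale := by
    unfold IntGraph.conn
    change ((∑ x ∈ Finset.range (G.nF * G.nC),
      if s.be x ≠ 0 then G.toInt.d (x / G.nC) (x % G.nC) else 0 : ℕ) : ℝ) = _
    rw [Finset.sum_range, ← Equiv.sum_comp finProdFinEquiv, Nat.cast_sum, Finset.sum_mul,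
      ← Finset.sum_filter_add_sum_filter_not Finset.univ
        (fun e : Fin G.nF × Fin G.nC => e ∈ S.edges)]
    have hx : ∀ e : Fin G.nF × Fin G.nC, ((finProdFinEquiv e : Fin (G.nF * G.nC)) : ℕ) =
        e.1 * G.nC + e.2 := fun e => by
      rw [finProdFinEquiv_apply_val]; ring
    rw [Finset.filter_mem_eq_inter, Finset.univ_inter, Finset.sum_eq_zero (s := Finset.filter _ _),
      add_zero]
    · refine Finset.sum_congr rfl fun e he => ?_
      rw [hx, if_pos ((hedge e).1 he), IntGraph.flat_index_div e.2.2,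
        IntGraph.flat_index_mod e.2.2, G.toInt_d, if_pos (hsub he),
        scaled_eq G (den_edgeCost_dvd G (hsub he))]
    · intro e he
      rw [hx, if_neg fun h => (Finset.mem_filter.1 he).2 ((hedge e).2 h), Nat.cast_zero]
  rw [h1, h2, ← add_mul, Purchase.cost, NNRat.cast_add, NNRat.cast_sum, NNRat.cast_sum]

theorem size_le_two_mul_logb {n : ℕ} (hn : 2 ≤ n) : (n.size : ℝ) ≤ 2 * Real.logb 2 n := by
  obtain ⟨p, hp⟩ : ∃ p, n.size = p + 1 := ⟨n.size - 1, by
    have := Nat.size_pos.2 (show 0 < n by omega); omega⟩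
  have h1 : 2 ^ p ≤ n := Nat.lt_size.1 (by omega)
  have h2 : (p : ℝ) ≤ Real.logb 2 n := by
    rw [Real.le_logb_iff_rpow_le (by norm_num) (by exact_mod_cast (show 0 < n by omega)),
      Real.rpow_natCast]
    exact_mod_cast h1
  have h3 : (1 : ℝ) ≤ Real.logb 2 n := by
    rw [Real.le_logb_iff_rpow_le (by norm_num) (by exact_mod_cast (show 0 < n by omega)),
      Real.rpow_one]
    exact_mod_cast hn
  rw [hp]
  push_cast
  linarith

theorem isCompetitiveOn_onlineAlg {G : FCGraph} (hF : 2 ≤ G.nF) (hC : 2 ≤ G.nC) :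
    onlineAlg.IsCompetitiveOn G (512 * (Real.logb 2 G.nF *
      (Real.logb 2 G.nC + Real.logb 2 (Real.logb 2 G.nF)))) := by
  intro A hA S hS
  have hone : (1 : ℝ) ≤ Real.logb 2 G.nF := by
    rw [Real.le_logb_iff_rpow_le (by norm_num) (by exact_mod_cast (show 0 < G.nF by omega)),
      Real.rpow_one]
    exact_mod_cast hF
  have hloglog : 0 ≤ Real.logb 2 (Real.logb 2 G.nF) := Real.logb_nonneg (by norm_num) hone
  have hm := size_le_two_mul_logb hF
  have hn := size_le_two_mul_logb hC
  have hlogC : 0 ≤ Real.logb 2 G.nC := by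
    have : (0 : ℝ) ≤ G.nC.size := Nat.cast_nonneg _
    linarith
  have hcost : (0 : ℝ) ≤ S.cost := NNRat.cast_nonneg _
  by_cases hne : A = []
  · subst hne
    simp only [OnlineAlgorithm.total, Purchase.cost, List.length_nil, Finset.range_zero,
      Finset.biUnion_empty, Finset.sum_empty, add_zero, NNRat.cast_zero]
    positivity
  obtain ⟨hF', hC', O, a, hs, hopt⟩ := exists_solution hA hne hS
  obtain ⟨s, hb, hfac, hedge, hle⟩ := total_onlineAlg hF' hC' hne hA hs
  have hsub := (isFeasible_onlineAlg G A hA ⟨S, hS⟩).1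
  have htotal := total_cost_mul_scale hsub hfac hedge
  have hD : (0 : ℝ) < G.scale := by exact_mod_cast G.scale_pos
  have hlam : (G.toInt.lam : ℝ) = 2 * G.nC.size := by
    change ((2 * G.nC.size : ℕ) : ℝ) = _
    push_cast; ring
  have hmu : (G.toInt.mu : ℝ) = G.nF.size := rfl
  -- Here `512 = 64 * 2 * 2 * 2`: one factor from `lam = 2 * L`, two from comparing bit lengths with
  -- logarithms. The double logarithm is merely nonnegative, as there are at least two facilities.
  have hratio : 64 * (G.toInt.lam : ℝ) * G.toInt.mu ≤ 512 * (Real.logb 2 G.nF *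
      (Real.logb 2 G.nC + Real.logb 2 (Real.logb 2 G.nF))) := by
    rw [hlam, hmu]
    have h1 : (G.nC.size : ℝ) * G.nF.size ≤ (2 * Real.logb 2 G.nC) * (2 * Real.logb 2 G.nF) :=
      mul_le_mul hn hm (Nat.cast_nonneg _) (by positivity)
    have h2 : 0 ≤ Real.logb 2 G.nF * Real.logb 2 (Real.logb 2 G.nF) := by positivity
    nlinarith
  refine le_of_mul_le_mul_right ?_ hD
  rw [htotal]
  refine hle.trans ?_
  rw [mul_assoc _ (S.cost : ℝ)]
  exact mul_le_mul hratio hopt (Nat.cast_nonneg _) (by positivity)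

theorem theorem1 :
    ∃ alg : OnlineAlgorithm, alg.IsPolyTime ∧ alg.IsFeasible ∧
      ∃ K : ℝ, ∀ G : FCGraph, 2 ≤ G.nF → 2 ≤ G.nC →
        alg.IsCompetitiveOn G
          (K * (Real.logb 2 G.nF *
            (Real.logb 2 G.nC + Real.logb 2 (Real.logb 2 G.nF)))) :=
  ⟨onlineAlg, isPolyTime_onlineAlg, isFeasible_onlineAlg, 512,
    fun _ hF hC => isCompetitiveOn_onlineAlg hF hC⟩
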